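/- Let $n \ge 5$. An algebraic curvature tensor in dimension $n$ is a four-tensor $R=(R_{ijkl})$ on $\mathbb{R}^n$ with $R_{ijkl}=-R_{jikl}=-R_{ijlk}=R_{klij}$ and $R_{ijkl}+R_{jkil}+R_{kijl}=0$; put $\mathrm{Ric}_{ik}=\sum_j R_{ijkj}$, $\mathrm{scal}=\sum_i \mathrm{Ric}_{ii}$, $(\mathrm{id}\owedge\mathrm{id})_{ijkl}=2(\delta_{ik}\delta_{jl}-\delta_{il}\delta_{jk})$, and $Q(R)=R^2+R^\#$, where $(R^2)_{ijkl}=\sum_{p,q}R_{ijpq}R_{klpq}$ and $(R^\#)_{ijkl}=2\sum_{p,q}(R_{ipkq}R_{jplq}-R_{iplq}R_{jpkq})$. Let $\mathrm{PIC}$ be the set of all algebraic curvature tensors $R$ such that $R(\varphi,\bar\varphi)\ge 0$ for every $\varphi=(e_1+ie_2)\wedge(e_3+ie_4)$ with $\{e_1,e_2,e_3,e_4\}$ an orthonormal four-frame. **Theorem 2.1.** Let $\mathcal{K}$ be a compact set of algebraic curvature tensors in dimension $n$ contained in the interior of $\mathrm{PIC}$, and let $T>0$. Then there exist real numbers $\theta>0$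 and $N>0$ and a family $\{\mathcal{G}^{(0)}_t : t\in[0,T]\}$ of nonempty closed, convex, $O(n)$-invariant sets of algebraic curvature tensors such that: 1. the family is continuous in $t$ (in the sense of Painlevé–Kuratowski convergence of closed sets: if $t_k\to t$, $R_k\in\mathcal{G}^{(0)}_{t_k}$ and $R_k\to R$, then $R\in\mathcal{G}^{(0)}_t$; and every element of $\mathcal{G}^{(0)}_t$ is a limit of elements of $\mathcal{G}^{(0)}_s$ as $s\to t$); 2. the family is invariant under the Hamilton ODE $\frac{d}{dt}R=Q(R)$: if $0\le t_0\le t_1\le T$, $R(t)$ solves the ODE on $[t_0,t_1]$ and $R(t_0)\in\mathcal{G}^{(0)}_{t_0}$, then $R(t)\in\mathcal{G}^{(0)}_t$ for all $t\in[t_0,t_1]$; 3. $\mathcal{K}\subset\mathcal{G}^{(0)}_0$; 4. for all $t\in[0,T]$, $$\mathcal{G}^{(0)}_t\subset\{R: R-\theta\,\mathrm{scal}\,\mathrm{id}\owedge\mathrm{id}\in\mathrm{PIC}\}\cap\{R:\mathrm{Ric}_{11}+\mathrm{Ric}_{22}-\theta\,\mathrm{scal}+N\ge 0\},$$ where the last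 inequality is required for $\mathrm{Ric}_{jj}=\mathrm{Ric}(e_j,e_j)$ and every orthonormal pair $\{e_1,e_2\}$. -/

import Mathlib

open Set

namespace AlgCurv

/-- The real vector space of algebraic curvature tensors in dimension `n`, given by their
components `R i j k l` in the standard basis of `ℝⁿ`: antisymmetry in each pair of indices,
symmetry under exchange of the two pairs, and the first Bianchi identity. -/
def curvatureSubmodule (n : ℕ) : Submodule ℝ (Fin n → Fin n → Fin n → Fin n → ℝ) where
  carrier := {R | (∀ i j k l, R i j k l = -R j i k l) ∧ (∀ i j k l, R i j k l = -R i j l k) ∧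
    (∀ i j k l, R i j k l = R k l i j) ∧
    (∀ i j k l, R i j k l + R j k i l + R k i j l = 0)}
  zero_mem' := by simp
  add_mem' := by
    rintro R S ⟨h1, h2, h3, h4⟩ ⟨g1, g2, g3, g4⟩
    refine ⟨fun i j k l => ?_, fun i j k l => ?_, fun i j k l => ?_, fun i j k l => ?_⟩
    · simp only [Pi.add_apply]; linarith [h1 i j k l, g1 i j k l]
    · simp only [Pi.add_apply]; linarith [h2 i j k l, g2 i j k l]
    · simp only [Pi.add_apply]; linarith [h3 i j k l, g3 i j k l]
    · simp only [Pi.add_apply]; linarith [h4 i j k l, g4 i j k l]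
  smul_mem' := by
    rintro c R ⟨h1, h2, h3, h4⟩
    refine ⟨fun i j k l => ?_, fun i j k l => ?_, fun i j k l => ?_, fun i j k l => ?_⟩
    · simp only [Pi.smul_apply, smul_eq_mul]; rw [h1 i j k l]; ring
    · simp only [Pi.smul_apply, smul_eq_mul]; rw [h2 i j k l]; ring
    · simp only [Pi.smul_apply, smul_eq_mul]; rw [h3 i j k l]
    · simp only [Pi.smul_apply, smul_eq_mul]; rw [← mul_add, ← mul_add, h4 i j k l, mul_zero]

/-- Algebraic curvature tensors in dimension `n`, a finite-dimensional real normed space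
(topological notions do not depend on the norm). -/
abbrev CurvTensor (n : ℕ) : Type := curvatureSubmodule n

variable {n : ℕ}

theorem mem_curvatureSubmodule {R : Fin n → Fin n → Fin n → Fin n → ℝ} :
    R ∈ curvatureSubmodule n ↔ (∀ i j k l, R i j k l = -R j i k l) ∧
      (∀ i j k l, R i j k l = -R i j l k) ∧ (∀ i j k l, R i j k l = R k l i j) ∧
      (∀ i j k l, R i j k l + R j k i l + R k i j l = 0) :=
  Iff.rfl

/-- The component `R_{ijkl}` in the standard basis. -/
def CurvTensor.comp (R : CurvTensor n) (i j k l : Fin n) : ℝ := R.1 i j k l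

theorem CurvTensor.antisymm_left (R : CurvTensor n) (i j k l : Fin n) :
    R.comp i j k l = -R.comp j i k l := R.2.1 i j k l

theorem CurvTensor.antisymm_right (R : CurvTensor n) (i j k l : Fin n) :
    R.comp i j k l = -R.comp i j l k := R.2.2.1 i j k l

theorem CurvTensor.pair_symm (R : CurvTensor n) (i j k l : Fin n) :
    R.comp i j k l = R.comp k l i j := R.2.2.2.1 i j k l

theorem CurvTensor.bianchi (R : CurvTensor n) (i j k l : Fin n) :
    R.comp i j k l + R.comp j k i l + R.comp k i j l = 0 := R.2.2.2.2 i j k l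

/-! ### Ricci and scalar curvature -/

/-- `Ric_{ik} = ∑_j R_{ijkj}`; with this convention `R_{ijij}` is a sectional curvature. -/
def ricci (R : CurvTensor n) (i k : Fin n) : ℝ := ∑ j, R.comp i j k j

/-- The quadratic form `Ric(v, v)`. -/
def ricciQuad (R : CurvTensor n) (v : EuclideanSpace ℝ (Fin n)) : ℝ :=
  ∑ i, ∑ k, ricci R i k * v i * v k

/-- The scalar curvature, the trace of the Ricci tensor. -/
def scal (R : CurvTensor n) : ℝ := ∑ i, ricci R i i

/-! ### The Kulkarni-Nomizu product -/

/-- The Kulkarni-Nomizu product of two symmetric bilinear forms,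
`A_{ik} B_{jl} - A_{il} B_{jk} - A_{jk} B_{il} + A_{jl} B_{ik}`. -/
def kulkarniNomizu (A B : Matrix (Fin n) (Fin n) ℝ) (hA : A.IsSymm) (hB : B.IsSymm) :
    CurvTensor n :=
  ⟨fun i j k l => A i k * B j l - A i l * B j k - A j k * B i l + A j l * B i k, by
    refine mem_curvatureSubmodule.2
      ⟨fun i j k l => ?_, fun i j k l => ?_, fun i j k l => ?_, fun i j k l => ?_⟩
    · ring
    · ring
    · rw [hA.apply i k, hA.apply j l, hA.apply j k, hA.apply i l,
        hB.apply i k, hB.apply j l, hB.apply j k, hB.apply i l]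
      ring
    · rw [hA.apply i j, hA.apply i k, hA.apply j k, hB.apply i j, hB.apply i k, hB.apply j k]
      ring⟩

/-- The Kulkarni-Nomizu product of the standard inner product with itself. -/
def idKNid (n : ℕ) : CurvTensor n :=
  kulkarniNomizu 1 1 Matrix.isSymm_one Matrix.isSymm_one

/-! ### The cone PIC -/

/-- The complex multilinear extension `R(x, y, z, w)` for `x, y, z, w ∈ ℂⁿ`. -/
def complexEval (R : CurvTensor n) (x y z w : Fin n → ℂ) : ℂ :=
  ∑ i, ∑ j, ∑ k, ∑ l, (R.comp i j k l : ℂ) * x i * y j * z k * w l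

/-- The complex vector `u + i v` for `u, v ∈ ℝⁿ`. -/
def complexVec (u v : EuclideanSpace ℝ (Fin n)) : Fin n → ℂ :=
  fun i => (u i : ℂ) + Complex.I * (v i : ℂ)

/-- The cone of algebraic curvature tensors with nonnegative isotropic curvature:
`R(φ, φ̄) ≥ 0` for `φ = (e₁ + i e₂) ∧ (e₃ + i e₄)` and every orthonormal four-frame, where
`R(x ∧ y, z ∧ w) = R(x, y, z, w)`. (The number `R(φ, φ̄)` is always real.) -/
def PIC (n : ℕ) : Set (CurvTensor n) :=
  {R | ∀ e : Fin 4 → EuclideanSpace ℝ (Fin n), Orthonormal ℝ e →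
    0 ≤ (complexEval R (complexVec (e 0) (e 1)) (complexVec (e 2) (e 3))
      (star (complexVec (e 0) (e 1))) (star (complexVec (e 2) (e 3)))).re}

/-! ### The quadratic term of the Hamilton ODE -/

/-- The tensor `R²`, with components `∑_{p,q} R_{ijpq} R_{klpq}`. -/
def sqTerm (R : CurvTensor n) (i j k l : Fin n) : ℝ :=
  ∑ p, ∑ q, R.comp i j p q * R.comp k l p q

/-- The tensor `R^#`, with components `2 ∑_{p,q} (R_{ipkq} R_{jplq} - R_{iplq} R_{jpkq})`. -/
def sharpTerm (R : CurvTensor n) (i j k l : Fin n) : ℝ :=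
  2 * ∑ p, ∑ q, (R.comp i p k q * R.comp j p l q - R.comp i p l q * R.comp j p k q)

def auxB (R : CurvTensor n) (i j k l : Fin n) : ℝ :=
  ∑ p, ∑ q, R.comp i p j q * R.comp k p l q

theorem auxB_comm (R : CurvTensor n) (i j k l : Fin n) :
    auxB R i j k l = auxB R k l i j := by
  simp only [auxB, mul_comm]

theorem auxB_flip (R : CurvTensor n) (i j k l : Fin n) :
    auxB R i j k l = auxB R j i l k := by
  unfold auxB
  rw [Finset.sum_comm]
  refine Finset.sum_congr rfl fun p _ => Finset.sum_congr rfl fun q _ => ?_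
  rw [R.pair_symm i q j p, R.pair_symm k q l p]

theorem sharpTerm_eq (R : CurvTensor n) (i j k l : Fin n) :
    sharpTerm R i j k l = 2 * (auxB R i k j l - auxB R i l j k) := by
  simp only [sharpTerm, auxB, Finset.sum_sub_distrib]

theorem sqTerm_eq (R : CurvTensor n) (i j k l : Fin n) :
    sqTerm R i j k l = 2 * (auxB R i j k l - auxB R i j l k) := by
  have key : ∀ a b p q, R.comp a b p q = R.comp a p b q - R.comp a q b p := by
    intro a b p q
    have h1 := R.bianchi a b p q
    have h2 := R.antisymm_left p a b q
    have h3 := R.pair_symm b p a q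
    have h4 := R.antisymm_right a q b p
    linarith
  have e1 : sqTerm R i j k l = ∑ p, ∑ q, (R.comp i p j q * R.comp k p l q
      - R.comp i p j q * R.comp l p k q) + ∑ p, ∑ q, (R.comp i q j p * R.comp k q l p
      - R.comp i q j p * R.comp l q k p) := by
    rw [sqTerm, ← Finset.sum_add_distrib]
    refine Finset.sum_congr rfl fun p _ => ?_
    rw [← Finset.sum_add_distrib]
    refine Finset.sum_congr rfl fun q _ => ?_
    rw [key i j p q, key k l p q, R.pair_symm l p k q, R.pair_symm l q k p]
    ring
  rw [e1, Finset.sum_comm (f := fun p q => R.comp i q j p * R.comp k q l p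
      - R.comp i q j p * R.comp l q k p)]
  simp only [auxB, Finset.sum_sub_distrib]
  ring

/-- `Q(R) = R² + R^#`, again an algebraic curvature tensor. -/
def Q (R : CurvTensor n) : CurvTensor n :=
  ⟨fun i j k l => sqTerm R i j k l + sharpTerm R i j k l, by
    refine mem_curvatureSubmodule.2
      ⟨fun i j k l => ?_, fun i j k l => ?_, fun i j k l => ?_, fun i j k l => ?_⟩
    · simp only [sqTerm_eq, sharpTerm_eq]
      linarith [auxB_flip R i j k l, auxB_flip R i j l k, auxB_comm R i k j l,
        auxB_comm R i l j k]
    · simp only [sqTerm_eq, sharpTerm_eq]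
      ring
    · simp only [sqTerm_eq, sharpTerm_eq]
      linarith [auxB_comm R i j k l, auxB_comm R i j l k, auxB_flip R l k i j,
        auxB_flip R i k j l, auxB_comm R k j l i, auxB_flip R l i k j]
    · simp only [sqTerm_eq, sharpTerm_eq]
      linarith [auxB_comm R i l j k, auxB_comm R j k l i, auxB_flip R l i j k,
        auxB_flip R i j l k, auxB_comm R j l k i, auxB_flip R k i l j,
        auxB_comm R k l i j, auxB_flip R k j i l, auxB_comm R k j i l]⟩

/-! ### The action of the orthogonal group -/

/-- The components `∑ A_{ip} A_{jq} A_{kr} A_{ls} R_{pqrs}` of the transformed tensor. -/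
def rotateComp (A : Matrix (Fin n) (Fin n) ℝ) (R : CurvTensor n) (i j k l : Fin n) : ℝ :=
  ∑ p, ∑ q, ∑ r, ∑ s, A i p * A j q * A k r * A l s * R.comp p q r s

/-- The action of a matrix (in the application: an orthogonal one) on curvature tensors. -/
def rotate (A : Matrix (Fin n) (Fin n) ℝ) (R : CurvTensor n) : CurvTensor n :=
  ⟨rotateComp A R, by
    refine mem_curvatureSubmodule.2
      ⟨fun i j k l => ?_, fun i j k l => ?_, fun i j k l => ?_, fun i j k l => ?_⟩
    · unfold rotateComp
      rw [Finset.sum_comm]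
      simp only [← Finset.sum_neg_distrib]
      refine Finset.sum_congr rfl fun p _ => Finset.sum_congr rfl fun q _ =>
        Finset.sum_congr rfl fun r _ => Finset.sum_congr rfl fun s _ => ?_
      rw [R.antisymm_left q p r s]
      ring
    · unfold rotateComp
      simp only [← Finset.sum_neg_distrib]
      refine Finset.sum_congr rfl fun p _ => Finset.sum_congr rfl fun q _ => ?_
      rw [Finset.sum_comm]
      refine Finset.sum_congr rfl fun r _ => Finset.sum_congr rfl fun s _ => ?_
      rw [R.antisymm_right p q s r]
      ring
    · unfold rotateComp
      rw [Finset.sum_comm_cycle]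
      refine Finset.sum_congr rfl fun p _ => ?_
      rw [Finset.sum_comm_cycle]
      refine Finset.sum_congr rfl fun q _ => Finset.sum_congr rfl fun r _ =>
        Finset.sum_congr rfl fun s _ => ?_
      rw [R.pair_symm r s p q]
      ring
    · have e1 : rotateComp A R j k i l = ∑ p, ∑ q, ∑ r, ∑ s,
          A i p * A j q * A k r * A l s * R.comp q r p s := by
        unfold rotateComp
        rw [Finset.sum_comm_cycle]
        refine Finset.sum_congr rfl fun p _ => Finset.sum_congr rfl fun q _ =>
          Finset.sum_congr rfl fun r _ => Finset.sum_congr rfl fun s _ => ?_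
        ring
      have e2 : rotateComp A R k i j l = ∑ p, ∑ q, ∑ r, ∑ s,
          A i p * A j q * A k r * A l s * R.comp r p q s := by
        unfold rotateComp
        rw [Finset.sum_comm_cycle, Finset.sum_comm_cycle]
        refine Finset.sum_congr rfl fun p _ => Finset.sum_congr rfl fun q _ =>
          Finset.sum_congr rfl fun r _ => Finset.sum_congr rfl fun s _ => ?_
        ring
      rw [e1, e2, rotateComp]
      simp only [← Finset.sum_add_distrib]
      refine Finset.sum_eq_zero fun p _ => Finset.sum_eq_zero fun q _ =>
        Finset.sum_eq_zero fun r _ => Finset.sum_eq_zero fun s _ => ?_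
      linear_combination (A i p * A j q * A k r * A l s) * R.bianchi p q r s⟩

/-- A set of curvature tensors is `O(n)`-invariant. -/
def IsOrthogonallyInvariant (G : Set (CurvTensor n)) : Prop :=
  ∀ A ∈ Matrix.orthogonalGroup (Fin n) ℝ, ∀ R ∈ G, rotate A R ∈ G

/-! ### Families of sets -/

/-- Continuity of a family of closed sets `G t`, `t ∈ [0, T]`, in the sense of
Painlevé-Kuratowski convergence: limits of `R_k ∈ G t_k` with `t_k → t` lie in `G t`, and every
element of `G t` is approximated by elements of `G s` as `s → t`. -/
def IsContinuousFamily (T : ℝ) (G : ℝ → Set (CurvTensor n)) : Prop :=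
  IsClosed {p : ℝ × CurvTensor n | p.1 ∈ Icc 0 T ∧ p.2 ∈ G p.1} ∧
  LowerHemicontinuousOn G (Icc 0 T)

/-- `R` solves the Hamilton ODE `d/dt R = Q(R)` on `[a, b]`. -/
def SolvesHamiltonODE (a b : ℝ) (R : ℝ → CurvTensor n) : Prop :=
  ∀ t ∈ Icc a b, HasDerivWithinAt R (Q (R t)) (Icc a b) t

/-- The family `G t`, `t ∈ [0, T]`, is invariant under the Hamilton ODE: a solution which starts
in `G t₀` at some time `t₀ ∈ [0, T]` lies in `G t` at all later times `t ≤ T` for which it is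
defined. -/
def IsHamiltonInvariant (T : ℝ) (G : ℝ → Set (CurvTensor n)) : Prop :=
  ∀ t₀ t₁ : ℝ, 0 ≤ t₀ → t₀ ≤ t₁ → t₁ ≤ T → ∀ R : ℝ → CurvTensor n,
    SolvesHamiltonODE t₀ t₁ R → R t₀ ∈ G t₀ → ∀ t ∈ Icc t₀ t₁, R t ∈ G t

end AlgCurv

/-!
The family is constant in time. For parameters `b`, `κ`, `N` it equals `pinchedSet n b κ N`, the set
of curvature tensors which satisfy in every orthonormal basis the linear inequalities

* (a) the tensor `R - (b Ric - g scal id) ∧ id`, with `g = (1/2 + 1/(4n)) b²`, has isotropic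
  curvature at least `8 κ`;
* (b) `Ric_{ii} + Ric_{jj} + δ (Ric_{ii} + Ric_{jj} - 2 R_{ijij}) ≥ (2 - 1/(8n)) b scal - N`, with
  `δ = 2 (n - 2) b`;
* (c) `Ric_{ii} + Ric_{jj} ≥ (2 - 1/(4n)) b scal - N`,

where `b` is tiny compared with `n`, `κ`, `N` (`SmallParams`). Being an intersection of half-spaces
permuted by `O(n)`, the set is closed, convex and `O(n)`-invariant. A compact subset of the interior
of `PIC` satisfies (a) for small `κ` and `b`, and the Ricci conditions for large `N`
(`exists_subset_pinchedSet`). Conversely (a) makes the isotropic curvature dominate `b² scal`, so the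
first inclusion of the conclusion holds with `θ = b² / 4`; (c) gives the second one.

For the invariance under `R' = Q(R)`, a first-exit argument (`forall_le_of_solution`) applies to any
intersection of compactly many half-spaces. The solution is pushed inwards by a multiple of
`e^{Lt} id ∧ id`, on which every functional is positive; what remains is to show that a functional
which attains its bound at a tensor `R` of the set is nonnegative on `Q(R)`.

* For (a), let `U` be the modified tensor. It lies in `PIC` after subtracting `κ id ∧ id`, and `Q(R)`
  differs from `Q(U)` by terms depending on the Ricci tensor alone (`comp_Q_add_knId`, `isoPinch_Q`).
  On a null frame of a tensor in `PIC` the isotropic curvature of `Q` is nonnegative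
  (`isoComp_Q_nonneg`). This is the argument of Brendle and Schoen: the first variations of the
  frame kill the tangential and mixed terms of `R^#`, and the second variation, taken along `(z, w)`
  and `(i z, i w)`, says that a Hermitian block matrix is positive semidefinite, so that the remaining
  terms form the trace of a product of two positive semidefinite matrices (`block_trace_nonneg`). The
  Ricci terms are handled with (c) applied to all two-planes of the four-plane (`ricci_det_ge`); the
  excess of `g` over `b²/2` yields a positive multiple of `|Ric|²`, which absorbs the errors
  (`isoPinch_boundary_real`).
* For (b), the first variation of the two-plane diagonalizes the Ricci tensor up to terms
  proportional to `δ`, after a choice of basis in the complement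
  (`ricPinch_Q_nonneg_of_diagonal`). The reaction term `∑ (R_{ipip} + R_{jpjp}) Ric_{pp}` is bounded
  below through (a) and the weighted inequality `weighted_sum_ge`. It dominates `ω |Ric|²` and the
  error caused by `δ` (`reaction_nonneg`).
* For (c), comparison with (b) shows that on the boundary `Ric_{ii} + Ric_{jj} - 2 R_{ijij}` is at
  least a fixed multiple of `scal`. The quadratic term of the reaction then wins for small `b`
  (`reaction_nonneg_of_excess`).
-/


namespace AlgCurv

variable {n : ℕ}

section

/-! ### Components, evaluation on vectors, rotations -/

@[simp] theorem comp_add (R S : CurvTensor n) (i j k l : Fin n) :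
    (R + S).comp i j k l = R.comp i j k l + S.comp i j k l := rfl

@[simp] theorem comp_sub (R S : CurvTensor n) (i j k l : Fin n) :
    (R - S).comp i j k l = R.comp i j k l - S.comp i j k l := rfl

@[simp] theorem comp_smul (c : ℝ) (R : CurvTensor n) (i j k l : Fin n) :
    (c • R).comp i j k l = c * R.comp i j k l := rfl

theorem CurvTensor.ext_comp {R S : CurvTensor n}
    (h : ∀ i j k l, R.comp i j k l = S.comp i j k l) : R = S :=
  Subtype.ext (funext fun i => funext fun j => funext fun k => funext fun l => h i j k l)

theorem CurvTensor.comp_self_left (R : CurvTensor n) (i k l : Fin n) : R.comp i i k l = 0 := by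
  linarith [R.antisymm_left i i k l]

theorem CurvTensor.comp_self_right (R : CurvTensor n) (i j k : Fin n) : R.comp i j k k = 0 := by
  linarith [R.antisymm_right i j k k]

/-- The value of a four-index array, viewed as a quadrilinear form, on four vectors. -/
def arrayEval (F : Fin n → Fin n → Fin n → Fin n → ℝ) (x y z w : Fin n → ℝ) : ℝ :=
  ∑ i, ∑ j, ∑ k, ∑ l, x i * y j * z k * w l * F i j k l

/-- The value `R(x, y, z, w)` of a curvature tensor on four vectors. -/
def CurvTensor.eval (R : CurvTensor n) (x y z w : Fin n → ℝ) : ℝ := arrayEval R.comp x y z w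

theorem comp_rotate (A : Matrix (Fin n) (Fin n) ℝ) (R : CurvTensor n) (i j k l : Fin n) :
    (rotate A R).comp i j k l = R.eval (A i) (A j) (A k) (A l) := rfl

theorem arrayEval_swap_right (F : Fin n → Fin n → Fin n → Fin n → ℝ) (x y z w : Fin n → ℝ) :
    arrayEval F x y w z = arrayEval (fun i j k l => F i j l k) x y z w := by
  unfold arrayEval
  refine Finset.sum_congr rfl fun i _ => Finset.sum_congr rfl fun j _ => ?_
  rw [Finset.sum_comm]
  refine Finset.sum_congr rfl fun k _ => Finset.sum_congr rfl fun l _ => ?_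
  ring

theorem arrayEval_swap_mid (F : Fin n → Fin n → Fin n → Fin n → ℝ) (x y z w : Fin n → ℝ) :
    arrayEval F x z y w = arrayEval (fun i j k l => F i k j l) x y z w := by
  unfold arrayEval
  refine Finset.sum_congr rfl fun i _ => ?_
  rw [Finset.sum_comm]
  refine Finset.sum_congr rfl fun j _ => Finset.sum_congr rfl fun k _ =>
    Finset.sum_congr rfl fun l _ => ?_
  ring

theorem arrayEval_swap_left (F : Fin n → Fin n → Fin n → Fin n → ℝ) (x y z w : Fin n → ℝ) :
    arrayEval F y x z w = arrayEval (fun i j k l => F j i k l) x y z w := by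
  unfold arrayEval
  rw [Finset.sum_comm]
  refine Finset.sum_congr rfl fun i _ => Finset.sum_congr rfl fun j _ =>
    Finset.sum_congr rfl fun k _ => Finset.sum_congr rfl fun l _ => ?_
  ring

theorem arrayEval_add (F G : Fin n → Fin n → Fin n → Fin n → ℝ) (x y z w : Fin n → ℝ) :
    arrayEval (fun i j k l => F i j k l + G i j k l) x y z w
      = arrayEval F x y z w + arrayEval G x y z w := by
  simp only [arrayEval, mul_add, Finset.sum_add_distrib]

theorem arrayEval_smul (c : ℝ) (F : Fin n → Fin n → Fin n → Fin n → ℝ) (x y z w : Fin n → ℝ) :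
    arrayEval (fun i j k l => c * F i j k l) x y z w = c * arrayEval F x y z w := by
  simp only [arrayEval, Finset.mul_sum]
  refine Finset.sum_congr rfl fun i _ => Finset.sum_congr rfl fun j _ =>
    Finset.sum_congr rfl fun k _ => Finset.sum_congr rfl fun l _ => ?_
  ring

theorem arrayEval_add_left (F : Fin n → Fin n → Fin n → Fin n → ℝ) (x x' y z w : Fin n → ℝ) :
    arrayEval F (x + x') y z w = arrayEval F x y z w + arrayEval F x' y z w := by
  simp only [arrayEval, Pi.add_apply, add_mul, Finset.sum_add_distrib]

theorem arrayEval_smul_left (F : Fin n → Fin n → Fin n → Fin n → ℝ) (c : ℝ)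
    (x y z w : Fin n → ℝ) :
    arrayEval F (c • x) y z w = c * arrayEval F x y z w := by
  simp only [arrayEval, Pi.smul_apply, smul_eq_mul, Finset.mul_sum, mul_assoc]

namespace CurvTensor

variable (R : CurvTensor n) (c : ℝ) (x x' y y' z z' w w' : Fin n → ℝ)

theorem eval_swap_left : R.eval y x z w = -R.eval x y z w := by
  unfold eval
  rw [arrayEval_swap_left, ← neg_one_mul, ← arrayEval_smul]
  congr 1; ext i j k l; rw [R.antisymm_left]; ring

theorem eval_swap_right : R.eval x y w z = -R.eval x y z w := by
  unfold eval
  rw [arrayEval_swap_right, ← neg_one_mul, ← arrayEval_smul]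
  congr 1; ext i j k l; rw [R.antisymm_right]; ring

theorem eval_swap_pair : R.eval z w x y = R.eval x y z w := by
  unfold eval
  rw [arrayEval_swap_mid, arrayEval_swap_left, arrayEval_swap_right, arrayEval_swap_mid]
  congr 1; ext i j k l; rw [R.pair_symm]

theorem eval_bianchi : R.eval x y z w + R.eval y z x w + R.eval z x y w = 0 := by
  have h1 : R.eval y z x w = arrayEval (fun i j k l => R.comp j k i l) x y z w := by
    unfold eval
    rw [arrayEval_swap_mid, arrayEval_swap_left]
  have h2 : R.eval z x y w = arrayEval (fun i j k l => R.comp k i j l) x y z w := by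
    unfold eval
    rw [arrayEval_swap_left, arrayEval_swap_mid]
  rw [h1, h2, eval, ← arrayEval_add, ← arrayEval_add]
  simp only [R.bianchi]
  simp [arrayEval]

theorem eval_add₁ : R.eval (x + x') y z w = R.eval x y z w + R.eval x' y z w :=
  arrayEval_add_left _ _ _ _ _ _

theorem eval_smul₁ : R.eval (c • x) y z w = c * R.eval x y z w :=
  arrayEval_smul_left _ _ _ _ _ _

theorem eval_add₂ : R.eval x (y + y') z w = R.eval x y z w + R.eval x y' z w := by
  rw [eval_swap_left, eval_add₁, R.eval_swap_left x y, R.eval_swap_left x y']; ring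

theorem eval_smul₂ : R.eval x (c • y) z w = c * R.eval x y z w := by
  rw [eval_swap_left, eval_smul₁, R.eval_swap_left x y]; ring

theorem eval_add₃ : R.eval x y (z + z') w = R.eval x y z w + R.eval x y z' w := by
  rw [← eval_swap_pair, eval_add₁, R.eval_swap_pair x y, R.eval_swap_pair x y]

theorem eval_smul₃ : R.eval x y (c • z) w = c * R.eval x y z w := by
  rw [← eval_swap_pair, eval_smul₁, R.eval_swap_pair x y]

theorem eval_add₄ : R.eval x y z (w + w') = R.eval x y z w + R.eval x y z w' := by
  rw [← eval_swap_pair, eval_add₂, R.eval_swap_pair x y, R.eval_swap_pair x y]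

theorem eval_smul₄ : R.eval x y z (c • w) = c * R.eval x y z w := by
  rw [← eval_swap_pair, eval_smul₂, R.eval_swap_pair x y]

end CurvTensor

/-- The standard basis vector `e_i` as a function. -/
def stdVec (i : Fin n) : Fin n → ℝ := Pi.single i 1

theorem eval_stdVec (R : CurvTensor n) (i j k l : Fin n) :
    R.eval (stdVec i) (stdVec j) (stdVec k) (stdVec l) = R.comp i j k l := by
  simp only [CurvTensor.eval, arrayEval, stdVec, Pi.single_apply, ite_mul, mul_ite, one_mul,
    mul_one, zero_mul, mul_zero, Finset.sum_ite_eq', Finset.mem_univ, if_true]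

theorem dot_stdVec (i j : Fin n) : stdVec i ⬝ᵥ stdVec j = if i = j then (1 : ℝ) else 0 := by
  simp [stdVec, Pi.single_apply, eq_comm]

/-- The Ricci form `Ric(x, y)`. -/
def ricForm (R : CurvTensor n) (x y : Fin n → ℝ) : ℝ := ∑ i, ∑ k, x i * y k * ricci R i k

theorem ricci_symm (R : CurvTensor n) (i k : Fin n) : ricci R i k = ricci R k i := by
  unfold ricci
  exact Finset.sum_congr rfl fun j _ => R.pair_symm i j k j

theorem ricForm_comm (R : CurvTensor n) (x y : Fin n → ℝ) : ricForm R x y = ricForm R y x := by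
  unfold ricForm
  rw [Finset.sum_comm]
  refine Finset.sum_congr rfl fun i _ => Finset.sum_congr rfl fun k _ => ?_
  rw [ricci_symm]; ring

theorem ricForm_add_left (R : CurvTensor n) (x x' y : Fin n → ℝ) :
    ricForm R (x + x') y = ricForm R x y + ricForm R x' y := by
  simp only [ricForm, Pi.add_apply, add_mul, Finset.sum_add_distrib]

theorem ricForm_smul_left (R : CurvTensor n) (c : ℝ) (x y : Fin n → ℝ) :
    ricForm R (c • x) y = c * ricForm R x y := by
  simp only [ricForm, Pi.smul_apply, smul_eq_mul, Finset.mul_sum, mul_assoc]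

theorem ricForm_add_right (R : CurvTensor n) (x y y' : Fin n → ℝ) :
    ricForm R x (y + y') = ricForm R x y + ricForm R x y' := by
  rw [ricForm_comm, ricForm_add_left, ricForm_comm R y, ricForm_comm R y']

theorem ricForm_smul_right (R : CurvTensor n) (c : ℝ) (x y : Fin n → ℝ) :
    ricForm R x (c • y) = c * ricForm R x y := by
  rw [ricForm_comm, ricForm_smul_left, ricForm_comm R y]

theorem ricForm_stdVec (R : CurvTensor n) (i k : Fin n) :
    ricForm R (stdVec i) (stdVec k) = ricci R i k := by
  simp only [ricForm, stdVec, Pi.single_apply, ite_mul, mul_ite, one_mul,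
    mul_one, zero_mul, mul_zero, Finset.sum_ite_eq', Finset.mem_univ, if_true]

theorem ricciQuad_eq (R : CurvTensor n) (v : EuclideanSpace ℝ (Fin n)) :
    ricciQuad R v = ricForm R (fun i => v i) (fun i => v i) := by
  unfold ricciQuad ricForm
  refine Finset.sum_congr rfl fun i _ => Finset.sum_congr rfl fun k _ => ?_
  ring

section Orthogonal

variable {A : Matrix (Fin n) (Fin n) ℝ} (hA : A ∈ Matrix.orthogonalGroup (Fin n) ℝ)
include hA

theorem orthogonal_col (p q : Fin n) : ∑ j, A j p * A j q = if p = q then 1 else 0 := by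
  have h := (Matrix.mem_orthogonalGroup_iff' (Fin n) ℝ).1 hA
  have := congrFun (congrFun h p) q
  simpa [Matrix.mul_apply, Matrix.one_apply, Matrix.star_eq_conjTranspose] using this

theorem orthogonal_row (p q : Fin n) : A p ⬝ᵥ A q = if p = q then 1 else 0 := by
  have h := (Matrix.mem_orthogonalGroup_iff (Fin n) ℝ).1 hA
  have := congrFun (congrFun h p) q
  simpa [Matrix.mul_apply, Matrix.one_apply, Matrix.star_eq_conjTranspose, dotProduct] using this

theorem orthogonal_contract (c : Fin n → Fin n → ℝ) :
    ∑ j, ∑ p, ∑ q, A j p * A j q * c p q = ∑ p, c p p := by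
  rw [Finset.sum_comm]
  refine Finset.sum_congr rfl fun p _ => ?_
  rw [Finset.sum_comm]
  simp only [← Finset.sum_mul, orthogonal_col hA]
  simp

theorem orthogonal_contract_two (S S' : Fin n → Fin n → ℝ) :
    ∑ p, ∑ q, (∑ b, ∑ d, A p b * A q d * S b d) * (∑ b, ∑ d, A p b * A q d * S' b d)
      = ∑ b, ∑ d, S b d * S' b d := by
  have h := (Matrix.mem_orthogonalGroup_iff' (Fin n) ℝ).1 hA
  have hA' : A.transpose * A = 1 := by
    simpa [Matrix.star_eq_conjTranspose] using h
  have e1 : ∀ (S : Matrix (Fin n) (Fin n) ℝ) p q, ∑ b, ∑ d, A p b * A q d * S b d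
      = (A * S * A.transpose) p q := by
    intro S p q
    simp only [Matrix.mul_apply, Matrix.transpose_apply, Finset.sum_mul]
    rw [Finset.sum_comm]
    refine Finset.sum_congr rfl fun b _ => Finset.sum_congr rfl fun d _ => ?_
    ring
  have e2 : ∀ (M N : Matrix (Fin n) (Fin n) ℝ), ∑ p, ∑ q, M p q * N p q
      = (M * N.transpose).trace := by
    intro M N
    simp [Matrix.trace, Matrix.mul_apply]
  have e3 := e2 (A * Matrix.of S * A.transpose) (A * Matrix.of S' * A.transpose)
  have e4 := e2 (Matrix.of S) (Matrix.of S')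
  have e5 : (A * Matrix.of S * A.transpose) * (A * Matrix.of S' * A.transpose).transpose
      = A * (Matrix.of S * (Matrix.of S').transpose * A.transpose) := by
    rw [Matrix.transpose_mul, Matrix.transpose_mul, Matrix.transpose_transpose]
    calc _ = A * Matrix.of S * (A.transpose * A) * (Matrix.of S').transpose * A.transpose := by
          simp only [Matrix.mul_assoc]
      _ = _ := by rw [hA']; simp only [Matrix.mul_assoc, Matrix.mul_one]
  have e6 : Matrix.of S * (Matrix.of S').transpose * A.transpose * A
      = Matrix.of S * (Matrix.of S').transpose := by
    rw [Matrix.mul_assoc _ A.transpose, hA', Matrix.mul_one]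
  rw [e5, Matrix.trace_mul_comm, e6] at e3
  calc _ = ∑ p, ∑ q, (A * Matrix.of S * A.transpose) p q * (A * Matrix.of S' * A.transpose) p q := by
        refine Finset.sum_congr rfl fun p _ => Finset.sum_congr rfl fun q _ => ?_
        rw [← e1, ← e1]; rfl
    _ = _ := by rw [e3, ← e4]; rfl

theorem ricci_rotate (R : CurvTensor n) (i k : Fin n) :
    ricci (rotate A R) i k = ricForm R (A i) (A k) := by
  have h1 : ∀ j, (rotate A R).comp i j k j =
      ∑ q, ∑ s, A j q * A j s * ∑ p, ∑ r, A i p * A k r * R.comp p q r s := by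
    intro j
    rw [comp_rotate]
    simp only [CurvTensor.eval, arrayEval, Finset.mul_sum]
    rw [Finset.sum_comm]
    refine Finset.sum_congr rfl fun q _ => ?_
    rw [Finset.sum_comm_cycle]
    refine Finset.sum_congr rfl fun s _ => Finset.sum_congr rfl fun p _ =>
      Finset.sum_congr rfl fun r _ => ?_
    ring
  unfold ricci ricForm
  simp only [h1]
  rw [orthogonal_contract hA]
  rw [Finset.sum_comm]
  refine Finset.sum_congr rfl fun p _ => ?_
  rw [Finset.sum_comm]
  refine Finset.sum_congr rfl fun r _ => ?_
  rw [ricci, Finset.mul_sum]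

theorem scal_rotate (R : CurvTensor n) : scal (rotate A R) = scal R := by
  unfold scal
  simp only [ricci_rotate hA]
  exact orthogonal_contract hA _

theorem auxB_rotate (R : CurvTensor n) (i j k l : Fin n) :
    auxB (rotate A R) i j k l = arrayEval (auxB R) (A i) (A j) (A k) (A l) := by
  have h1 : ∀ i j p q, (rotate A R).comp i p j q =
      ∑ b, ∑ d, A p b * A q d * ∑ a, ∑ c, A i a * A j c * R.comp a b c d := by
    intro i j p q
    rw [comp_rotate]
    simp only [CurvTensor.eval, arrayEval, Finset.mul_sum]
    rw [Finset.sum_comm]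
    refine Finset.sum_congr rfl fun q _ => ?_
    rw [Finset.sum_comm_cycle]
    refine Finset.sum_congr rfl fun s _ => Finset.sum_congr rfl fun p _ =>
      Finset.sum_congr rfl fun r _ => ?_
    ring
  unfold auxB
  simp only [h1]
  rw [orthogonal_contract_two hA]
  simp only [arrayEval, Finset.mul_sum, Finset.sum_mul]
  have h2 : ∀ (f : Fin n → Fin n → Fin n → Fin n → Fin n → Fin n → ℝ),
      ∑ b, ∑ d, ∑ a', ∑ c', ∑ a, ∑ c, f b d a' c' a c
        = ∑ a, ∑ c, ∑ a', ∑ c', ∑ b, ∑ d, f b d a' c' a c := by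
    intro f
    have h3 : ∀ g : (Fin n × Fin n) → (Fin n × Fin n) → (Fin n × Fin n) → ℝ,
        ∑ x, ∑ y, ∑ z, g x y z = ∑ z, ∑ y, ∑ x, g x y z := by
      intro g
      rw [Finset.sum_comm]
      simp_rw [Finset.sum_comm (f := fun x z => g x _ z)]
      rw [Finset.sum_comm]
    simpa only [Fintype.sum_prod_type] using
      h3 fun x y z => f x.1 x.2 y.1 y.2 z.1 z.2
  rw [h2]
  refine Finset.sum_congr rfl fun a _ => Finset.sum_congr rfl fun c _ =>
    Finset.sum_congr rfl fun a' _ => Finset.sum_congr rfl fun c' _ =>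
    Finset.sum_congr rfl fun b _ => Finset.sum_congr rfl fun d _ => ?_
  ring

omit hA in
theorem comp_Q (R : CurvTensor n) (i j k l : Fin n) :
    (Q R).comp i j k l = 2 * (auxB R i j k l - auxB R i j l k + auxB R i k j l - auxB R i l j k) := by
  have : (Q R).comp i j k l = sqTerm R i j k l + sharpTerm R i j k l := rfl
  rw [this, sqTerm_eq, sharpTerm_eq]; ring

/-- The quadratic term of the Hamilton ODE is `O(n)`-equivariant. -/
theorem Q_rotate (R : CurvTensor n) : Q (rotate A R) = rotate A (Q R) := by
  refine CurvTensor.ext_comp fun i j k l => ?_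
  rw [comp_rotate, comp_Q]
  simp only [auxB_rotate hA, CurvTensor.eval]
  have : (Q R).comp = fun i j k l => 2 * (auxB R i j k l + ((-1) * auxB R i j l k +
      (auxB R i k j l + (-1) * auxB R i l j k))) := by
    ext i j k l; rw [comp_Q]; ring
  have h1 : arrayEval (auxB R) (A i) (A l) (A j) (A k)
      = arrayEval (fun i j k l => auxB R i l j k) (A i) (A j) (A k) (A l) := by
    rw [arrayEval_swap_mid, arrayEval_swap_right]
  have h2 : arrayEval (auxB R) (A i) (A j) (A l) (A k)
      = arrayEval (fun i j k l => auxB R i j l k) (A i) (A j) (A k) (A l) :=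
    arrayEval_swap_right _ _ _ _ _
  have h3 : arrayEval (auxB R) (A i) (A k) (A j) (A l)
      = arrayEval (fun i j k l => auxB R i k j l) (A i) (A j) (A k) (A l) :=
    arrayEval_swap_mid _ _ _ _ _
  rw [this, arrayEval_smul, arrayEval_add, arrayEval_add, arrayEval_add,
    arrayEval_smul, arrayEval_smul, h1, h2, h3]
  ring

end Orthogonal

end

section

/-! ### Isotropic curvature on real frames and on complex isotropic pairs -/

/-- A finite family of vectors of `ℝⁿ`, given as functions, which is orthonormal for the dot
product. -/
def OrthoTuple {r : ℕ} (v : Fin r → Fin n → ℝ) : Prop :=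
  ∀ a b, v a ⬝ᵥ v b = if a = b then 1 else 0

theorem orthonormal_toLp_iff {r : ℕ} (v : Fin r → Fin n → ℝ) :
    Orthonormal ℝ (fun a => WithLp.toLp 2 (v a)) ↔ OrthoTuple v := by
  rw [orthonormal_iff_ite]
  unfold OrthoTuple
  simp only [EuclideanSpace.inner_toLp_toLp, star_trivial]
  constructor
  · intro h a b; rw [dotProduct_comm]; exact h a b
  · intro h a b; rw [dotProduct_comm]; exact h a b

theorem orthoTuple_stdVec {r : ℕ} {f : Fin r → Fin n} (hf : Function.Injective f) :
    OrthoTuple fun a => stdVec (f a) := by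
  intro a b
  rw [dot_stdVec]
  simp [hf.eq_iff]

/-- Every orthonormal tuple consists of rows, at prescribed positions, of an orthogonal matrix. -/
theorem OrthoTuple.exists_orthogonal {r : ℕ} {v : Fin r → Fin n → ℝ} (hv : OrthoTuple v)
    {f : Fin r → Fin n} (hf : Function.Injective f) :
    ∃ A ∈ Matrix.orthogonalGroup (Fin n) ℝ, ∀ a, A (f a) = v a := by
  classical
  let w : Fin n → EuclideanSpace ℝ (Fin n) :=
    Function.extend f (fun a => WithLp.toLp 2 (v a)) 0
  have hw : ∀ a, w (f a) = WithLp.toLp 2 (v a) := fun a => hf.extend_apply _ _ a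
  have hon : Orthonormal ℝ ((Set.range f).domRestrict w) := by
    rw [orthonormal_iff_ite]
    intro p q
    obtain ⟨_, a, rfl⟩ := p
    obtain ⟨_, b, rfl⟩ := q
    have h := (orthonormal_iff_ite.1 ((orthonormal_toLp_iff v).2 hv)) a b
    rw [← hw, ← hw] at h
    refine h.trans (if_congr ?_ rfl rfl)
    exact ⟨fun h => Subtype.ext (congrArg f h), fun h => hf (congrArg Subtype.val h)⟩
  obtain ⟨B, hB⟩ := hon.exists_orthonormalBasis_extension_of_card_eq (by simp)
  refine ⟨Matrix.of fun i j => B i j, ?_, fun a => ?_⟩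
  · rw [Matrix.mem_orthogonalGroup_iff]
    ext i j
    have h := (orthonormal_iff_ite.1 B.orthonormal) j i
    simp only [PiLp.inner_apply, RCLike.inner_apply, conj_trivial] at h
    rw [Matrix.mul_apply, Matrix.one_apply]
    refine Eq.trans h ?_
    simp only [eq_comm]
  · funext j
    simp [hB (f a) ⟨a, rfl⟩, hw]

/-- The isotropic curvature `R₁₃₁₃ + R₁₄₁₄ + R₂₃₂₃ + R₂₄₂₄ - 2 R₁₂₃₄` of four vectors. -/
def isoEval (R : CurvTensor n) (x y z w : Fin n → ℝ) : ℝ :=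
  R.eval x z x z + R.eval x w x w + R.eval y z y z + R.eval y w y w - 2 * R.eval x y z w

/-- The isotropic curvature of four standard basis vectors. -/
def isoComp (R : CurvTensor n) (i j k l : Fin n) : ℝ :=
  R.comp i k i k + R.comp i l i l + R.comp j k j k + R.comp j l j l - 2 * R.comp i j k l

theorem isoEval_stdVec (R : CurvTensor n) (i j k l : Fin n) :
    isoEval R (stdVec i) (stdVec j) (stdVec k) (stdVec l) = isoComp R i j k l := by
  simp only [isoEval, isoComp, eval_stdVec]

theorem isoComp_rotate (A : Matrix (Fin n) (Fin n) ℝ) (R : CurvTensor n) (i j k l : Fin n) :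
    isoComp (rotate A R) i j k l = isoEval R (A i) (A j) (A k) (A l) := by
  simp only [isoEval, isoComp, comp_rotate]

section ComplexEval

variable (R : CurvTensor n) (c : ℂ) (x x' y y' z z' w w' : Fin n → ℂ)

theorem complexEval_add₁ : complexEval R (x + x') y z w
    = complexEval R x y z w + complexEval R x' y z w := by
  simp only [complexEval, Pi.add_apply, mul_add, add_mul, Finset.sum_add_distrib]

theorem complexEval_add₂ : complexEval R x (y + y') z w
    = complexEval R x y z w + complexEval R x y' z w := by
  simp only [complexEval, Pi.add_apply, mul_add, add_mul, Finset.sum_add_distrib]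

theorem complexEval_add₃ : complexEval R x y (z + z') w
    = complexEval R x y z w + complexEval R x y z' w := by
  simp only [complexEval, Pi.add_apply, mul_add, add_mul, Finset.sum_add_distrib]

theorem complexEval_add₄ : complexEval R x y z (w + w')
    = complexEval R x y z w + complexEval R x y z w' := by
  simp only [complexEval, Pi.add_apply, mul_add, Finset.sum_add_distrib]

theorem complexEval_smul₁ : complexEval R (c • x) y z w = c * complexEval R x y z w := by
  simp only [complexEval, Pi.smul_apply, smul_eq_mul, Finset.mul_sum]
  refine Finset.sum_congr rfl fun i _ => Finset.sum_congr rfl fun j _ =>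
    Finset.sum_congr rfl fun k _ => Finset.sum_congr rfl fun l _ => ?_
  ring

theorem complexEval_smul₂ : complexEval R x (c • y) z w = c * complexEval R x y z w := by
  simp only [complexEval, Pi.smul_apply, smul_eq_mul, Finset.mul_sum]
  refine Finset.sum_congr rfl fun i _ => Finset.sum_congr rfl fun j _ =>
    Finset.sum_congr rfl fun k _ => Finset.sum_congr rfl fun l _ => ?_
  ring

theorem complexEval_smul₃ : complexEval R x y (c • z) w = c * complexEval R x y z w := by
  simp only [complexEval, Pi.smul_apply, smul_eq_mul, Finset.mul_sum]
  refine Finset.sum_congr rfl fun i _ => Finset.sum_congr rfl fun j _ =>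
    Finset.sum_congr rfl fun k _ => Finset.sum_congr rfl fun l _ => ?_
  ring

theorem complexEval_smul₄ : complexEval R x y z (c • w) = c * complexEval R x y z w := by
  simp only [complexEval, Pi.smul_apply, smul_eq_mul, Finset.mul_sum]
  refine Finset.sum_congr rfl fun i _ => Finset.sum_congr rfl fun j _ =>
    Finset.sum_congr rfl fun k _ => Finset.sum_congr rfl fun l _ => ?_
  ring

theorem complexEval_self_left : complexEval R x x z w = 0 := by
  have h : complexEval R x x z w = -complexEval R x x z w := by
    conv_lhs => rw [complexEval, Finset.sum_comm]
    simp only [complexEval, ← Finset.sum_neg_distrib]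
    refine Finset.sum_congr rfl fun i _ => Finset.sum_congr rfl fun j _ =>
      Finset.sum_congr rfl fun k _ => Finset.sum_congr rfl fun l _ => ?_
    rw [R.antisymm_left j i]; push_cast; ring
  exact CharZero.eq_neg_self_iff.1 h

theorem complexEval_self_right : complexEval R x y z z = 0 := by
  have h : complexEval R x y z z = -complexEval R x y z z := by
    simp only [complexEval, ← Finset.sum_neg_distrib]
    refine Finset.sum_congr rfl fun i _ => Finset.sum_congr rfl fun j _ => ?_
    rw [Finset.sum_comm]
    refine Finset.sum_congr rfl fun k _ => Finset.sum_congr rfl fun l _ => ?_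
    rw [R.antisymm_right i j l k]; push_cast; ring
  exact CharZero.eq_neg_self_iff.1 h

theorem complexEval_ofReal (x y z w : Fin n → ℝ) :
    complexEval R (fun i => (x i : ℂ)) (fun i => (y i : ℂ)) (fun i => (z i : ℂ))
      (fun i => (w i : ℂ)) = (R.eval x y z w : ℂ) := by
  simp only [complexEval, CurvTensor.eval, arrayEval]
  push_cast
  refine Finset.sum_congr rfl fun i _ => Finset.sum_congr rfl fun j _ =>
    Finset.sum_congr rfl fun k _ => Finset.sum_congr rfl fun l _ => ?_
  ring

end ComplexEval

/-- The isotropic curvature of the complex pair `(x + i y, z + i w)` in real terms. -/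
theorem re_complexEval (R : CurvTensor n) (x y z w : Fin n → ℝ) :
    (complexEval R (fun i => (x i : ℂ) + Complex.I * (y i : ℂ))
      (fun i => (z i : ℂ) + Complex.I * (w i : ℂ))
      (star fun i => (x i : ℂ) + Complex.I * (y i : ℂ))
      (star fun i => (z i : ℂ) + Complex.I * (w i : ℂ))).re = isoEval R x y z w := by
  have h1 : ∀ x y : Fin n → ℝ, (fun i => (x i : ℂ) + Complex.I * (y i : ℂ))
      = (fun i => (x i : ℂ)) + Complex.I • (fun i => (y i : ℂ)) := by
    intro x y; rfl
  have h2 : ∀ x y : Fin n → ℝ, (star fun i => (x i : ℂ) + Complex.I * (y i : ℂ))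
      = (fun i => (x i : ℂ)) + (-Complex.I) • (fun i => (y i : ℂ)) := by
    intro x y; funext i
    simp [Pi.star_apply]
  simp only [h2]
  simp only [h1, complexEval_add₁, complexEval_add₂, complexEval_add₃, complexEval_add₄,
    complexEval_smul₁, complexEval_smul₂, complexEval_smul₃, complexEval_smul₄,
    complexEval_ofReal]
  simp only [Complex.add_re, Complex.mul_re, Complex.mul_im, Complex.neg_re, Complex.neg_im,
    Complex.I_re, Complex.I_im, Complex.ofReal_re, Complex.ofReal_im, Complex.add_im]
  have e1 := R.eval_bianchi x y z w
  have e2 := R.eval_swap_left x z y w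
  have e3 := R.eval_swap_pair y z x w
  have e4 := R.eval_swap_pair x z y w
  have e5 := R.eval_swap_left y z x w
  have e6 := R.eval_swap_right y z x w
  have e7 := R.eval_swap_right y z w x
  have e8 := R.eval_swap_left x w y z
  unfold isoEval
  linarith

theorem mem_PIC_iff (R : CurvTensor n) :
    R ∈ PIC n ↔ ∀ v : Fin 4 → Fin n → ℝ, OrthoTuple v → 0 ≤ isoEval R (v 0) (v 1) (v 2) (v 3) := by
  constructor
  · intro h v hv
    have := h _ ((orthonormal_toLp_iff v).2 hv)
    rw [← re_complexEval]
    exact this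
  · intro h e he
    have := h (fun a i => e a i) ((orthonormal_toLp_iff _).1 he)
    rw [← re_complexEval] at this
    exact this

theorem mem_PIC_iff_rotate {f : Fin 4 → Fin n} (hf : Function.Injective f) (R : CurvTensor n) :
    R ∈ PIC n ↔ ∀ A ∈ Matrix.orthogonalGroup (Fin n) ℝ,
      0 ≤ isoComp (rotate A R) (f 0) (f 1) (f 2) (f 3) := by
  rw [mem_PIC_iff]
  constructor
  · intro h A hA
    rw [isoComp_rotate]
    refine h (fun a => A (f a)) fun a b => ?_
    rw [orthogonal_row hA]
    simp [hf.eq_iff]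
  · intro h v hv
    obtain ⟨A, hA, hv'⟩ := hv.exists_orthogonal hf
    have := h A hA
    rwa [isoComp_rotate, hv', hv', hv', hv'] at this

theorem isoEval_nonneg {R : CurvTensor n} (hR : R ∈ PIC n) {x y z w : Fin n → ℝ}
    (h : OrthoTuple ![x, y, z, w]) : 0 ≤ isoEval R x y z w :=
  (mem_PIC_iff R).1 hR ![x, y, z, w] h

theorem isoComp_nonneg {R : CurvTensor n} (hR : R ∈ PIC n) {i j k l : Fin n}
    (h : Function.Injective ![i, j, k, l]) : 0 ≤ isoComp R i j k l := by
  rw [← isoEval_stdVec]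
  exact (mem_PIC_iff R).1 hR (fun a => stdVec (![i, j, k, l] a)) (orthoTuple_stdVec h)

theorem complex_dot_re (x y : Fin n → ℂ) : (x ⬝ᵥ y).re
    = (fun i => (x i).re) ⬝ᵥ (fun i => (y i).re) - (fun i => (x i).im) ⬝ᵥ (fun i => (y i).im) := by
  simp [dotProduct, Complex.mul_re]

theorem complex_dot_im (x y : Fin n → ℂ) : (x ⬝ᵥ y).im
    = (fun i => (x i).re) ⬝ᵥ (fun i => (y i).im) + (fun i => (x i).im) ⬝ᵥ (fun i => (y i).re) := by
  simp [dotProduct, Complex.mul_im, Finset.sum_add_distrib]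

theorem complex_dot_star_self (x : Fin n → ℂ) :
    x ⬝ᵥ star x = ((∑ i, Complex.normSq (x i) : ℝ) : ℂ) := by
  simp [dotProduct, Complex.mul_conj]

/-- Normalization of a complex vector to squared length `2`, the length of `e₁ + i e₂`. -/
theorem exists_unit_scale {x : Fin n → ℂ} (hx : x ≠ 0) :
    ∃ (r : ℝ) (x₁ : Fin n → ℂ), x = (r : ℂ) • x₁ ∧ x₁ ⬝ᵥ star x₁ = 2 ∧
      ∃ c : ℂ, x₁ = c • x := by
  set S : ℝ := ∑ i, Complex.normSq (x i) with hS
  have hSpos : 0 < S := by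
    obtain ⟨i, hi⟩ := Function.ne_iff.1 hx
    exact Finset.sum_pos' (fun i _ => Complex.normSq_nonneg _)
      ⟨i, Finset.mem_univ _, Complex.normSq_pos.2 hi⟩
  set r := Real.sqrt (S / 2) with hr
  have hrpos : 0 < r := Real.sqrt_pos.2 (by linarith)
  have hr2 : r * r = S / 2 := Real.mul_self_sqrt (by linarith)
  have hrC : (r : ℂ) ≠ 0 := by exact_mod_cast hrpos.ne'
  refine ⟨r, ((r : ℂ)⁻¹) • x, ?_, ?_, _, rfl⟩
  · rw [smul_smul, mul_inv_cancel₀ hrC, one_smul]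
  · have : star (((r : ℂ)⁻¹) • x) = ((r : ℂ)⁻¹) • star x := by
      funext i; simp
    rw [this, smul_dotProduct, dotProduct_smul, complex_dot_star_self, ← hS]
    have hS' : (S : ℂ) = 2 * (r * r) := by
      have : S = 2 * (r * r) := by linarith
      exact_mod_cast this
    rw [hS']
    simp only [smul_eq_mul]
    field_simp

theorem orthoTuple_re_im {x₁ y₁ : Fin n → ℂ} (hx₁x₁ : x₁ ⬝ᵥ x₁ = 0) (hx₁ : x₁ ⬝ᵥ star x₁ = 2)
    (hy₁y₁ : y₁ ⬝ᵥ y₁ = 0) (hy₁ : y₁ ⬝ᵥ star y₁ = 2) (hx₁y₁ : x₁ ⬝ᵥ y₁ = 0)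
    (hy₁x₁ : y₁ ⬝ᵥ star x₁ = 0) :
    OrthoTuple ![fun i => (x₁ i).re, fun i => (x₁ i).im, fun i => (y₁ i).re,
      fun i => (y₁ i).im] := by
  have r1 := complex_dot_re x₁ x₁
  have i1 := complex_dot_im x₁ x₁
  have r2 := complex_dot_re x₁ (star x₁)
  have r3 := complex_dot_re y₁ y₁
  have i3 := complex_dot_im y₁ y₁
  have r4 := complex_dot_re y₁ (star y₁)
  have r5 := complex_dot_re x₁ y₁
  have i5 := complex_dot_im x₁ y₁
  have r6 := complex_dot_re y₁ (star x₁)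
  have i6 := complex_dot_im y₁ (star x₁)
  have hneg : ∀ a b : Fin n → ℂ, (fun i => (a i).im) ⬝ᵥ (fun i => -(b i).im)
      = -((fun i => (a i).im) ⬝ᵥ fun i => (b i).im) := fun a b => dotProduct_neg _ _
  have hneg' : ∀ a b : Fin n → ℂ, (fun i => (a i).re) ⬝ᵥ (fun i => -(b i).im)
      = -((fun i => (a i).re) ⬝ᵥ fun i => (b i).im) := fun a b => dotProduct_neg _ _
  simp only [Pi.star_apply, Complex.star_def, Complex.conj_re, Complex.conj_im, hneg, hneg',
    hx₁x₁, hx₁, hy₁y₁, hy₁, hx₁y₁, hy₁x₁, Complex.zero_re, Complex.zero_im,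
    Complex.re_ofNat] at r1 i1 r2 r3 i3 r4 r5 i5 r6 i6
  have c1 := dotProduct_comm (fun i => (x₁ i).im) (fun i => (x₁ i).re)
  have c2 := dotProduct_comm (fun i => (y₁ i).im) (fun i => (y₁ i).re)
  have c3 := dotProduct_comm (fun i => (y₁ i).re) (fun i => (x₁ i).re)
  have c4 := dotProduct_comm (fun i => (y₁ i).im) (fun i => (x₁ i).re)
  have c5 := dotProduct_comm (fun i => (y₁ i).re) (fun i => (x₁ i).im)
  have c6 := dotProduct_comm (fun i => (y₁ i).im) (fun i => (x₁ i).im)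
  have hall : ∀ p q r t : Fin n → ℝ, p ⬝ᵥ p = 1 → q ⬝ᵥ q = 1 → r ⬝ᵥ r = 1 → t ⬝ᵥ t = 1 →
      p ⬝ᵥ q = 0 → p ⬝ᵥ r = 0 → p ⬝ᵥ t = 0 → q ⬝ᵥ r = 0 → q ⬝ᵥ t = 0 → r ⬝ᵥ t = 0 →
      OrthoTuple ![p, q, r, t] := by
    intro p q r t h1 h2 h3 h4 h5 h6 h7 h8 h9 h10 a b
    fin_cases a <;> fin_cases b <;>
      simp [h1, h2, h3, h4, h5, h6, h7, h8, h9, h10, dotProduct_comm q p, dotProduct_comm r p,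
        dotProduct_comm t p, dotProduct_comm r q, dotProduct_comm t q, dotProduct_comm t r]
  apply hall <;> linarith

theorem complexEval_nonneg_of_unitary {R : CurvTensor n} (hR : R ∈ PIC n) {x₁ y₁ : Fin n → ℂ}
    (hx₁x₁ : x₁ ⬝ᵥ x₁ = 0) (hx₁ : x₁ ⬝ᵥ star x₁ = 2)
    (hy₁y₁ : y₁ ⬝ᵥ y₁ = 0) (hy₁ : y₁ ⬝ᵥ star y₁ = 2) (hx₁y₁ : x₁ ⬝ᵥ y₁ = 0)
    (hy₁x₁ : y₁ ⬝ᵥ star x₁ = 0) :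
    0 ≤ (complexEval R x₁ y₁ (star x₁) (star y₁)).re := by
  have hsplit : ∀ a : Fin n → ℂ, a
      = fun i => (((a i).re : ℝ) : ℂ) + Complex.I * (((a i).im : ℝ) : ℂ) := by
    intro a; funext i; rw [mul_comm]; exact (Complex.re_add_im _).symm
  rw [hsplit x₁, hsplit y₁, re_complexEval]
  exact isoEval_nonneg hR (orthoTuple_re_im hx₁x₁ hx₁ hy₁y₁ hy₁ hx₁y₁ hy₁x₁)

/-- A tensor in `PIC` is nonnegative on every pair of complex vectors spanning an isotropic
subspace, orthonormal or not: a Hermitian Gram-Schmidt step inside the span leaves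
`R(x, y, x̄, ȳ)` unchanged up to a positive factor. -/
theorem complexEval_nonneg_of_isotropic {R : CurvTensor n} (hR : R ∈ PIC n) {x y : Fin n → ℂ}
    (hxx : x ⬝ᵥ x = 0) (hxy : x ⬝ᵥ y = 0) (hyy : y ⬝ᵥ y = 0) :
    0 ≤ (complexEval R x y (star x) (star y)).re := by
  have hzero₁ : ∀ y z w, complexEval R 0 y z w = 0 := fun y z w => by
    simpa using complexEval_smul₁ R 0 0 y z w
  have hzero₂ : ∀ y z w, complexEval R y 0 z w = 0 := fun y z w => by
    simpa using complexEval_smul₂ R 0 y 0 z w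
  by_cases hx : x = 0
  · rw [hx, hzero₁]; simp
  obtain ⟨r, x₁, hr, hx₁, c, hc⟩ := exists_unit_scale hx
  have hx₁x₁ : x₁ ⬝ᵥ x₁ = 0 := by rw [hc]; simp [hxx]
  have hx₁y : x₁ ⬝ᵥ y = 0 := by rw [hc]; simp [hxy]
  -- the component of `y` orthogonal to `x`
  obtain ⟨d, hd⟩ : ∃ d : ℂ, d = (y ⬝ᵥ star x₁) / 2 := ⟨_, rfl⟩
  obtain ⟨y', hy'⟩ : ∃ y' : Fin n → ℂ, y' = y - d • x₁ := ⟨_, rfl⟩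
  have hyd : y = y' + d • x₁ := by rw [hy']; simp
  have hred : complexEval R x y (star x) (star y)
      = ((r * r : ℝ) : ℂ) * complexEval R x₁ y' (star x₁) (star y') := by
    have h1 : star x = (r : ℂ) • star x₁ := by rw [hr]; funext i; simp
    have h2 : star y = star y' + star d • star x₁ := by rw [hyd]; funext i; simp
    rw [h1, h2]
    conv_lhs => rw [hr, hyd]
    simp only [complexEval_add₂, complexEval_add₄, complexEval_smul₁, complexEval_smul₂,
      complexEval_smul₃, complexEval_smul₄, complexEval_self_left, complexEval_self_right]
    push_cast; ring
  have hx₁y' : x₁ ⬝ᵥ y' = 0 := by rw [hy', dotProduct_sub, hx₁y]; simp [hx₁x₁]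
  have hy'y' : y' ⬝ᵥ y' = 0 := by
    conv_lhs => rw [hy']
    rw [sub_dotProduct, smul_dotProduct, ← hy', hx₁y', hy', dotProduct_sub, hyy, dotProduct_smul,
      dotProduct_comm y x₁, hx₁y]
    simp
  have hy'x₁ : y' ⬝ᵥ star x₁ = 0 := by
    rw [hy', sub_dotProduct, smul_dotProduct, hx₁, hd]
    simp only [smul_eq_mul]; ring
  rw [hred, Complex.re_ofReal_mul]
  refine mul_nonneg (mul_self_nonneg r) ?_
  by_cases hy0 : y' = 0
  · rw [hy0, hzero₂]; simp
  obtain ⟨r', y₁, hr', hy₁, c', hc'⟩ := exists_unit_scale hy0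
  have hy₁y₁ : y₁ ⬝ᵥ y₁ = 0 := by rw [hc']; simp [hy'y']
  have hx₁y₁ : x₁ ⬝ᵥ y₁ = 0 := by rw [hc']; simp [hx₁y']
  have hy₁x₁ : y₁ ⬝ᵥ star x₁ = 0 := by rw [hc']; simp [hy'x₁]
  have hred' : complexEval R x₁ y' (star x₁) (star y')
      = ((r' * r' : ℝ) : ℂ) * complexEval R x₁ y₁ (star x₁) (star y₁) := by
    have h2 : star y' = (r' : ℂ) • star y₁ := by rw [hr']; funext i; simp
    rw [h2]
    conv_lhs => rw [hr']
    simp only [complexEval_smul₂, complexEval_smul₄]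
    push_cast; ring
  rw [hred', Complex.re_ofReal_mul]
  refine mul_nonneg (mul_self_nonneg r') ?_
  exact complexEval_nonneg_of_unitary hR hx₁x₁ hx₁ hy₁y₁ hy₁ hx₁y₁ hy₁x₁

end

/-! ### The boundary of `PIC` is not crossed by the Hamilton ODE -/

theorem CurvTensor.comp_last_first (U : CurvTensor n) (w x y z : Fin n) :
    U.comp w z x y = U.comp w y x z - U.comp w x y z := by
  linarith [U.bianchi w x y z, U.antisymm_left x y w z, U.antisymm_left y w x z,
    U.pair_symm x y w z]

/-- The summand of the isotropic curvature of `R^#`: with `ζ = e_i + i e_j`, `η = e_k + i e_l`, it is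
the real part of `R(ζ, e_p, ζ̄, e_q) R(η, e_p, η̄, e_q) - R(ζ, e_p, η̄, e_q) R(η, e_p, ζ̄, e_q)`. -/
def sharpDensity (U : CurvTensor n) (i j k l p q : Fin n) : ℝ :=
  (U.comp i p i q + U.comp j p j q) * (U.comp k p k q + U.comp l p l q)
    - (U.comp j p i q - U.comp i p j q) * (U.comp l p k q - U.comp k p l q)
    - (U.comp i p k q + U.comp j p l q) * (U.comp i q k p + U.comp j q l p)
    - (U.comp j p k q - U.comp i p l q) * (U.comp j q k p - U.comp i q l p)

/-- The isotropic curvature of `Q(R)`: the contribution of `R²` is the square `|R(φ)|²`, that of `R^#`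
the sum of `sharpDensity`. -/
theorem isoComp_Q (U : CurvTensor n) (i j k l : Fin n) :
    isoComp (Q U) i j k l
      = ∑ p, ∑ q, ((U.comp i k p q - U.comp j l p q) ^ 2 + (U.comp i l p q + U.comp j k p q) ^ 2)
        + 2 * ∑ p, ∑ q, sharpDensity U i j k l p q := by
  have hQ : ∀ a b c d, (Q U).comp a b c d = sqTerm U a b c d + sharpTerm U a b c d :=
    fun _ _ _ _ => rfl
  have h0 : isoComp (Q U) i j k l = (Q U).comp i k i k + (Q U).comp i l i l + (Q U).comp j k j k
      + (Q U).comp j l j l - (Q U).comp i k j l - (Q U).comp j l i k + (Q U).comp i l j k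
      + (Q U).comp j k i l := by
    have h1 := (Q U).comp_last_first i j k l
    have h2 := (Q U).pair_symm i k j l
    have h3 := (Q U).pair_symm i l j k
    unfold isoComp
    linarith
  rw [h0]
  simp only [hQ, sqTerm, sharpTerm, Finset.mul_sum, ← Finset.sum_add_distrib,
    ← Finset.sum_sub_distrib]
  refine Finset.sum_congr rfl fun p _ => Finset.sum_congr rfl fun q _ => ?_
  unfold sharpDensity
  rw [U.pair_symm k p i q, U.pair_symm l p i q, U.pair_symm k p j q, U.pair_symm l p j q]
  ring

/-- At a null frame, the terms of the isotropic curvature of `R^#` with both summation indices in the frame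
cancel. The hypotheses `h1`, `h2` are the first variation equation inside the four-plane. -/
theorem sharpDensity_block (U : CurvTensor n) {i j k l : Fin n} (hnull : isoComp U i j k l = 0)
    (h1 : U.comp i j i l + U.comp i j j k + U.comp i l k l + U.comp j k k l = 0)
    (h2 : -U.comp i j i k + U.comp i j j l - U.comp i k k l + U.comp j l k l = 0) :
    sharpDensity U i j k l i i + sharpDensity U i j k l i j + sharpDensity U i j k l i k
      + sharpDensity U i j k l i l + sharpDensity U i j k l j i + sharpDensity U i j k l j j
      + sharpDensity U i j k l j k + sharpDensity U i j k l j l + sharpDensity U i j k l k i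
      + sharpDensity U i j k l k j + sharpDensity U i j k l k k + sharpDensity U i j k l k l
      + sharpDensity U i j k l l i + sharpDensity U i j k l l j + sharpDensity U i j k l l k
      + sharpDensity U i j k l l l = 0 := by
  unfold isoComp at hnull
  unfold sharpDensity
  simp only [CurvTensor.comp_self_left, CurvTensor.comp_self_right, U.antisymm_left j i,
    U.antisymm_right _ _ j i, U.antisymm_left k i, U.antisymm_right _ _ k i, U.antisymm_left l i,
    U.antisymm_right _ _ l i, U.antisymm_left k j, U.antisymm_right _ _ k j, U.antisymm_left l j,
    U.antisymm_right _ _ l j, U.antisymm_left l k, U.antisymm_right _ _ l k, U.pair_symm i k i j,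
    U.pair_symm i l i j, U.pair_symm j k i j, U.pair_symm j l i j, U.pair_symm i l i k,
    U.pair_symm j k i k, U.pair_symm j l i k, U.pair_symm k l i k, U.pair_symm j k i l,
    U.pair_symm j l i l, U.pair_symm k l i l, U.pair_symm j l j k, U.pair_symm k l j k,
    U.pair_symm k l j l, U.comp_last_first i j k l] at hnull h1 h2 ⊢
  linear_combination (U.comp i j i j + 2 * U.comp i j k l + U.comp k l k l) * hnull
    - (U.comp i j i l + U.comp i j j k + U.comp i l k l + U.comp j k k l) * h1
    + (U.comp i j i k - U.comp i j j l + U.comp i k k l - U.comp j l k l) * h2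

/-- At a null frame, the terms of the isotropic curvature of `R^#` with one summation index in the frame
cancel. The hypotheses are the first variation equations for moving one of the two vectors of the
isotropic pair towards `e_q`. -/
theorem sharpDensity_mixed (U : CurvTensor n) {i j k l q : Fin n}
    (h1 : U.comp i k i q + U.comp i j l q + U.comp j k j q = 0)
    (h2 : -U.comp i l i q + U.comp i j k q - U.comp j l j q = 0)
    (h3 : -U.comp i k k q + U.comp j l k q - U.comp i l l q - U.comp j k l q = 0)
    (h4 : U.comp i l k q + U.comp j k k q - U.comp i k l q + U.comp j l l q = 0) :
    sharpDensity U i j k l i q + sharpDensity U i j k l j q + sharpDensity U i j k l k q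
      + sharpDensity U i j k l l q + (sharpDensity U i j k l q i + sharpDensity U i j k l q j
      + sharpDensity U i j k l q k + sharpDensity U i j k l q l) = 0 := by
  unfold sharpDensity
  simp only [CurvTensor.comp_self_left, CurvTensor.comp_self_right, U.antisymm_left j i,
    U.antisymm_right _ _ j i, U.antisymm_left k i, U.antisymm_right _ _ k i, U.antisymm_left l i,
    U.antisymm_right _ _ l i, U.antisymm_left k j, U.antisymm_right _ _ k j, U.antisymm_left l j,
    U.antisymm_right _ _ l j, U.antisymm_left l k, U.antisymm_right _ _ l k, U.pair_symm i q i j,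
    U.pair_symm j q i j, U.pair_symm i q i k, U.pair_symm j q i k, U.pair_symm k q i k,
    U.pair_symm l q i k, U.pair_symm i q i l, U.pair_symm j q i l, U.pair_symm k q i l,
    U.pair_symm l q i l, U.pair_symm j k i q, U.pair_symm j l i q, U.pair_symm j q j k,
    U.pair_symm k q j k, U.pair_symm l q j k, U.pair_symm j q j l, U.pair_symm k q j l,
    U.pair_symm l q j l, U.pair_symm k q k l, U.pair_symm l q k l, U.comp_last_first i j k q,
    U.comp_last_first i j l q, U.comp_last_first i k l q, U.comp_last_first j k l q]
  linear_combination (-2 * U.comp i j l q - 2 * U.comp k l l q) * h1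
    + (-2 * U.comp i j k q - 2 * U.comp k l k q) * h2
    + (-2 * U.comp i j j q + 2 * U.comp j k l q - 2 * U.comp j l k q) * h3
    + (-2 * U.comp i j i q + 2 * U.comp i k l q - 2 * U.comp i l k q) * h4

open Matrix ComplexOrder MatrixOrder in
/-- For a positive semidefinite block matrix `[[a, c], [cᴴ, b]]`, the number
`tr (a bᵀ) - tr (c c̄)` is nonnegative: twice it is the trace of the product with the positive
semidefinite matrix `[[bᵀ, -cᵀ], [-c̄, aᵀ]]`. -/
theorem block_trace_nonneg {κ : Type*} [Fintype κ] [DecidableEq κ] {a b c : Matrix κ κ ℂ}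
    (h : (fromBlocks a c cᴴ b).PosSemidef) :
    0 ≤ (∑ p, ∑ q, (a p q * b p q - c p q * star (c q p))).re := by
  set M := fromBlocks a c cᴴ b with hM
  let J : Matrix (κ ⊕ κ) (κ ⊕ κ) ℂ := fromBlocks 0 1 (-1) 0
  have hM' : (J * Mᵀ * Jᴴ).PosSemidef := h.transpose.mul_mul_conjTranspose_same J
  have hJ : J * Mᵀ * Jᴴ = fromBlocks bᵀ (-cᵀ) (-cᴴᵀ) aᵀ := by
    simp [J, hM, fromBlocks_transpose, fromBlocks_conjTranspose, fromBlocks_multiply]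
  rw [hJ] at hM'
  obtain ⟨B, hB⟩ := CStarAlgebra.nonneg_iff_eq_star_mul_self.1 (show 0 ≤ M from h.nonneg)
  have h1 : (M * fromBlocks bᵀ (-cᵀ) (-cᴴᵀ) aᵀ).trace
      = (B * fromBlocks bᵀ (-cᵀ) (-cᴴᵀ) aᵀ * Bᴴ).trace := by
    rw [hB, star_eq_conjTranspose, Matrix.mul_assoc, Matrix.trace_mul_comm]
  have h2 : 0 ≤ (M * fromBlocks bᵀ (-cᵀ) (-cᴴᵀ) aᵀ).trace := by
    rw [h1]; exact (hM'.mul_mul_conjTranspose_same B).trace_nonneg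
  have h3 : (M * fromBlocks bᵀ (-cᵀ) (-cᴴᵀ) aᵀ).trace
      = 2 * ∑ p, ∑ q, (a p q * b p q - c p q * star (c q p)) := by
    have e1 : (M * fromBlocks bᵀ (-cᵀ) (-cᴴᵀ) aᵀ).trace
        = ∑ p, ∑ q, (a p q * b p q - c p q * star (c q p))
          + ∑ p, ∑ q, (b p q * a p q - star (c q p) * c p q) := by
      rw [hM, fromBlocks_multiply, trace, Fintype.sum_sum_type]
      simp only [diag_apply, fromBlocks_apply₁₁, fromBlocks_apply₂₂, Matrix.add_apply, mul_apply,
        transpose_apply, Matrix.neg_apply, conjTranspose_apply, mul_neg, ← Finset.sum_add_distrib]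
      refine Finset.sum_congr rfl fun p _ => ?_
      simp only [← Finset.sum_neg_distrib, ← Finset.sum_add_distrib]
      refine Finset.sum_congr rfl fun q _ => ?_
      ring
    rw [e1, two_mul]
    congr 1
    simp only [Finset.sum_sub_distrib]
    congr 1
    · simp only [mul_comm]
    · simp only [mul_comm]
  rw [h3] at h2
  have := (Complex.le_def.1 h2).1
  simp at this
  simpa using this

open ComplexConjugate in
/-- The Hermitian form `∑ R_{ijkl} M_{ij} conj N_{kl}` of a curvature tensor on complex two-tensors. -/
noncomputable def hermForm (R : CurvTensor n) :
    (Fin n → Fin n → ℂ) →ₗ[ℂ] (Fin n → Fin n → ℂ) →ₛₗ[starRingEnd ℂ] ℂ :=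
  LinearMap.mk₂'ₛₗ (RingHom.id ℂ) (starRingEnd ℂ)
    (fun M N => ∑ i, ∑ j, ∑ k, ∑ l, (R.comp i j k l : ℂ) * M i j * conj (N k l))
    (fun M M' N => by
      simp only [Pi.add_apply, mul_add, add_mul, Finset.sum_add_distrib])
    (fun c M N => by
      simp only [Pi.smul_apply, smul_eq_mul, Finset.mul_sum, RingHom.id_apply]
      refine Finset.sum_congr rfl fun i _ => Finset.sum_congr rfl fun j _ =>
        Finset.sum_congr rfl fun k _ => Finset.sum_congr rfl fun l _ => ?_
      ring)
    (fun M N N' => by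
      simp only [Pi.add_apply, map_add, mul_add, Finset.sum_add_distrib])
    (fun c M N => by
      simp only [Pi.smul_apply, smul_eq_mul, Finset.mul_sum, map_mul]
      refine Finset.sum_congr rfl fun i _ => Finset.sum_congr rfl fun j _ =>
        Finset.sum_congr rfl fun k _ => Finset.sum_congr rfl fun l _ => ?_
      ring)

open ComplexConjugate in
theorem hermForm_conj (R : CurvTensor n) (M N : Fin n → Fin n → ℂ) :
    conj (hermForm R M N) = hermForm R N M := by
  simp only [hermForm, LinearMap.mk₂'ₛₗ_apply, map_sum, map_mul, Complex.conj_conj,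
    Complex.conj_ofReal]
  rw [Finset.sum_comm_cycle]
  refine Finset.sum_congr rfl fun p _ => ?_
  rw [Finset.sum_comm_cycle]
  refine Finset.sum_congr rfl fun q _ => Finset.sum_congr rfl fun r _ =>
    Finset.sum_congr rfl fun s _ => ?_
  rw [R.pair_symm r s p q]
  ring

/-- The tensor product of two complex vectors. -/
def tens (x y : Fin n → ℂ) : Fin n → Fin n → ℂ := fun i j => x i * y j

theorem tens_add_left (x x' y : Fin n → ℂ) : tens (x + x') y = tens x y + tens x' y := by
  funext i j; simp [tens, add_mul]

theorem tens_add_right (x y y' : Fin n → ℂ) : tens x (y + y') = tens x y + tens x y' := by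
  funext i j; simp [tens, mul_add]

theorem tens_smul_left (c : ℂ) (x y : Fin n → ℂ) : tens (c • x) y = c • tens x y := by
  funext i j; simp [tens, mul_assoc]

theorem tens_smul_right (c : ℂ) (x y : Fin n → ℂ) : tens x (c • y) = c • tens x y := by
  funext i j; simp [tens, mul_left_comm]

theorem hermForm_tens (R : CurvTensor n) (x y z w : Fin n → ℂ) :
    hermForm R (tens x y) (tens z w) = complexEval R x y (star z) (star w) := by
  simp only [hermForm, LinearMap.mk₂'ₛₗ_apply, complexEval, tens, Pi.star_apply, map_mul,
    Complex.star_def]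
  refine Finset.sum_congr rfl fun i _ => Finset.sum_congr rfl fun j _ =>
    Finset.sum_congr rfl fun k _ => Finset.sum_congr rfl fun l _ => ?_
  ring

/-- If `a t + b t² + O(t³)` is nonnegative for all `t`, then `a = 0` and `b ≥ 0`. -/
theorem taylor_nonneg {a b : ℝ} {r : ℝ → ℝ} (hr : Continuous r)
    (h : ∀ t : ℝ, 0 ≤ a * t + b * t ^ 2 + t ^ 3 * r t) : a = 0 ∧ 0 ≤ b := by
  have hc1 : Continuous fun t => a + b * t + t ^ 2 * r t := by fun_prop
  have hc2 : Continuous fun t => b + t * r t := by fun_prop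
  have ha : a = 0 := by
    apply le_antisymm
    · have := (hc1.tendsto 0).mono_left (nhdsWithin_le_nhds (s := Iio 0))
      simp only [mul_zero, add_zero, ne_eq, OfNat.ofNat_ne_zero, not_false_eq_true, zero_pow,
        zero_mul] at this
      refine le_of_tendsto this ?_
      filter_upwards [self_mem_nhdsWithin] with t ht
      have ht' : t < 0 := ht
      have := h t
      by_contra hlt
      push Not at hlt
      nlinarith
    · have := (hc1.tendsto 0).mono_left (nhdsWithin_le_nhds (s := Ioi 0))
      simp only [mul_zero, add_zero, ne_eq, OfNat.ofNat_ne_zero, not_false_eq_true, zero_pow,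
        zero_mul] at this
      refine ge_of_tendsto this ?_
      filter_upwards [self_mem_nhdsWithin] with t ht
      have ht' : 0 < t := ht
      have := h t
      by_contra hlt
      push Not at hlt
      nlinarith
  refine ⟨ha, ?_⟩
  have := (hc2.tendsto 0).mono_left (nhdsWithin_le_nhds (s := Ioi 0))
  simp only [add_zero, zero_mul] at this
  refine ge_of_tendsto this ?_
  filter_upwards [self_mem_nhdsWithin] with t ht
  have ht' : 0 < t := ht
  have := h t
  by_contra hlt
  push Not at hlt
  have : 0 < t ^ 2 := by positivity
  nlinarith

/-- First and second variation of `R(x, y, x̄, ȳ)` along a polynomial curve of isotropic pairs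
starting at a zero. -/
theorem isotropic_variation {R : CurvTensor n} (hR : R ∈ PIC n) {x₀ x₁ x₂ y₀ y₁ y₂ : Fin n → ℂ}
    (hxx : ∀ t : ℝ, (x₀ + (t : ℂ) • x₁ + ((t : ℂ) ^ 2) • x₂) ⬝ᵥ
      (x₀ + (t : ℂ) • x₁ + ((t : ℂ) ^ 2) • x₂) = 0)
    (hxy : ∀ t : ℝ, (x₀ + (t : ℂ) • x₁ + ((t : ℂ) ^ 2) • x₂) ⬝ᵥ
      (y₀ + (t : ℂ) • y₁ + ((t : ℂ) ^ 2) • y₂) = 0)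
    (hyy : ∀ t : ℝ, (y₀ + (t : ℂ) • y₁ + ((t : ℂ) ^ 2) • y₂) ⬝ᵥ
      (y₀ + (t : ℂ) • y₁ + ((t : ℂ) ^ 2) • y₂) = 0)
    (h0 : (hermForm R (tens x₀ y₀) (tens x₀ y₀)).re = 0) :
    (hermForm R (tens x₀ y₁ + tens x₁ y₀) (tens x₀ y₀)).re = 0 ∧
      0 ≤ (hermForm R (tens x₀ y₁ + tens x₁ y₀) (tens x₀ y₁ + tens x₁ y₀)).re
        + 2 * (hermForm R (tens x₀ y₂ + tens x₁ y₁ + tens x₂ y₀) (tens x₀ y₀)).re := by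
  obtain ⟨v₀, hv₀⟩ : ∃ v, v = tens x₀ y₀ := ⟨_, rfl⟩
  obtain ⟨v₁, hv₁⟩ : ∃ v, v = tens x₀ y₁ + tens x₁ y₀ := ⟨_, rfl⟩
  obtain ⟨v₂, hv₂⟩ : ∃ v, v = tens x₀ y₂ + tens x₁ y₁ + tens x₂ y₀ := ⟨_, rfl⟩
  obtain ⟨v₃, hv₃⟩ : ∃ v, v = tens x₁ y₂ + tens x₂ y₁ := ⟨_, rfl⟩
  obtain ⟨v₄, hv₄⟩ : ∃ v, v = tens x₂ y₂ := ⟨_, rfl⟩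
  rw [← hv₀, ← hv₁, ← hv₂]
  rw [← hv₀] at h0
  obtain ⟨B, hB⟩ : ∃ B : (Fin n → Fin n → ℂ) → (Fin n → Fin n → ℂ) → ℝ,
      B = fun M N => (hermForm R M N).re := ⟨_, rfl⟩
  have hBc : ∀ M N, B N M = B M N := by
    intro M N; rw [hB]; simp only
    rw [← hermForm_conj R N M, Complex.conj_re]
  have hkey : ∀ t : ℝ, 0 ≤ (2 * B v₁ v₀) * t + (B v₁ v₁ + 2 * B v₂ v₀) * t ^ 2
      + t ^ 3 * (2 * (B v₃ v₀ + B v₂ v₁) + t * (B v₂ v₂ + 2 * B v₃ v₁ + 2 * B v₄ v₀)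
        + t ^ 2 * (2 * (B v₃ v₂ + B v₄ v₁)) + t ^ 3 * (B v₃ v₃ + 2 * B v₄ v₂)
        + t ^ 4 * (2 * B v₄ v₃) + t ^ 5 * B v₄ v₄) := by
    intro t
    have h := complexEval_nonneg_of_isotropic hR (hxx t) (hxy t) (hyy t)
    rw [← hermForm_tens] at h
    have hexp : tens (x₀ + (t : ℂ) • x₁ + ((t : ℂ) ^ 2) • x₂) (y₀ + (t : ℂ) • y₁ + ((t : ℂ) ^ 2) • y₂)
        = v₀ + (t : ℂ) • v₁ + ((t ^ 2 : ℝ) : ℂ) • v₂ + ((t ^ 3 : ℝ) : ℂ) • v₃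
          + ((t ^ 4 : ℝ) : ℂ) • v₄ := by
      rw [hv₀, hv₁, hv₂, hv₃, hv₄]
      funext i j
      simp only [tens, Pi.add_apply, Pi.smul_apply, smul_eq_mul]
      push_cast
      ring
    rw [hexp] at h
    simp only [map_add, LinearMap.add_apply, map_smulₛₗ, LinearMap.smul_apply, Complex.conj_ofReal,
      RingHom.id_apply, smul_eq_mul, Complex.add_re, Complex.re_ofReal_mul] at h
    have e : ∀ M N, (hermForm R M N).re = B M N := by intro M N; rw [hB]
    simp only [e] at h h0
    rw [h0, hBc v₁ v₀, hBc v₂ v₀, hBc v₃ v₀, hBc v₄ v₀, hBc v₂ v₁, hBc v₃ v₁, hBc v₄ v₁, hBc v₃ v₂,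
      hBc v₄ v₂, hBc v₄ v₃] at h
    refine h.trans_eq ?_
    ring
  obtain ⟨h1, h2⟩ := taylor_nonneg (by fun_prop) hkey
  rw [hB] at h1 h2
  exact ⟨by linarith, h2⟩

/-- Two complex vectors `x`, `y` of squared length `2` whose span is isotropic and which are
orthogonal for the Hermitian product. -/
structure IsotropicFrame (x y : Fin n → ℂ) : Prop where
  left_left : x ⬝ᵥ x = 0
  left_right : x ⬝ᵥ y = 0
  right_right : y ⬝ᵥ y = 0
  left_star : x ⬝ᵥ star x = 2
  right_star : y ⬝ᵥ star y = 2
  right_star_left : y ⬝ᵥ star x = 0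

/-- A complex vector orthogonal to `x`, `y` and their conjugates. -/
structure IsNormalTo (x y z : Fin n → ℂ) : Prop where
  left : z ⬝ᵥ x = 0
  right : z ⬝ᵥ y = 0
  star_left : z ⬝ᵥ star x = 0
  star_right : z ⬝ᵥ star y = 0

theorem IsNormalTo.smul {x y z : Fin n → ℂ} (h : IsNormalTo x y z) (c : ℂ) :
    IsNormalTo x y (c • z) :=
  ⟨by simp [h.left], by simp [h.right], by simp [h.star_left], by simp [h.star_right]⟩

theorem isNormalTo_zero (x y : Fin n → ℂ) : IsNormalTo x y 0 := by
  constructor <;> simp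

/-- First and second variation at a null frame along the curve
`(x + t z + O(t²), y + t w + O(t²))`, whose terms of second order are multiples of `x̄` and `ȳ` chosen
so that the curve stays isotropic. -/
theorem normal_variation_aux {R : CurvTensor n} (hR : R ∈ PIC n) {x y z w : Fin n → ℂ}
    (h : IsotropicFrame x y) (hz : IsNormalTo x y z) (hw : IsNormalTo x y w)
    (h0 : (hermForm R (tens x y) (tens x y)).re = 0) :
    (hermForm R (tens x w + tens z y) (tens x y)).re = 0 ∧
      0 ≤ (hermForm R (tens x w + tens z y) (tens x w + tens z y)).re
        + 2 * (hermForm R (tens x (-(w ⬝ᵥ w / 4) • star y - (z ⬝ᵥ w / 2) • star x) + tens z w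
          + tens (-(z ⬝ᵥ z / 4) • star x) y) (tens x y)).re := by
  have a1 : star x ⬝ᵥ star x = 0 := by
    rw [← star_star (star x ⬝ᵥ star x), ← Matrix.star_dotProduct_star]; simp [h.left_left]
  have a2 : star x ⬝ᵥ star y = 0 := by
    rw [Matrix.star_dotProduct_star, dotProduct_comm, h.left_right, star_zero]
  have a3 : star y ⬝ᵥ star y = 0 := by
    rw [Matrix.star_dotProduct_star, h.right_right, star_zero]
  have a4 : x ⬝ᵥ star y = 0 := by
    rw [Matrix.dotProduct_star, h.right_star_left, star_zero]
  have c1 : star x ⬝ᵥ x = 2 := by rw [dotProduct_comm, h.left_star]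
  have c2 : star y ⬝ᵥ y = 2 := by rw [dotProduct_comm, h.right_star]
  have c3 : star x ⬝ᵥ y = 0 := by rw [dotProduct_comm, h.right_star_left]
  have c6 : star y ⬝ᵥ star x = 0 := by rw [dotProduct_comm, a2]
  have z1 : x ⬝ᵥ z = 0 := by rw [dotProduct_comm, hz.left]
  have z3 : star x ⬝ᵥ z = 0 := by rw [dotProduct_comm, hz.star_left]
  have w1 : x ⬝ᵥ w = 0 := by rw [dotProduct_comm, hw.left]
  have w2 : y ⬝ᵥ w = 0 := by rw [dotProduct_comm, hw.right]
  have w3 : star x ⬝ᵥ w = 0 := by rw [dotProduct_comm, hw.star_left]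
  have w4 : star y ⬝ᵥ w = 0 := by rw [dotProduct_comm, hw.star_right]
  refine isotropic_variation hR (fun t => ?_) (fun t => ?_) (fun t => ?_) h0 <;>
  · simp only [add_dotProduct, dotProduct_add, sub_dotProduct, dotProduct_sub, smul_dotProduct,
      dotProduct_smul, smul_eq_mul, h.left_left, h.left_right, h.right_right, h.left_star,
      h.right_star, h.right_star_left, a1, a2, a3, a4, c1, c2, c3, c6, z1, z3, w1,
      w2, w3, w4, hz.left, hz.right, hz.star_left, hz.star_right, hw.right, hw.star_left,
      hw.star_right]
    ring

/-- First and second variation in normal directions at a null frame. Multiplying `(z, w)` by `i` reverses the sign of the second-order correction, so the second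
variation is nonnegative without it. -/
theorem normal_variation {R : CurvTensor n} (hR : R ∈ PIC n) {x y z w : Fin n → ℂ}
    (h : IsotropicFrame x y) (hz : IsNormalTo x y z) (hw : IsNormalTo x y w)
    (h0 : (hermForm R (tens x y) (tens x y)).re = 0) :
    hermForm R (tens x w + tens z y) (tens x y) = 0 ∧
      0 ≤ (hermForm R (tens x w + tens z y) (tens x w + tens z y)).re := by
  obtain ⟨h1, h2⟩ := normal_variation_aux hR h hz hw h0
  obtain ⟨h3, h4⟩ := normal_variation_aux hR h (hz.smul Complex.I) (hw.smul Complex.I) h0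
  obtain ⟨v, hv⟩ : ∃ v, v = tens x w + tens z y := ⟨_, rfl⟩
  have e1 : tens x (Complex.I • w) + tens (Complex.I • z) y = Complex.I • v := by
    rw [tens_smul_left, tens_smul_right, hv, smul_add]
  have e2 : tens x (-((Complex.I • w) ⬝ᵥ (Complex.I • w) / 4) • star y
        - ((Complex.I • z) ⬝ᵥ (Complex.I • w) / 2) • star x) + tens (Complex.I • z) (Complex.I • w)
        + tens (-((Complex.I • z) ⬝ᵥ (Complex.I • z) / 4) • star x) y
      = (-1 : ℂ) • (tens x (-(w ⬝ᵥ w / 4) • star y - (z ⬝ᵥ w / 2) • star x) + tens z w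
          + tens (-(z ⬝ᵥ z / 4) • star x) y) := by
    funext i j
    simp only [tens, Pi.add_apply, Pi.sub_apply, Pi.smul_apply, smul_eq_mul, smul_dotProduct,
      dotProduct_smul]
    linear_combination (-(x i * (w ⬝ᵥ w / 4) * star y j) - x i * (z ⬝ᵥ w / 2) * star x j
      + z i * w j - (z ⬝ᵥ z / 4) * star x i * y j) * Complex.I_mul_I
  rw [e1] at h3 h4
  rw [e2] at h4
  rw [← hv] at h1 h2 ⊢
  simp only [map_smulₛₗ, LinearMap.smul_apply, RingHom.id_apply, smul_eq_mul, Complex.conj_I]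
    at h3 h4
  constructor
  · apply Complex.ext
    · rw [h1]; simp
    · simp at h3; rw [h3]; simp
  · have e3 : (-Complex.I * (Complex.I * hermForm R v v)) = hermForm R v v := by
      linear_combination (-hermForm R v v) * Complex.I_mul_I
    simp only [e3, neg_mul, one_mul, Complex.neg_re] at h4
    linarith

/-- First variation at a null frame `(x, y)` along `(x - t c ȳ, y + t c x̄)`, which stays inside the span
of `x`, `y` and their conjugates. -/
theorem frame_variation {R : CurvTensor n} (hR : R ∈ PIC n) {x y : Fin n → ℂ}
    (h : IsotropicFrame x y) (h0 : (hermForm R (tens x y) (tens x y)).re = 0) :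
    hermForm R (tens x (star x) - tens (star y) y) (tens x y) = 0 := by
  have a1 : star x ⬝ᵥ star x = 0 := by
    rw [Matrix.star_dotProduct_star, h.left_left, star_zero]
  have a3 : star y ⬝ᵥ star y = 0 := by
    rw [Matrix.star_dotProduct_star, h.right_right, star_zero]
  have a2 : star y ⬝ᵥ star x = 0 := by
    rw [Matrix.star_dotProduct_star, h.left_right, star_zero]
  have a4 : x ⬝ᵥ star y = 0 := by
    rw [Matrix.dotProduct_star, h.right_star_left, star_zero]
  have c2 : star y ⬝ᵥ y = 2 := by rw [dotProduct_comm, h.right_star]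
  have c3 : star x ⬝ᵥ y = 0 := by rw [dotProduct_comm, h.right_star_left]
  have c4 : star y ⬝ᵥ x = 0 := by rw [dotProduct_comm, a4]
  have key : ∀ c : ℂ, (hermForm R (tens x (c • star x) + tens (-c • star y) y) (tens x y)).re = 0 := by
    intro c
    refine (isotropic_variation (x₂ := 0) (y₂ := 0) hR (fun t => ?_) (fun t => ?_) (fun t => ?_)
      h0).1 <;>
    · simp only [add_dotProduct, dotProduct_add, smul_dotProduct,
        dotProduct_smul, smul_eq_mul, h.left_left, h.left_right, h.right_right, h.left_star,
        h.right_star_left, a1, a2, a3, a4, c2, c3, c4, dotProduct_zero,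
        zero_dotProduct]
      ring
  have e : ∀ c : ℂ, tens x (c • star x) + tens (-c • star y) y
      = c • (tens x (star x) - tens (star y) y) := by
    intro c
    rw [tens_smul_left, tens_smul_right, smul_sub, neg_smul, sub_eq_add_neg]
  simp only [e, map_smulₛₗ, LinearMap.smul_apply, RingHom.id_apply, smul_eq_mul] at key
  have k1 := key 1
  have k2 := key Complex.I
  apply Complex.ext
  · simpa using k1
  · simp at k2 ⊢
    linarith

section

/-- The standard basis vectors of `ℂⁿ`. -/
def cvec (i : Fin n) : Fin n → ℂ := fun a => (stdVec i a : ℂ)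

theorem star_cvec (i : Fin n) : star (cvec i) = cvec i := by
  funext a; simp [cvec]

theorem cvec_apply (i j : Fin n) : cvec i j = if j = i then 1 else 0 := by
  simp [cvec, stdVec, Pi.single_apply, apply_ite]

theorem dot_cvec (i : Fin n) (x : Fin n → ℂ) : x ⬝ᵥ cvec i = x i := by
  simp [cvec_apply, dotProduct]

theorem hermForm_cvec (R : CurvTensor n) (i j k l : Fin n) :
    hermForm R (tens (cvec i) (cvec j)) (tens (cvec k) (cvec l)) = (R.comp i j k l : ℂ) := by
  rw [hermForm_tens, star_cvec, star_cvec]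
  unfold cvec
  rw [complexEval_ofReal, eval_stdVec]

/-- The isotropic vector `e_i + i e_j`. -/
noncomputable def nullVec (i j : Fin n) : Fin n → ℂ := cvec i + Complex.I • cvec j

theorem star_nullVec (i j : Fin n) : star (nullVec i j) = cvec i + (-Complex.I) • cvec j := by
  rw [nullVec, star_add, star_smul, star_cvec, star_cvec]; simp

/-- The isotropic curvature of a frame is the value of the Hermitian form on the isotropic pair. -/
theorem re_hermForm_nullVec (R : CurvTensor n) (i j k l : Fin n) :
    (hermForm R (tens (nullVec i j) (nullVec k l)) (tens (nullVec i j) (nullVec k l))).re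
      = isoComp R i j k l := by
  simp only [nullVec, tens_add_left, tens_add_right, tens_smul_left, tens_smul_right, map_add,
    map_smulₛₗ, LinearMap.add_apply, LinearMap.smul_apply, hermForm_cvec, smul_eq_mul,
    Complex.conj_I, RingHom.id_apply, Complex.add_re, Complex.mul_re, Complex.add_im,
    Complex.mul_im, Complex.I_re, Complex.I_im, Complex.ofReal_re, Complex.ofReal_im,
    Complex.neg_re, Complex.neg_im]
  unfold isoComp
  linarith [R.comp_last_first i j k l, R.pair_symm i k j l, R.pair_symm i l j k,
    R.antisymm_left j l i k, R.antisymm_left j k i l]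

theorem isotropicFrame_nullVec {i j k l : Fin n} (h : Function.Injective ![i, j, k, l]) :
    IsotropicFrame (nullVec i j) (nullVec k l) := by
  have hij : i ≠ j := fun e => absurd (@h 0 1 e) (by decide)
  have hik : i ≠ k := fun e => absurd (@h 0 2 e) (by decide)
  have hil : i ≠ l := fun e => absurd (@h 0 3 e) (by decide)
  have hjk : j ≠ k := fun e => absurd (@h 1 2 e) (by decide)
  have hjl : j ≠ l := fun e => absurd (@h 1 3 e) (by decide)
  have hkl : k ≠ l := fun e => absurd (@h 2 3 e) (by decide)
  have e1 : ∀ a b : Fin n, a ≠ b → nullVec a b ⬝ᵥ nullVec a b = 0 := by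
    intro a b hab
    simp [nullVec, dotProduct_add, dot_cvec, cvec_apply, hab, hab.symm]
  have e2 : ∀ a b : Fin n, a ≠ b → nullVec a b ⬝ᵥ star (nullVec a b) = 2 := by
    intro a b hab
    rw [star_nullVec]
    simp [nullVec, dotProduct_add, dot_cvec, cvec_apply, hab, hab.symm]
    norm_num
  refine ⟨e1 i j hij, ?_, e1 k l hkl, e2 i j hij, e2 k l hkl, ?_⟩
  · simp [nullVec, dotProduct_add, dot_cvec, cvec_apply, hik.symm, hil.symm, hjk.symm, hjl.symm]
  · rw [star_nullVec]
    simp [nullVec, dotProduct_add, dot_cvec, cvec_apply, hik, hil, hjk, hjl]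

theorem isNormalTo_nullVec {i j k l : Fin n} {z : Fin n → ℂ} (hi : z i = 0) (hj : z j = 0)
    (hk : z k = 0) (hl : z l = 0) : IsNormalTo (nullVec i j) (nullVec k l) z := by
  have e : ∀ a b : Fin n, z a = 0 → z b = 0 →
      z ⬝ᵥ nullVec a b = 0 ∧ z ⬝ᵥ star (nullVec a b) = 0 := by
    intro a b ha hb
    rw [star_nullVec]
    simp [nullVec, dot_cvec, dotProduct_add, ha, hb]
  exact ⟨(e i j hi hj).1, (e k l hk hl).1, (e i j hi hj).2, (e k l hk hl).2⟩

variable {U : CurvTensor n} {i j k l : Fin n}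

/-- The first variation of the isotropic curvature at a null frame when `e_i + i e_j` moves towards `e_q`:
real and imaginary parts. -/
theorem first_variation_left (hU : U ∈ PIC n) (h : Function.Injective ![i, j, k, l])
    (h0 : isoComp U i j k l = 0) {q : Fin n} (hqi : q ≠ i) (hqj : q ≠ j) (hqk : q ≠ k)
    (hql : q ≠ l) :
    (U.comp i k i q + U.comp i j l q + U.comp j k j q = 0) ∧
    (-U.comp i l i q + U.comp i j k q - U.comp j l j q = 0) := by
  have hz : IsNormalTo (nullVec i j) (nullVec k l) (cvec q) := by
    apply isNormalTo_nullVec <;> simp [cvec_apply, hqi.symm, hqj.symm, hqk.symm, hql.symm]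
  rw [← re_hermForm_nullVec] at h0
  have hv := (normal_variation hU (isotropicFrame_nullVec h) (isNormalTo_zero _ _) hz h0).1
  have e : tens (0 : Fin n → ℂ) (nullVec k l) = 0 := by funext a b; simp [tens]
  rw [e, add_zero] at hv
  simp only [nullVec, tens_add_left, tens_add_right, tens_smul_left, tens_smul_right, map_add,
    map_smulₛₗ, LinearMap.add_apply, LinearMap.smul_apply, hermForm_cvec, smul_eq_mul,
    Complex.conj_I, RingHom.id_apply] at hv
  have hre := congrArg Complex.re hv
  have him := congrArg Complex.im hv
  simp only [Complex.add_re, Complex.mul_re, Complex.add_im,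
    Complex.mul_im, Complex.I_re, Complex.I_im, Complex.ofReal_re, Complex.ofReal_im,
    Complex.neg_re, Complex.neg_im, Complex.zero_re, Complex.zero_im] at hre him
  constructor
  · linarith [U.pair_symm i q i k, U.pair_symm j q j k, U.comp_last_first i j l q,
      U.pair_symm j q i l, U.antisymm_left q l i j, U.pair_symm i q j l, U.pair_symm i j l q]
  · linarith [U.pair_symm i q i l, U.pair_symm j q j l, U.comp_last_first i j k q,
      U.pair_symm j q i k, U.antisymm_left q l i j, U.pair_symm i q j k, U.pair_symm i j k q]

/-- The first variation of the isotropic curvature at a null frame when `e_k + i e_l` moves towards `e_q`: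
real and imaginary parts. -/
theorem first_variation_right (hU : U ∈ PIC n) (h : Function.Injective ![i, j, k, l])
    (h0 : isoComp U i j k l = 0) {q : Fin n} (hqi : q ≠ i) (hqj : q ≠ j) (hqk : q ≠ k)
    (hql : q ≠ l) :
    (-U.comp i k k q + U.comp j l k q - U.comp i l l q - U.comp j k l q = 0) ∧
    (U.comp i l k q + U.comp j k k q - U.comp i k l q + U.comp j l l q = 0) := by
  have hz : IsNormalTo (nullVec i j) (nullVec k l) (cvec q) := by
    apply isNormalTo_nullVec <;> simp [cvec_apply, hqi.symm, hqj.symm, hqk.symm, hql.symm]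
  rw [← re_hermForm_nullVec] at h0
  have hv := (normal_variation hU (isotropicFrame_nullVec h) hz (isNormalTo_zero _ _) h0).1
  have e : tens (nullVec i j) (0 : Fin n → ℂ) = 0 := by funext a b; simp [tens]
  rw [e, zero_add] at hv
  simp only [nullVec, tens_add_left, tens_add_right, tens_smul_left, tens_smul_right, map_add,
    map_smulₛₗ, LinearMap.add_apply, LinearMap.smul_apply, hermForm_cvec, smul_eq_mul,
    Complex.conj_I, RingHom.id_apply] at hv
  have hre := congrArg Complex.re hv
  have him := congrArg Complex.im hv
  simp only [Complex.add_re, Complex.mul_re, Complex.add_im,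
    Complex.mul_im, Complex.I_re, Complex.I_im, Complex.ofReal_re, Complex.ofReal_im,
    Complex.neg_re, Complex.neg_im, Complex.zero_re, Complex.zero_im] at hre him
  constructor
  · linarith [U.pair_symm q k i k, U.pair_symm q k j l, U.pair_symm q l i l, U.pair_symm q l j k,
      U.antisymm_right i k k q, U.antisymm_right j l k q, U.antisymm_right i l l q,
      U.antisymm_right j k l q]
  · linarith [U.pair_symm q k i l, U.pair_symm q k j k, U.pair_symm q l i k, U.pair_symm q l j l,
      U.antisymm_right i l k q, U.antisymm_right j k k q, U.antisymm_right i k l q,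
      U.antisymm_right j l l q]

/-- The first variation of the isotropic curvature at a null frame inside the four-plane of the frame: real
and imaginary parts. -/
theorem first_variation_frame (hU : U ∈ PIC n) (h : Function.Injective ![i, j, k, l])
    (h0 : isoComp U i j k l = 0) :
    (U.comp i j i l + U.comp i j j k + U.comp i l k l + U.comp j k k l = 0) ∧
    (-U.comp i j i k + U.comp i j j l - U.comp i k k l + U.comp j l k l = 0) := by
  rw [← re_hermForm_nullVec] at h0
  have hv := frame_variation hU (isotropicFrame_nullVec h) h0
  simp only [star_nullVec, map_sub, LinearMap.sub_apply] at hv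
  simp only [nullVec, tens_add_left, tens_add_right, tens_smul_left, tens_smul_right, map_add,
    map_smulₛₗ, LinearMap.add_apply, LinearMap.smul_apply, hermForm_cvec, smul_eq_mul,
    Complex.conj_I, RingHom.id_apply, CurvTensor.comp_self_left] at hv
  have hre := congrArg Complex.re hv
  have him := congrArg Complex.im hv
  simp only [Complex.add_re, Complex.mul_re, Complex.add_im, Complex.sub_re, Complex.sub_im,
    Complex.mul_im, Complex.I_re, Complex.I_im, Complex.ofReal_re, Complex.ofReal_im,
    Complex.neg_re, Complex.neg_im, Complex.zero_re, Complex.zero_im] at hre him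
  have a1 := U.antisymm_left j i
  have a2 := U.antisymm_left l k
  constructor
  · linarith [a1 i k, a1 i l, a1 j k, a1 j l, a2 i k, a2 i l, a2 j k, a2 j l, U.pair_symm k l i k,
      U.pair_symm k l i l, U.pair_symm k l j k, U.pair_symm k l j l]
  · linarith [a1 i k, a1 i l, a1 j k, a1 j l, a2 i k, a2 i l, a2 j k, a2 j l, U.pair_symm k l i k,
      U.pair_symm k l i l, U.pair_symm k l j k, U.pair_symm k l j l]

open ComplexOrder in
/-- The Gram matrix of a family of two-tensors is positive semidefinite if the Hermitian form of the
curvature tensor is nonnegative on their span. -/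
theorem gram_posSemidef {κ : Type*} [Fintype κ] [DecidableEq κ] (R : CurvTensor n)
    (u : κ → Fin n → Fin n → ℂ)
    (h : ∀ c : κ → ℂ, 0 ≤ (hermForm R (∑ s, c s • u s) (∑ s, c s • u s)).re) :
    (Matrix.of fun s t => hermForm R (u s) (u t)).PosSemidef := by
  have hH : (Matrix.of fun s t => hermForm R (u s) (u t)).IsHermitian := by
    ext s t
    simp [Matrix.conjTranspose_apply, hermForm_conj]
  refine Matrix.PosSemidef.of_dotProduct_mulVec_nonneg hH fun x => ?_
  rw [Complex.le_def]
  refine ⟨?_, (hH.im_star_dotProduct_mulVec_self x).symm⟩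
  refine (h (star x)).trans_eq ?_
  congr 1
  simp only [map_sum, LinearMap.sum_apply, map_smulₛₗ, LinearMap.smul_apply, smul_eq_mul,
    RingHom.id_apply, dotProduct, Matrix.mulVec, Matrix.of_apply, Pi.star_apply, Finset.mul_sum,
    Complex.star_def, Complex.conj_conj]
  rw [Finset.sum_comm]
  refine Finset.sum_congr rfl fun s _ => Finset.sum_congr rfl fun t _ => ?_
  ring

/-- At a null frame, the terms of the isotropic curvature of `R^#` with both summation indices outside
the frame have nonnegative sum. The second variation turns it into the trace of a product of two positive
semidefinite matrices, one of which is the other with its blocks exchanged. -/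
theorem sharpDensity_normal_nonneg (hU : U ∈ PIC n) (h : Function.Injective ![i, j, k, l])
    (h0 : isoComp U i j k l = 0) :
    0 ≤ ∑ p : {p // p ∉ ({i, j, k, l} : Finset (Fin n))},
      ∑ q : {p // p ∉ ({i, j, k, l} : Finset (Fin n))}, sharpDensity U i j k l p q := by
  have h0' := h0
  rw [← re_hermForm_nullVec] at h0'
  set J := {p // p ∉ ({i, j, k, l} : Finset (Fin n))}
  let u : J ⊕ J → Fin n → Fin n → ℂ :=
    Sum.elim (fun p => tens (nullVec i j) (cvec p)) (fun p => tens (cvec p) (nullVec k l))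
  have hpsd := gram_posSemidef U u fun c => by
    have hz : ∀ c : J → ℂ, IsNormalTo (nullVec i j) (nullVec k l) (∑ p, c p • cvec (p : Fin n)) := by
      intro c
      apply isNormalTo_nullVec <;>
      · rw [Finset.sum_apply]
        refine Finset.sum_eq_zero fun p _ => ?_
        have := p.2
        simp only [Finset.mem_insert, Finset.mem_singleton, not_or] at this
        simp [cvec_apply, Ne.symm this.1, Ne.symm this.2.1, Ne.symm this.2.2.1,
          Ne.symm this.2.2.2]
    have hv := (normal_variation hU (isotropicFrame_nullVec h) (hz fun p => c (Sum.inr p))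
      (hz fun p => c (Sum.inl p)) h0').2
    have e : ∑ s, c s • u s = tens (nullVec i j) (∑ p : J, c (Sum.inl p) • cvec (p : Fin n))
        + tens (∑ p : J, c (Sum.inr p) • cvec (p : Fin n)) (nullVec k l) := by
      rw [Fintype.sum_sum_type]
      congr 1
      · funext a b
        simp [u, tens, Finset.sum_apply, Finset.mul_sum, mul_left_comm]
      · funext a b
        simp [u, tens, Finset.sum_apply, Finset.sum_mul, mul_assoc]
    rw [e]; exact hv
  have hblock : (Matrix.of fun s t => hermForm U (u s) (u t))
      = Matrix.fromBlocks (Matrix.of fun p q => hermForm U (u (Sum.inl p)) (u (Sum.inl q)))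
        (Matrix.of fun p q => hermForm U (u (Sum.inl p)) (u (Sum.inr q)))
        (Matrix.of fun p q => hermForm U (u (Sum.inl p)) (u (Sum.inr q))).conjTranspose
        (Matrix.of fun p q => hermForm U (u (Sum.inr p)) (u (Sum.inr q))) := by
    ext s t
    rcases s with s | s <;> rcases t with t | t <;>
      simp [Matrix.conjTranspose_apply, hermForm_conj]
  rw [hblock] at hpsd
  have htr := block_trace_nonneg hpsd
  rw [Complex.re_sum] at htr
  refine htr.trans_eq (Finset.sum_congr rfl fun p _ => ?_)
  rw [Complex.re_sum]
  refine Finset.sum_congr rfl fun q _ => ?_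
  obtain ⟨p, -⟩ := p
  obtain ⟨q, -⟩ := q
  simp only [u, Matrix.of_apply, Sum.elim_inl, Sum.elim_inr, Complex.star_def, hermForm_conj]
  simp only [nullVec, tens_add_left, tens_add_right, tens_smul_left, tens_smul_right, map_add,
    map_smulₛₗ, LinearMap.add_apply, LinearMap.smul_apply, hermForm_cvec, smul_eq_mul,
    Complex.conj_I, RingHom.id_apply]
  simp only [Complex.add_re, Complex.mul_re, Complex.add_im, Complex.sub_re,
    Complex.mul_im, Complex.I_re, Complex.I_im, Complex.ofReal_re, Complex.ofReal_im,
    Complex.neg_re, Complex.neg_im]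
  unfold sharpDensity
  simp only [U.antisymm_left p k, U.antisymm_left p l, U.antisymm_right _ _ q k,
    U.antisymm_right _ _ q l, U.pair_symm k p i q, U.pair_symm k p j q, U.pair_symm l p i q,
    U.pair_symm l p j q]
  ring

/-- At a null frame of a tensor in `PIC` the vector field `Q` does not point out of the cone. -/
theorem isoComp_Q_nonneg (hU : U ∈ PIC n) (h : Function.Injective ![i, j, k, l])
    (h0 : isoComp U i j k l = 0) : 0 ≤ isoComp (Q U) i j k l := by
  have hij : i ≠ j := fun e => absurd (@h 0 1 e) (by decide)
  have hik : i ≠ k := fun e => absurd (@h 0 2 e) (by decide)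
  have hil : i ≠ l := fun e => absurd (@h 0 3 e) (by decide)
  have hjk : j ≠ k := fun e => absurd (@h 1 2 e) (by decide)
  have hjl : j ≠ l := fun e => absurd (@h 1 3 e) (by decide)
  have hkl : k ≠ l := fun e => absurd (@h 2 3 e) (by decide)
  have hS : ∀ f : Fin n → ℝ, ∑ p ∈ ({i, j, k, l} : Finset (Fin n)), f p = f i + f j + f k + f l := by
    intro f
    rw [Finset.sum_insert (by simp [hij, hik, hil]), Finset.sum_insert (by simp [hjk, hjl]),
      Finset.sum_insert (by simp [hkl]), Finset.sum_singleton]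
    ring
  have hsplit : ∀ f : Fin n → ℝ, ∑ p, f p = (f i + f j + f k + f l)
      + ∑ p : {p // p ∉ ({i, j, k, l} : Finset (Fin n))}, f p := by
    intro f
    rw [← hS, ← Finset.sum_add_sum_compl ({i, j, k, l} : Finset (Fin n)) f]
    congr 1
    exact (Finset.sum_subtype _ (fun p => by simp) f)
  have hblock := sharpDensity_block U h0 (first_variation_frame hU h h0).1
    (first_variation_frame hU h h0).2
  have hmixed : ∀ q : {p // p ∉ ({i, j, k, l} : Finset (Fin n))}, _ := fun q => by
    have hq := q.2
    simp only [Finset.mem_insert, Finset.mem_singleton, not_or] at hq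
    exact sharpDensity_mixed U
      (first_variation_left hU h h0 hq.1 hq.2.1 hq.2.2.1 hq.2.2.2).1
      (first_variation_left hU h h0 hq.1 hq.2.1 hq.2.2.1 hq.2.2.2).2
      (first_variation_right hU h h0 hq.1 hq.2.1 hq.2.2.1 hq.2.2.2).1
      (first_variation_right hU h h0 hq.1 hq.2.1 hq.2.2.1 hq.2.2.2).2
  have hm := Finset.sum_eq_zero (s := Finset.univ) fun q _ => hmixed q
  simp only [Finset.sum_add_distrib] at hm
  have hnn := sharpDensity_normal_nonneg hU h h0
  have htot : 0 ≤ ∑ p, ∑ q, sharpDensity U i j k l p q := by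
    rw [hsplit]
    simp only [hsplit (fun q => sharpDensity U i j k l _ q), Finset.sum_add_distrib]
    linarith
  rw [isoComp_Q]
  refine add_nonneg (Finset.sum_nonneg fun p _ => Finset.sum_nonneg fun q _ => by positivity) ?_
  linarith

end

section

/-! ### Sums over frames, and Ricci curvature bounds on `PIC` -/

/-- If all sums over `r`-element subsets are nonnegative, so is the sum over any larger set. -/
theorem sum_nonneg_of_card_eq {ι : Type*} [DecidableEq ι] {f : ι → ℝ} {r : ℕ} (hr : 0 < r)
    (s : Finset ι) (hs : r ≤ s.card) (h : ∀ t ⊆ s, t.card = r → 0 ≤ ∑ p ∈ t, f p) :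
    0 ≤ ∑ p ∈ s, f p := by
  induction s using Finset.strongInduction with
  | H s ih =>
    rcases hs.eq_or_lt with h1 | h1
    · exact h s subset_rfl h1.symm
    · have h2 : 0 ≤ ∑ p ∈ s, ∑ q ∈ s.erase p, f q := by
        refine Finset.sum_nonneg fun p hp => ih _ (Finset.erase_ssubset hp) ?_ fun t ht =>
          h t (ht.trans (Finset.erase_subset _ _))
        rw [Finset.card_erase_of_mem hp]; omega
      have h3 : ∑ p ∈ s, ∑ q ∈ s.erase p, f q = ((s.card : ℝ) - 1) * ∑ p ∈ s, f p := by
        have : ∀ p ∈ s, ∑ q ∈ s.erase p, f q = (∑ q ∈ s, f q) - f p := fun p hp => by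
          rw [← Finset.add_sum_erase s f hp]; ring
        rw [Finset.sum_congr rfl this, Finset.sum_sub_distrib, Finset.sum_const, nsmul_eq_mul]
        ring
      rw [h3] at h2
      have h4 : (1 : ℝ) < s.card := by exact_mod_cast (show 1 < s.card by omega)
      exact nonneg_of_mul_nonneg_right h2 (by linarith)

theorem sum_nonneg_of_pairs {ι : Type*} [DecidableEq ι] {f : ι → ℝ} (s : Finset ι)
    (hs : 2 ≤ s.card) (h : ∀ p ∈ s, ∀ q ∈ s, p ≠ q → 0 ≤ f p + f q) : 0 ≤ ∑ p ∈ s, f p := by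
  refine sum_nonneg_of_card_eq two_pos s hs fun t ht hc => ?_
  obtain ⟨p, q, hpq, rfl⟩ := Finset.card_eq_two.1 hc
  rw [Finset.sum_pair hpq]
  exact h p (ht (by simp)) q (ht (by simp)) hpq

/-- The indices different from `i` and `j`. -/
def others (i j : Fin n) : Finset (Fin n) := {i, j}ᶜ

theorem mem_others {i j p : Fin n} : p ∈ others i j ↔ p ≠ i ∧ p ≠ j := by
  simp [others]

theorem card_others {i j : Fin n} (h : i ≠ j) : (others i j).card = n - 2 := by
  rw [others, Finset.card_compl, Finset.card_pair h, Fintype.card_fin]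

theorem sum_eq_add_sum_others {i j : Fin n} (h : i ≠ j) (f : Fin n → ℝ) :
    ∑ p, f p = f i + f j + ∑ p ∈ others i j, f p := by
  rw [others, ← Finset.sum_pair h, Finset.sum_add_sum_compl]

theorem injective_four {i j k l : Fin n} (hij : i ≠ j) (hik : i ≠ k) (hil : i ≠ l) (hjk : j ≠ k)
    (hjl : j ≠ l) (hkl : k ≠ l) : Function.Injective ![i, j, k, l] := by
  intro a b hab
  fin_cases a <;> fin_cases b <;> simp_all

variable {R : CurvTensor n}

theorem isoComp_swap (R : CurvTensor n) (i j k l : Fin n) : isoComp R i j l k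
    = R.comp i k i k + R.comp i l i l + R.comp j k j k + R.comp j l j l + 2 * R.comp i j k l := by
  unfold isoComp; rw [R.antisymm_right i j l k]; ring

theorem CurvTensor.comp_swap_swap (R : CurvTensor n) (i j : Fin n) :
    R.comp i j i j = R.comp j i j i := by
  rw [R.antisymm_left, R.antisymm_right]; ring

/-- `∑ (R_{ipip} + R_{jpjp})` over the indices `p` different from `i` and `j`. -/
theorem sum_others_eq {i j : Fin n} (h : i ≠ j) (R : CurvTensor n) :
    ∑ p ∈ others i j, (R.comp i p i p + R.comp j p j p)
      = ricci R i i + ricci R j j - 2 * R.comp i j i j := by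
  have h1 := sum_eq_add_sum_others h fun p => R.comp i p i p + R.comp j p j p
  simp only [CurvTensor.comp_self_left, Finset.sum_add_distrib] at h1
  rw [Finset.sum_add_distrib]
  unfold ricci
  have := R.comp_swap_swap i j
  linarith

/-- On `PIC`, the sum of `R_{ipip} + R_{jpjp}` over all `p ≠ i, j` is nonnegative: averaging the isotropic
curvatures over two frames removes the mixed component, so the sum of any two terms is nonnegative. -/
theorem ricci_pair_ge (hn : 5 ≤ n) (hR : R ∈ PIC n) {i j : Fin n} (h : i ≠ j) :
    0 ≤ ricci R i i + ricci R j j - 2 * R.comp i j i j := by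
  rw [← sum_others_eq h]
  refine sum_nonneg_of_pairs _ (by rw [card_others h]; omega) fun p hp q hq hpq => ?_
  rw [mem_others] at hp hq
  have hinj := injective_four h hp.1.symm hq.1.symm hp.2.symm hq.2.symm hpq
  have h1 := isoComp_nonneg hR hinj
  have h2 := isoComp_nonneg hR
    (injective_four h hq.1.symm hp.1.symm hq.2.symm hp.2.symm hpq.symm)
  rw [isoComp_swap] at h2
  unfold isoComp at h1
  linarith

/-- On `PIC` the Ricci tensor has nonnegative trace on four-dimensional subspaces. -/
theorem ricci_four_nonneg (hn : 5 ≤ n) (hR : R ∈ PIC n) {i j k l : Fin n}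
    (h : Function.Injective ![i, j, k, l]) :
    0 ≤ ricci R i i + ricci R j j + ricci R k k + ricci R l l := by
  have hij : i ≠ j := fun e => absurd (@h 0 1 e) (by decide)
  have hik : i ≠ k := fun e => absurd (@h 0 2 e) (by decide)
  have hil : i ≠ l := fun e => absurd (@h 0 3 e) (by decide)
  have hjk : j ≠ k := fun e => absurd (@h 1 2 e) (by decide)
  have hjl : j ≠ l := fun e => absurd (@h 1 3 e) (by decide)
  have hkl : k ≠ l := fun e => absurd (@h 2 3 e) (by decide)
  have a1 := isoComp_nonneg hR h
  have a2 := isoComp_nonneg hR (injective_four hij hil hik hjl hjk hkl.symm)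
  have a3 := isoComp_nonneg hR (injective_four hik hij hil hjk.symm hkl hjl)
  have a4 := isoComp_nonneg hR (injective_four hik hil hij hkl hjk.symm hjl.symm)
  rw [isoComp_swap] at a2 a4
  unfold isoComp at a1 a3
  have := R.comp_swap_swap j k
  have := ricci_pair_ge hn hR hij
  have := ricci_pair_ge hn hR hik
  have := ricci_pair_ge hn hR hil
  have := ricci_pair_ge hn hR hjk
  have := ricci_pair_ge hn hR hjl
  have := ricci_pair_ge hn hR hkl
  linarith

theorem sum_ricci_nonneg (hn : 5 ≤ n) (hR : R ∈ PIC n) {s : Finset (Fin n)} (hs : 4 ≤ s.card) :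
    0 ≤ ∑ p ∈ s, ricci R p p := by
  refine sum_nonneg_of_card_eq four_pos s hs fun t _ hc => ?_
  obtain ⟨i, j, k, l, hij, hik, hil, hjk, hjl, hkl, rfl⟩ := Finset.card_eq_four.1 hc
  rw [Finset.sum_insert (by simp [hij, hik, hil]), Finset.sum_insert (by simp [hjk, hjl]),
    Finset.sum_insert (by simp [hkl]), Finset.sum_singleton]
  have := ricci_four_nonneg hn hR (injective_four hij hik hil hjk hjl hkl)
  linarith

theorem scal_nonneg (hn : 5 ≤ n) (hR : R ∈ PIC n) : 0 ≤ scal R :=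
  sum_ricci_nonneg hn hR (by rw [Finset.card_univ, Fintype.card_fin]; omega)

theorem ricci_le_scal (hn : 5 ≤ n) (hR : R ∈ PIC n) (i : Fin n) : ricci R i i ≤ scal R := by
  have h := sum_ricci_nonneg hn hR (s := Finset.univ.erase i) (by
    rw [Finset.card_erase_of_mem (Finset.mem_univ _), Finset.card_univ, Fintype.card_fin]; omega)
  rw [scal, ← Finset.add_sum_erase _ _ (Finset.mem_univ i)]
  linarith

theorem neg_scal_le_ricci (hn : 5 ≤ n) (hR : R ∈ PIC n) (i : Fin n) :
    -(3 * scal R) ≤ ricci R i i := by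
  obtain ⟨t, ht, hc⟩ := Finset.exists_subset_card_eq (s := Finset.univ.erase i) (n := 3) (by
    rw [Finset.card_erase_of_mem (Finset.mem_univ _), Finset.card_univ, Fintype.card_fin]; omega)
  obtain ⟨j, k, l, hjk, hjl, hkl, rfl⟩ := Finset.card_eq_three.1 hc
  have hj : j ≠ i := Finset.ne_of_mem_erase (ht (by simp))
  have hk : k ≠ i := Finset.ne_of_mem_erase (ht (by simp))
  have hl : l ≠ i := Finset.ne_of_mem_erase (ht (by simp))
  have := ricci_four_nonneg hn hR (injective_four hj.symm hk.symm hl.symm hjk hjl hkl)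
  linarith [ricci_le_scal hn hR j, ricci_le_scal hn hR k, ricci_le_scal hn hR l]

theorem eval_sum₁ {ι : Type*} (R : CurvTensor n) (s : Finset ι) (c : ι → ℝ) (v : ι → Fin n → ℝ)
    (y z w : Fin n → ℝ) :
    R.eval (∑ i ∈ s, c i • v i) y z w = ∑ i ∈ s, c i * R.eval (v i) y z w := by
  classical
  induction s using Finset.induction_on with
  | empty => simpa using R.eval_smul₁ 0 0 y z w
  | insert a s ha ih => rw [Finset.sum_insert ha, Finset.sum_insert ha, R.eval_add₁, R.eval_smul₁, ih]

theorem rotate_rotate (A B : Matrix (Fin n) (Fin n) ℝ) (R : CurvTensor n) :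
    rotate A (rotate B R) = rotate (A * B) R := by
  have hAB : ∀ i, (A * B) i = ∑ p, A i p • B p := fun i => by
    rw [Matrix.mul_apply_eq_vecMul, Matrix.vecMul_eq_sum]
  have e2 : ∀ x y z w, R.eval x y z w = R.eval y x w z := fun x y z w => by
    rw [R.eval_swap_left, R.eval_swap_right, neg_neg]
  refine CurvTensor.ext_comp fun i j k l => ?_
  have h1 : ∀ i (y z w : Fin n → ℝ), R.eval ((A * B) i) y z w = ∑ p, A i p * R.eval (B p) y z w :=
    fun i y z w => (congrArg (fun v => R.eval v y z w) (hAB i)).trans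
      (eval_sum₁ R Finset.univ (fun p => A i p) (fun p => B p) y z w)
  have h2 : ∀ x z w : Fin n → ℝ, R.eval x ((A * B) j) z w = ∑ p, A j p * R.eval x (B p) z w :=
    fun x z w => by
      rw [e2, h1]
      exact Finset.sum_congr rfl fun p _ => congrArg _ (e2 _ _ _ _)
  have h3 : ∀ x y w : Fin n → ℝ, R.eval x y ((A * B) k) w = ∑ p, A k p * R.eval x y (B p) w :=
    fun x y w => by
      rw [← R.eval_swap_pair, h1]
      exact Finset.sum_congr rfl fun p _ => congrArg _ (R.eval_swap_pair _ _ _ _)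
  have h4 : ∀ x y z : Fin n → ℝ, R.eval x y z ((A * B) l) = ∑ p, A l p * R.eval x y z (B p) :=
    fun x y z => by
      rw [e2, ← R.eval_swap_pair, h1]
      refine Finset.sum_congr rfl fun p _ => congrArg _ ?_
      rw [R.eval_swap_pair, e2]
  rw [comp_rotate (A * B), h1]
  simp only [h2, h3, h4, Finset.mul_sum]
  change ∑ p, ∑ q, ∑ r, ∑ t, A i p * A j q * A k r * A l t * (rotate B R).comp p q r t = _
  refine Finset.sum_congr rfl fun p _ => Finset.sum_congr rfl fun q _ =>
    Finset.sum_congr rfl fun r _ => Finset.sum_congr rfl fun t _ => ?_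
  rw [comp_rotate]
  ring

theorem rotate_mem_PIC (hR : R ∈ PIC n) {A : Matrix (Fin n) (Fin n) ℝ}
    (hA : A ∈ Matrix.orthogonalGroup (Fin n) ℝ) : rotate A R ∈ PIC n := by
  by_cases hn : 4 ≤ n
  · have hf : Function.Injective (Fin.castLE hn) := Fin.castLE_injective hn
    rw [mem_PIC_iff_rotate hf] at hR ⊢
    intro B hB
    rw [rotate_rotate]
    exact hR _ (mul_mem hB hA)
  · intro e he
    have := he.linearIndependent.fintype_card_le_finrank
    simp at this
    omega

/-- Bounds for the Ricci curvature in the direction of an arbitrary unit vector. -/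
theorem ricForm_le_scal (hn : 5 ≤ n) (hR : R ∈ PIC n) {v : Fin n → ℝ} (hv : v ⬝ᵥ v = 1) :
    -(3 * scal R) ≤ ricForm R v v ∧ ricForm R v v ≤ scal R := by
  have hv' : OrthoTuple ![v] := by
    intro a b; fin_cases a; fin_cases b; simpa using hv
  have hinj : Function.Injective ![(⟨0, by omega⟩ : Fin n)] := fun a b _ => Subsingleton.elim a b
  obtain ⟨A, hA, hAv⟩ := hv'.exists_orthogonal hinj
  have h0 : A (⟨0, by omega⟩ : Fin n) = v := hAv 0
  rw [← h0, ← ricci_rotate hA, ← scal_rotate hA]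
  exact ⟨neg_scal_le_ricci hn (rotate_mem_PIC hR hA) _, ricci_le_scal hn (rotate_mem_PIC hR hA) _⟩

theorem abs_ricci_le (hn : 5 ≤ n) (hR : R ∈ PIC n) {i j : Fin n} (hij : i ≠ j) :
    |ricci R i j| ≤ 4 * scal R := by
  have hs : (√2)⁻¹ * (√2)⁻¹ = (1 / 2 : ℝ) := by
    rw [← mul_inv, Real.mul_self_sqrt (by norm_num)]; norm_num
  have key : ∀ ε : ℝ, ε * ε = 1 →
      -(3 * scal R) ≤ (ricci R i i + ricci R j j) / 2 + ε * ricci R i j ∧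
      (ricci R i i + ricci R j j) / 2 + ε * ricci R i j ≤ scal R := by
    intro ε hε
    have h := ricForm_le_scal hn hR (v := (√2)⁻¹ • (stdVec i + ε • stdVec j)) (by
      simp only [smul_dotProduct, dotProduct_smul, add_dotProduct, dotProduct_add, dot_stdVec,
        smul_eq_mul, hij, hij.symm, if_true, if_false]
      linear_combination (1 + ε * ε) * hs + 1 / 2 * hε)
    have e : ricForm R ((√2)⁻¹ • (stdVec i + ε • stdVec j)) ((√2)⁻¹ • (stdVec i + ε • stdVec j))
        = (ricci R i i + ricci R j j) / 2 + ε * ricci R i j := by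
      simp only [ricForm_smul_left, ricForm_smul_right, ricForm_add_left, ricForm_add_right,
        ricForm_stdVec]
      rw [ricci_symm R j i]
      linear_combination (ricci R i i + ε * ricci R i j + ε * ricci R i j
        + ε * ε * ricci R j j) * hs + 1 / 2 * ricci R j j * hε
    rwa [e] at h
  have h1 := key 1 (by norm_num)
  have h2 := key (-1) (by norm_num)
  rw [abs_le]
  constructor <;> linarith [ricci_le_scal hn hR i, ricci_le_scal hn hR j, neg_scal_le_ricci hn hR i,
    neg_scal_le_ricci hn hR j, h1.1, h1.2, h2.1, h2.2]

end

/-! ### Contractions and the Hamilton vector field of a modified tensor -/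

theorem ricci_add (R S : CurvTensor n) (i k : Fin n) :
    ricci (R + S) i k = ricci R i k + ricci S i k := by
  simp only [ricci, comp_add, Finset.sum_add_distrib]

theorem ricci_sub (R S : CurvTensor n) (i k : Fin n) :
    ricci (R - S) i k = ricci R i k - ricci S i k := by
  simp only [ricci, comp_sub, Finset.sum_sub_distrib]

theorem ricci_smul (c : ℝ) (R : CurvTensor n) (i k : Fin n) :
    ricci (c • R) i k = c * ricci R i k := by
  simp only [ricci, comp_smul, Finset.mul_sum]

/-- `(A * S)_{ij} = ∑ A_{pq} S_{ipjq}`. -/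
def starForm (A : Matrix (Fin n) (Fin n) ℝ) (S : CurvTensor n) (i j : Fin n) : ℝ :=
  ∑ p, ∑ q, A p q * S.comp i p j q

/-- The Ricci tensor as a matrix. -/
def ricMat (R : CurvTensor n) : Matrix (Fin n) (Fin n) ℝ := Matrix.of (ricci R)

theorem ricMat_isSymm (R : CurvTensor n) : (ricMat R).IsSymm := by
  ext i j; exact ricci_symm R j i

theorem ricci_Q (R : CurvTensor n) (i k : Fin n) :
    ricci (Q R) i k = 2 * starForm (ricMat R) R i k := by
  have hab : ∑ j, auxB R i j k j = 2 * ∑ j, auxB R i j j k := by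
    have h1 : ∑ j, auxB R i j j k = ∑ j, auxB R i j k j
        + ∑ j, ∑ p, ∑ q, R.comp i p j q * R.comp k j q p := by
      simp only [auxB, ← Finset.sum_add_distrib]
      refine Finset.sum_congr rfl fun j _ => Finset.sum_congr rfl fun p _ =>
        Finset.sum_congr rfl fun q _ => ?_
      have h2 := R.bianchi p j q k
      have h3 := R.pair_symm p j q k
      have h4 := R.pair_symm j q p k
      have h5 := R.pair_symm q p j k
      have h6 := R.pair_symm j p k q
      have h8 := R.antisymm_left p k j q
      have h9 := R.antisymm_left j k q p
      have h10 := R.antisymm_left q k p j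
      have h11 := R.antisymm_right k q p j
      linear_combination R.comp i p j q * (h6 + h2 - h3 - h4 - h5 - h8 - h9 - h10 + h11)
    have h2 : ∑ j, ∑ p, ∑ q, R.comp i p j q * R.comp k j q p = -∑ j, auxB R i j j k := by
      rw [Finset.sum_comm]
      have h3 : ∀ p, ∑ j, ∑ q, R.comp i p j q * R.comp k j q p
          = -∑ j, ∑ q, R.comp i p j q * R.comp j p k q := by
        intro p
        rw [Finset.sum_comm, ← Finset.sum_neg_distrib]
        refine Finset.sum_congr rfl fun j _ => ?_
        rw [← Finset.sum_neg_distrib]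
        refine Finset.sum_congr rfl fun q _ => ?_
        rw [R.antisymm_right i p q j, R.pair_symm j p k q]
        ring
      simp only [h3, auxB, Finset.sum_neg_distrib]
      rw [Finset.sum_comm]
    linarith
  have hc : ∑ j, auxB R i k j j = starForm (ricMat R) R i k := by
    unfold auxB starForm
    rw [Finset.sum_comm]
    refine Finset.sum_congr rfl fun p _ => ?_
    rw [Finset.sum_comm]
    refine Finset.sum_congr rfl fun q _ => ?_
    rw [← Finset.mul_sum, mul_comm]
    congr 1
    exact Finset.sum_congr rfl fun j _ => by rw [R.antisymm_left, R.antisymm_right]; ring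
  rw [ricci]
  simp only [comp_Q, ← Finset.mul_sum, Finset.sum_add_distrib, Finset.sum_sub_distrib]
  linarith

theorem scal_Q (R : CurvTensor n) : scal (Q R) = 2 * ∑ p, ∑ q, ricci R p q ^ 2 := by
  simp only [scal, ricci_Q, starForm, ricMat, Matrix.of_apply, ← Finset.mul_sum]
  congr 1
  rw [Finset.sum_comm]
  refine Finset.sum_congr rfl fun p _ => ?_
  rw [Finset.sum_comm]
  refine Finset.sum_congr rfl fun q _ => ?_
  rw [← Finset.mul_sum, sq]
  congr 1
  exact Finset.sum_congr rfl fun i _ => by rw [R.antisymm_left, R.antisymm_right]; ring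

/-- The product `A ∧ id`. -/
def knId (A : Matrix (Fin n) (Fin n) ℝ) (hA : A.IsSymm) : CurvTensor n :=
  kulkarniNomizu A 1 hA Matrix.isSymm_one

theorem comp_knId (A : Matrix (Fin n) (Fin n) ℝ) (hA : A.IsSymm) (i j k l : Fin n) :
    (knId A hA).comp i j k l = A i k * (if j = l then 1 else 0) - A i l * (if j = k then 1 else 0)
      - A j k * (if i = l then 1 else 0) + A j l * (if i = k then 1 else 0) := by
  simp only [← Matrix.one_apply]; rfl

theorem ricci_knId (A : Matrix (Fin n) (Fin n) ℝ) (hA : A.IsSymm) (i k : Fin n) :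
    ricci (knId A hA) i k = ((n : ℝ) - 2) * A i k + A.trace * (if i = k then 1 else 0) := by
  simp only [ricci, comp_knId, Finset.sum_add_distrib, Finset.sum_sub_distrib, mul_ite, mul_one,
    mul_zero, Finset.sum_ite_eq, Finset.sum_ite_eq', Finset.mem_univ, if_true, Finset.sum_const,
    Finset.card_univ, Fintype.card_fin, nsmul_eq_mul, Matrix.trace, Matrix.diag_apply]
  rw [Finset.sum_ite_irrel]
  simp only [Finset.sum_const_zero]
  ring

theorem starForm_knId (A : Matrix (Fin n) (Fin n) ℝ) (hA : A.IsSymm) (i j : Fin n) :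
    starForm A (knId A hA) i j = A.trace * A i j - 2 * ∑ p, A i p * A j p
      + (∑ p, ∑ q, A p q ^ 2) * (if i = j then 1 else 0) := by
  simp only [starForm, comp_knId, mul_add, mul_sub, mul_ite, mul_one, mul_zero,
    Finset.sum_add_distrib, Finset.sum_sub_distrib, Finset.sum_ite_irrel, Finset.sum_const_zero,
    Finset.sum_ite_eq, Finset.sum_ite_eq', Finset.mem_univ, if_true]
  have h1 : ∑ q, A j q * A i q = ∑ p, A i p * A j p :=
    Finset.sum_congr rfl fun p _ => mul_comm _ _
  have h2 : ∑ p, A p i * A p j = ∑ p, A i p * A j p :=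
    Finset.sum_congr rfl fun p _ => by rw [hA.apply i p, hA.apply j p]
  rw [h1, h2, ← Finset.sum_mul]
  simp only [sq, Matrix.trace, Matrix.diag_apply]
  ring

theorem starForm_add (A : Matrix (Fin n) (Fin n) ℝ) (S T : CurvTensor n) (i j : Fin n) :
    starForm A (S + T) i j = starForm A S i j + starForm A T i j := by
  simp only [starForm, comp_add, mul_add, Finset.sum_add_distrib]

theorem starForm_sub (A : Matrix (Fin n) (Fin n) ℝ) (S T : CurvTensor n) (i j : Fin n) :
    starForm A (S - T) i j = starForm A S i j - starForm A T i j := by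
  simp only [starForm, comp_sub, mul_sub, Finset.sum_sub_distrib]

/-- The contraction `∑_q A_{aq} S_{qbcd}`. -/
def contractFirst (A : Matrix (Fin n) (Fin n) ℝ) (S : CurvTensor n) (a b c d : Fin n) : ℝ :=
  ∑ q, A a q * S.comp q b c d

theorem contractFirst_antisymm (A : Matrix (Fin n) (Fin n) ℝ) (S : CurvTensor n)
    (a b c d : Fin n) : contractFirst A S a b c d = -contractFirst A S a b d c := by
  simp only [contractFirst, ← Finset.sum_neg_distrib]
  exact Finset.sum_congr rfl fun q _ => by rw [S.antisymm_right]; ring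

theorem sum_comp_mul_knId (A : Matrix (Fin n) (Fin n) ℝ) (hA : A.IsSymm) (S : CurvTensor n)
    (i j k l : Fin n) : ∑ p, ∑ q, S.comp i p j q * (knId A hA).comp k p l q
      = A k l * ricci S i j - contractFirst A S k j l i - contractFirst A S l i k j
        + (if k = l then 1 else 0) * starForm A S i j := by
  simp only [comp_knId, mul_add, mul_sub, mul_ite, mul_one, mul_zero,
    Finset.sum_add_distrib, Finset.sum_sub_distrib, Finset.sum_ite_irrel, Finset.sum_const_zero,
    Finset.sum_ite_eq, Finset.sum_ite_eq', Finset.mem_univ, if_true]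
  have h1 : ∑ q, S.comp i l j q * A k q = contractFirst A S k j l i :=
    Finset.sum_congr rfl fun q _ => by
      rw [S.pair_symm, S.antisymm_left, S.antisymm_right]; ring
  have h2 : ∑ p, S.comp i p j k * A p l = contractFirst A S l i k j :=
    Finset.sum_congr rfl fun p _ => by
      rw [S.antisymm_left, S.antisymm_right, hA.apply l p]; ring
  have h3 : ∑ p, S.comp i p j p * A k l = A k l * ricci S i j := by
    rw [← Finset.sum_mul, mul_comm, ricci]
  have h4 : ∑ p, ∑ q, S.comp i p j q * A p q = starForm A S i j :=
    Finset.sum_congr rfl fun p _ => Finset.sum_congr rfl fun q _ => mul_comm _ _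
  rw [h1, h2, h3, h4]
  split_ifs <;> ring

/-- `Q(U + A ∧ id) = Q(U) + A ∧ (Ric_U + Ric_R) + (A * (U + R)) ∧ id` for `R = U + A ∧ id`. -/
theorem comp_Q_add_knId (A : Matrix (Fin n) (Fin n) ℝ) (hA : A.IsSymm) (U S : CurvTensor n)
    (hS : S = U + (U + knId A hA)) (i j k l : Fin n) :
    (Q (U + knId A hA)).comp i j k l = (Q U).comp i j k l
      + (A i k * ricci S j l - A i l * ricci S j k - A j k * ricci S i l + A j l * ricci S i k)
      + (starForm A S i k * (if j = l then 1 else 0) - starForm A S i l * (if j = k then 1 else 0)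
        - starForm A S j k * (if i = l then 1 else 0)
        + starForm A S j l * (if i = k then 1 else 0)) := by
  have hB : ∀ i j k l, auxB (U + knId A hA) i j k l = auxB U i j k l
      + 1 / 2 * (∑ p, ∑ q, S.comp i p j q * (knId A hA).comp k p l q
        + ∑ p, ∑ q, S.comp k p l q * (knId A hA).comp i p j q) := by
    intro i j k l
    simp only [auxB, hS, comp_add, Finset.mul_sum, ← Finset.sum_add_distrib]
    refine Finset.sum_congr rfl fun p _ => Finset.sum_congr rfl fun q _ => ?_
    ring
  have hsymm : ∀ a b, A a b = A b a := fun a b => hA.apply b a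
  have hst : ∀ a b, starForm A S a b = starForm A S b a := by
    intro a b
    unfold starForm
    rw [Finset.sum_comm]
    refine Finset.sum_congr rfl fun p _ => Finset.sum_congr rfl fun q _ => ?_
    rw [hsymm, S.pair_symm]
  have hδ : ∀ a b : Fin n, (if a = b then (1 : ℝ) else 0) = if b = a then 1 else 0 := by
    intro a b; simp only [eq_comm]
  rw [comp_Q, comp_Q]
  simp only [hB, sum_comp_mul_knId]
  have c := contractFirst_antisymm A S
  rw [hst l k, hδ l k, hsymm l k, ricci_symm S l k]
  linarith [c k j l i, c k i l j, c l j k i, c l i k j, c i j k l, c i k j l, c i l j k, c j k i l,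
    c j i k l, c j l i k, c k l i j, c l k i j]

section

/-! ### The pinching functionals -/

/-- The trace of the Ricci tensor over four basis vectors. -/
def traceFour (R : CurvTensor n) (i j k l : Fin n) : ℝ :=
  ricci R i i + ricci R j j + ricci R k k + ricci R l l

/-- The isotropic curvature of `R - (b Ric - g scal id) ∧ id`. -/
def isoPinch (b g : ℝ) (R : CurvTensor n) (i j k l : Fin n) : ℝ :=
  isoComp R i j k l - 2 * b * traceFour R i j k l + 8 * g * scal R

/-- The functional `Ric_{ii} + Ric_{jj} + δ (Ric_{ii} + Ric_{jj} - 2 R_{ijij}) - ω scal`. -/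
def ricPinch (δ ω : ℝ) (R : CurvTensor n) (i j : Fin n) : ℝ :=
  (1 + δ) * (ricci R i i + ricci R j j) - 2 * δ * R.comp i j i j - ω * scal R

theorem isSymm_shift (b τ : ℝ) (R : CurvTensor n) :
    (b • ricMat R - τ • (1 : Matrix (Fin n) (Fin n) ℝ)).IsSymm :=
  ((ricMat_isSymm R).smul b).sub (Matrix.isSymm_one.smul τ)

/-- The tensor `R - (b Ric - τ id) ∧ id`. -/
def corrected (b τ : ℝ) (R : CurvTensor n) : CurvTensor n := R - knId _ (isSymm_shift b τ R)

theorem shift_apply (b τ : ℝ) (R : CurvTensor n) (i j : Fin n) :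
    (b • ricMat R - τ • (1 : Matrix (Fin n) (Fin n) ℝ)) i j
      = b * ricci R i j - τ * (if i = j then 1 else 0) := by
  simp [ricMat, Matrix.one_apply]

theorem shift_trace (b τ : ℝ) (R : CurvTensor n) :
    (b • ricMat R - τ • (1 : Matrix (Fin n) (Fin n) ℝ)).trace = b * scal R - n * τ := by
  simp [ricMat, scal, Matrix.trace, Finset.mul_sum, mul_comm]

theorem isoComp_sub (R S : CurvTensor n) (i j k l : Fin n) :
    isoComp (R - S) i j k l = isoComp R i j k l - isoComp S i j k l := by
  simp only [isoComp, comp_sub]; ring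

theorem scal_add (R S : CurvTensor n) : scal (R + S) = scal R + scal S := by
  simp only [scal, ricci_add, Finset.sum_add_distrib]

theorem scal_smul (c : ℝ) (R : CurvTensor n) : scal (c • R) = c * scal R := by
  simp only [scal, ricci_smul, Finset.mul_sum]

theorem ricci_corrected (b τ : ℝ) (R : CurvTensor n) (i k : Fin n) :
    ricci (corrected b τ R) i k = (1 - ((n : ℝ) - 2) * b) * ricci R i k
      - (b * scal R - (2 * n - 2) * τ) * (if i = k then 1 else 0) := by
  rw [corrected, ricci_sub, ricci_knId, shift_apply, shift_trace]
  ring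

theorem scal_corrected (b τ : ℝ) (R : CurvTensor n) :
    scal (corrected b τ R) = (1 - (2 * (n : ℝ) - 2) * b) * scal R + 2 * n * (n - 1) * τ := by
  simp only [scal, ricci_corrected, if_true, mul_one, Finset.sum_sub_distrib, ← Finset.mul_sum,
    Finset.sum_const, Finset.card_univ, Fintype.card_fin, nsmul_eq_mul]
  ring

section Distinct

variable {i j k l : Fin n} (h : Function.Injective ![i, j, k, l])
include h

theorem isoComp_corrected (b τ : ℝ) (R : CurvTensor n) :
    isoComp (corrected b τ R) i j k l
      = isoComp R i j k l - 2 * b * traceFour R i j k l + 8 * τ := by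
  have hik : i ≠ k := fun e => absurd (@h 0 2 e) (by decide)
  have hil : i ≠ l := fun e => absurd (@h 0 3 e) (by decide)
  have hjk : j ≠ k := fun e => absurd (@h 1 2 e) (by decide)
  have hjl : j ≠ l := fun e => absurd (@h 1 3 e) (by decide)
  rw [corrected, isoComp_sub]
  simp only [isoComp, traceFour, comp_knId, shift_apply, hik, hil, hjk, hjl, hik.symm,
    hjk.symm, hil.symm, hjl.symm, if_true, if_false]
  ring

/-- The evolution of the isotropic curvature functional: up to the isotropic curvature of `Q(U)`,
`U = R - (b Ric - τ id) ∧ id`, it depends on the Ricci tensor alone. -/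
theorem isoPinch_Q (b g τ : ℝ) (R : CurvTensor n) :
    isoPinch b g (Q R) i j k l = isoComp (Q (corrected b τ R)) i j k l
      + ((4 * b - 2 * (n - 2) * b ^ 2) * ((ricci R i i + ricci R j j) * (ricci R k k + ricci R l l)
          - (ricci R i k + ricci R j l) ^ 2 - (ricci R j k - ricci R i l) ^ 2)
        + (16 * g - 8 * b ^ 2) * ∑ p, ∑ q, ricci R p q ^ 2
        + 4 * b ^ 2 * (∑ q, ricci R i q ^ 2 + ∑ q, ricci R j q ^ 2 + ∑ q, ricci R k q ^ 2
          + ∑ q, ricci R l q ^ 2)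
        - 4 * b ^ 2 * scal R * traceFour R i j k l - 8 * τ * traceFour R i j k l
        + (8 * n - 16) * b * τ * traceFour R i j k l + 32 * b * τ * scal R
        - 32 * (n - 1) * τ ^ 2) := by
  have hij : i ≠ j := fun e => absurd (@h 0 1 e) (by decide)
  have hik : i ≠ k := fun e => absurd (@h 0 2 e) (by decide)
  have hil : i ≠ l := fun e => absurd (@h 0 3 e) (by decide)
  have hjk : j ≠ k := fun e => absurd (@h 1 2 e) (by decide)
  have hjl : j ≠ l := fun e => absurd (@h 1 3 e) (by decide)
  have hkl : k ≠ l := fun e => absurd (@h 2 3 e) (by decide)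
  set A := b • ricMat R - τ • (1 : Matrix (Fin n) (Fin n) ℝ) with hAdef
  have hR : R = corrected b τ R + knId A (isSymm_shift b τ R) := by rw [corrected]; abel
  set S := corrected b τ R + (corrected b τ R + knId A (isSymm_shift b τ R)) with hS
  have hSR : S = R + (R - knId A (isSymm_shift b τ R)) := by
    rw [hS, ← hR, corrected]; abel
  have hQ := comp_Q_add_knId A (isSymm_shift b τ R) (corrected b τ R) S hS
  rw [← hR] at hQ
  have hricS : ∀ a c, ricci S a c = ricci R a c + ((1 - ((n : ℝ) - 2) * b) * ricci R a c
      - (b * scal R - (2 * n - 2) * τ) * (if a = c then 1 else 0)) := by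
    intro a c
    rw [← ricci_corrected, ← ricci_add, hSR, corrected]
  have hstarR : ∀ a, starForm A R a a = b * starForm (ricMat R) R a a - τ * ricci R a a := by
    intro a
    have e : ∑ p, R.comp a p a p = ∑ p, ∑ q, (if p = q then 1 else 0) * R.comp a p a q := by
      simp
    simp only [starForm, ricci, e, Finset.mul_sum, ← Finset.sum_sub_distrib]
    refine Finset.sum_congr rfl fun p _ => Finset.sum_congr rfl fun q _ => ?_
    rw [hAdef, shift_apply]
    simp only [ricMat, Matrix.of_apply]
    ring
  have hAA : ∀ a, ∑ p, A a p * A a p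
      = b ^ 2 * ∑ q, ricci R a q ^ 2 - 2 * b * τ * ricci R a a + τ ^ 2 := by
    intro a
    have e1 : ricci R a a = ∑ q, (if a = q then 1 else 0) * ricci R a q := by simp
    have e2 : τ ^ 2 = ∑ q : Fin n, if a = q then τ ^ 2 else 0 := by simp
    conv_rhs => rw [e1, e2]
    simp only [Finset.mul_sum, ← Finset.sum_sub_distrib, ← Finset.sum_add_distrib]
    refine Finset.sum_congr rfl fun q _ => ?_
    rw [hAdef, shift_apply]
    split_ifs <;> ring
  have hA2 : ∑ p, ∑ q, A p q ^ 2
      = b ^ 2 * (∑ p, ∑ q, ricci R p q ^ 2) - 2 * b * τ * scal R + n * τ ^ 2 := by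
    simp only [sq (A _ _), hAA, Finset.sum_add_distrib, Finset.sum_sub_distrib, ← Finset.mul_sum,
      scal, Finset.sum_const, Finset.card_univ, Fintype.card_fin, nsmul_eq_mul]
  have hstarS : ∀ a, starForm A S a a = 2 * (b * starForm (ricMat R) R a a - τ * ricci R a a)
      - ((b * scal R - n * τ) * (b * ricci R a a - τ)
        - 2 * (b ^ 2 * ∑ q, ricci R a q ^ 2 - 2 * b * τ * ricci R a a + τ ^ 2)
        + (b ^ 2 * (∑ p, ∑ q, ricci R p q ^ 2) - 2 * b * τ * scal R + n * τ ^ 2)) := by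
    intro a
    rw [hSR, starForm_add, starForm_sub, starForm_knId, hstarR, hAA, hA2, hAdef, shift_trace,
      shift_apply, if_pos rfl]
    ring
  have hoff : ∀ a c, a ≠ c → A a c = b * ricci R a c := by
    intro a c hac
    rw [hAdef, shift_apply, if_neg hac]; ring
  have hdiag : ∀ a, A a a = b * ricci R a a - τ := by
    intro a
    rw [hAdef, shift_apply, if_pos rfl]; ring
  simp only [isoPinch, traceFour, scal_Q, ricci_Q, isoComp, hQ, hricS, hoff _ _ hik, hoff _ _ hil,
    hoff _ _ hjk, hoff _ _ hjl, hoff _ _ hik.symm, hoff _ _ hil.symm, hoff _ _ hjk.symm,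
    hoff _ _ hjl.symm, hdiag, hik, hil, hjk, hjl,
    hik.symm, hjk.symm, hil.symm, hjl.symm, if_true, if_false, hstarS]
  rw [ricci_symm R k i, ricci_symm R l i, ricci_symm R k j, ricci_symm R l j]
  ring

end Distinct

end

section

/-! ### The pinching set -/

/-- Smallness of the pinching parameter `b` relative to the dimension and to the constants `κ` and
`N`. -/
structure SmallParams (n : ℕ) (b κ N : ℝ) : Prop where
  dim : 5 ≤ n
  b_pos : 0 < b
  κ_pos : 0 < κ
  N_nonneg : 0 ≤ N
  b_small : 10 ^ 7 * (n : ℝ) ^ 5 * b ≤ 1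
  N_small : 1000 * n * b * N ≤ κ
  N_sq_small : 8 * b * N ^ 2 ≤ κ ^ 2

namespace SmallParams

variable {b κ N : ℝ} (hp : SmallParams n b κ N)
include hp

theorem five_le : (5 : ℝ) ≤ n := by exact_mod_cast hp.dim

theorem pow_mul_le {m : ℕ} (hm : m ≤ 5) : 10 ^ 7 * ((n : ℝ) ^ m * b) ≤ 1 := by
  have h1 : (n : ℝ) ^ m ≤ (n : ℝ) ^ 5 :=
    pow_le_pow_right₀ (by linarith [hp.five_le]) hm
  have h2 := mul_le_mul_of_nonneg_right h1 hp.b_pos.le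
  linarith [hp.b_small]

theorem b_le : 10 ^ 7 * b ≤ 1 := by
  have := hp.pow_mul_le (m := 0) (by norm_num)
  linarith

theorem coef_le : 1 / (4 * (n : ℝ)) ≤ 1 / 20 ∧ (1 / 2 + 1 / (4 * (n : ℝ))) * b ^ 2 ≤ b ^ 2 := by
  have h1 : 1 / (4 * (n : ℝ)) ≤ 1 / 20 :=
    one_div_le_one_div_of_le (by norm_num) (by linarith [hp.five_le])
  exact ⟨h1, mul_le_of_le_one_left (sq_nonneg b) (by linarith)⟩

end SmallParams

/-- The real-variable inequality behind the invariance of the isotropic curvature condition: `t` is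
the trace of the Ricci tensor on the four-plane, `P` its squared norm, `q` the squared norm of its
four rows, and `D` the determinant-like quantity of the two-planes. -/
theorem isoPinch_boundary_real {b κ N s t P q D g τ μ : ℝ} (hp : SmallParams n b κ N)
    (hs : 0 ≤ s) (ht0 : 0 ≤ t) (ht4 : t ≤ 4 * s) (hP : s ^ 2 ≤ n * P) (hq : t ^ 2 ≤ 4 * q)
    (hμ : μ = (2 - 1 / (4 * n)) * b * s - N) (hD : μ * t - μ ^ 2 ≤ D)
    (hg : g = (1 / 2 + 1 / (4 * n)) * b ^ 2) (hτ : τ = g * s - κ)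
    (ht : 4 * b * s - 8 * (n - 1) * τ ≤ (1 - (n - 2) * b) * t) :
    0 ≤ (4 * b - 2 * (n - 2) * b ^ 2) * D + (16 * g - 8 * b ^ 2) * P + 4 * b ^ 2 * q
        - 4 * b ^ 2 * s * t - 8 * τ * t + (8 * n - 16) * b * τ * t + 32 * b * τ * s
        - 32 * (n - 1) * τ ^ 2 := by
  obtain ⟨hn, hb, hκ, hN, hb1, hN1, hN2⟩ := hp
  have hν5 : (5 : ℝ) ≤ n := by exact_mod_cast hn
  generalize (n : ℝ) = ν at *
  obtain ⟨e, he⟩ : ∃ e : ℝ, e = 1 / (4 * ν) := ⟨_, rfl⟩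
  have heν : e * ν = 1 / 4 := by rw [he]; field_simp
  have he0 : 0 < e := by rw [he]; positivity
  have he1 : e ≤ 1 / 20 := by
    rw [he]; exact one_div_le_one_div_of_le (by norm_num) (by linarith)
  rw [← he] at hμ hg
  obtain ⟨y, hy⟩ : ∃ y, y = b * s := ⟨_, rfl⟩
  have hy0 : 0 ≤ y := by rw [hy]; positivity
  -- smallness of `b` in terms of `e`
  have hbe : 48 * ν * b ≤ e ^ 2 := by
    have h1 : e ^ 2 * ν ^ 2 = 1 / 16 := by
      have : e ^ 2 * ν ^ 2 = (e * ν) ^ 2 := by ring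
      rw [this, heν]; norm_num
    have h2 : (48 * ν * b) * ν ^ 2 ≤ e ^ 2 * ν ^ 2 := by
      rw [h1]
      have h4 : ν ^ 3 * 5 ^ 2 ≤ ν ^ 5 := by
        have h3 := mul_le_mul_of_nonneg_left (pow_le_pow_left₀ (by norm_num) hν5 2)
          (show 0 ≤ ν ^ 3 by positivity)
        linarith
      have h5 : ν ^ 3 * 5 ^ 2 * b ≤ ν ^ 5 * b := mul_le_mul_of_nonneg_right h4 hb.le
      linarith
    exact le_of_mul_le_mul_right h2 (by positivity)
  have hee : e ^ 2 ≤ e := by rw [sq]; exact mul_le_of_le_one_left he0.le (by linarith)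
  have hbν : 48 * (ν * b) ≤ 1 := by linarith
  have hb2 : b ≤ 1 := by
    have := mul_le_mul_of_nonneg_right hν5 hb.le
    linarith
  have hg0 : 0 ≤ g := by rw [hg]; positivity
  have hgb : g ≤ b ^ 2 := by
    rw [hg]; exact mul_le_of_le_one_left (by positivity) (by linarith)
  obtain ⟨w, hw⟩ : ∃ w, w = g * s := ⟨_, rfl⟩
  have hw0 : 0 ≤ w := by rw [hw]; positivity
  have hwy : w ≤ b * y := by
    rw [hw, hy]; linarith [mul_le_mul_of_nonneg_right hgb hs]
  have hw2 : w ^ 2 ≤ b * y ^ 2 := by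
    have h1 : w ^ 2 ≤ (b * y) ^ 2 := pow_le_pow_left₀ hw0 hwy 2
    have h2 : (b * y) ^ 2 ≤ b * y ^ 2 := by
      have : 0 ≤ b * y ^ 2 * (1 - b) := by
        apply mul_nonneg (by positivity) (by linarith)
      linarith
    linarith
  -- the determinant term
  have hc0 : 0 ≤ 4 * b - 2 * (ν - 2) * b ^ 2 := by
    have h1 : 0 ≤ b * (1 - 48 * (ν * b)) := mul_nonneg hb.le (by linarith)
    have h2 : 0 ≤ ν * b ^ 2 := by positivity
    linarith [sq_nonneg b]
  have hc4 : 4 * b - 2 * (ν - 2) * b ^ 2 ≤ 4 * b := by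
    have : 0 ≤ (ν - 2) * b ^ 2 := mul_nonneg (by linarith) (by positivity)
    linarith
  have hμ2 : μ = (2 - e) * y - N := by rw [hμ, hy]; ring
  have hμy : μ ≤ 2 * y := by linarith [mul_nonneg he0.le hy0]
  have hμsq : μ ^ 2 ≤ 4 * y ^ 2 + N ^ 2 := by
    have h1 : 0 ≤ (2 - e) * y := by apply mul_nonneg <;> linarith
    have h2 : (2 - e) * y ≤ 2 * y := by linarith [mul_nonneg he0.le hy0]
    have h3 : ((2 - e) * y) ^ 2 ≤ (2 * y) ^ 2 := pow_le_pow_left₀ h1 h2 2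
    rw [hμ2]; linarith [mul_nonneg h1 hN]
  have hA : 4 * b * (2 - e) * y * t - 4 * b * N * t - 16 * (ν - 1) * b * y ^ 2 - 4 * b * N ^ 2
      ≤ (4 * b - 2 * (ν - 2) * b ^ 2) * D := by
    have h1 := mul_le_mul_of_nonneg_left hD hc0
    have h2 : (4 * b - 2 * (ν - 2) * b ^ 2) * μ ^ 2 ≤ 4 * b * (4 * y ^ 2 + N ^ 2) :=
      mul_le_mul hc4 hμsq (by positivity) (by positivity)
    have h3 : μ * t ≤ 2 * y * (4 * s) := mul_le_mul hμy ht4 ht0 (by positivity)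
    have h4 : 2 * (ν - 2) * b ^ 2 * (μ * t) ≤ 2 * (ν - 2) * b ^ 2 * (2 * y * (4 * s)) :=
      mul_le_mul_of_nonneg_left h3 (mul_nonneg (by linarith) (by positivity))
    have h5 : 2 * (ν - 2) * b ^ 2 * (2 * y * (4 * s)) = 16 * (ν - 2) * b * y ^ 2 := by
      rw [hy]; ring
    have h6 : 4 * b * (μ * t) = 4 * b * (2 - e) * y * t - 4 * b * N * t := by rw [hμ2]; ring
    linarith [mul_nonneg hb.le (sq_nonneg y)]
  have hB : 64 * e ^ 2 * y ^ 2 ≤ (16 * g - 8 * b ^ 2) * P := by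
    have h1 : (16 * g - 8 * b ^ 2) * P = 64 * e ^ 2 * b ^ 2 * (ν * P) := by
      rw [hg]; linear_combination (-64 * e * b ^ 2 * P) * heν
    rw [h1, hy]
    have : 0 ≤ 64 * e ^ 2 * b ^ 2 := by positivity
    linarith [mul_le_mul_of_nonneg_left hP this]
  have hq' : (b * t) ^ 2 ≤ 4 * b ^ 2 * q := by
    linarith [mul_le_mul_of_nonneg_left hq (sq_nonneg b)]
  -- the deviation of `t` from its lower bound
  obtain ⟨t', ht'⟩ : ∃ t', t' = t - 4 * y + 8 * (ν - 1) * τ := ⟨_, rfl⟩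
  have ht'0 : 0 ≤ t' := by
    have : 0 ≤ (ν - 2) * b * t := mul_nonneg (mul_nonneg (by linarith) hb.le) ht0
    rw [ht', hy]; linarith
  obtain ⟨ε, hε⟩ : ∃ ε, ε = 8 * (ν - 2) * b * κ + 4 * b * N := ⟨_, rfl⟩
  have hε0 : 0 ≤ ε := by
    rw [hε]
    have : 0 ≤ (ν - 2) * b * κ := mul_nonneg (mul_nonneg (by linarith) hb.le) hκ.le
    linarith [mul_nonneg hb.le hN]
  have hε1 : ε ≤ e * κ := by
    have h1 : 8 * (ν * b) * κ ≤ e / 6 * κ := by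
      apply mul_le_mul_of_nonneg_right _ hκ.le
      linarith
    have h2 : 4 * b * N ≤ e / 10 * κ := by
      have h3 : e * (1000 * ν * b * N) ≤ e * κ := mul_le_mul_of_nonneg_left hN1 he0.le
      have h4 : e * (1000 * ν * b * N) = 250 * (b * N) := by
        linear_combination (1000 * b * N) * heν
      linarith [mul_nonneg hb.le hN, mul_nonneg he0.le hκ.le]
    have h5 : 0 ≤ b * κ := by positivity
    rw [hε]; linarith [mul_nonneg he0.le hκ.le]
  have hεt : ε * t ≤ κ * t' + 4 * (e * κ * y) + 2 * κ ^ 2 := by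
    have h1 : t ≤ t' + 4 * y + 8 * ν * κ := by
      have : 0 ≤ (ν - 1) * w := mul_nonneg (by linarith) hw0
      rw [ht', hτ, ← hw]; linarith
    have h2 : ε * t ≤ ε * (t' + 4 * y + 8 * ν * κ) := mul_le_mul_of_nonneg_left h1 hε0
    have h3 : ε * (t' + 4 * y + 8 * ν * κ) ≤ e * κ * (t' + 4 * y + 8 * ν * κ) :=
      mul_le_mul_of_nonneg_right hε1 (by positivity)
    have h4 : e * κ * (8 * ν * κ) = 2 * κ ^ 2 := by linear_combination (8 * κ ^ 2) * heν
    have h5 : e * κ * t' ≤ κ * t' := by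
      rw [mul_assoc]; exact mul_le_of_le_one_left (by positivity) (by linarith)
    linarith
  have hfin : 0 ≤ (16 * g - 8 * b ^ 2) * P + 4 * b ^ 2 * q
      + (4 * b * (2 - e) * y * t - 16 * (ν - 1) * b * y ^ 2 - 4 * b * N ^ 2)
      - 4 * b * y * t - 8 * w * t + 8 * κ * t' + 32 * (ν - 1) * κ ^ 2 - 32 * (ν - 1) * w ^ 2
      - ε * t := by
    have h1 : 8 * w * t = (4 + 8 * e) * b * y * t := by rw [hw, hg, hy]; ring
    have h2 : 0 ≤ (b * t - 6 * e * y) ^ 2 := sq_nonneg _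
    have h3 : (48 * ν * b) * y ^ 2 ≤ e ^ 2 * y ^ 2 :=
      mul_le_mul_of_nonneg_right hbe (by positivity)
    have h4 : 32 * (ν - 1) * w ^ 2 ≤ 32 * ν * (b * y ^ 2) := by
      have : (ν - 1) * w ^ 2 ≤ ν * (b * y ^ 2) :=
        mul_le_mul (by linarith) hw2 (by positivity) (by linarith)
      linarith
    have h5 : 0 ≤ κ * t' := by positivity
    have h6 : 4 * (e * κ * y) ≤ 4 * e ^ 2 * y ^ 2 + κ ^ 2 := by
      linarith [sq_nonneg (2 * e * y - κ)]
    have h7 : 4 * κ ^ 2 ≤ (ν - 1) * κ ^ 2 := by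
      exact mul_le_mul_of_nonneg_right (by linarith) (by positivity)
    have h8 : 0 ≤ b * y ^ 2 := by positivity
    have h9 : 0 ≤ e ^ 2 * y ^ 2 := by positivity
    have h10 : 0 ≤ κ ^ 2 := sq_nonneg κ
    linear_combination hB + hq' + h2 + h1 + h3 + h4 + 7 * h5 + h6 + 32 * h7 + 16 * h8 + 23 * h9
      + hεt + 1 / 2 * hN2 + (128 - 7 / 2) * h10
  have hκ8 : 8 * κ * t' = 8 * κ * t - 32 * κ * y + 64 * (ν - 1) * w * κ - 64 * (ν - 1) * κ ^ 2 := by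
    rw [ht', hτ, ← hw]; ring
  have hrest : (8 * ν - 16) * b * τ * t + 32 * b * τ * s
      ≥ -(8 * (ν - 2) * b * κ * t) - 32 * κ * y := by
    have h1 : 0 ≤ (ν - 2) * b * w * t :=
      mul_nonneg (mul_nonneg (mul_nonneg (by linarith) hb.le) hw0) ht0
    have h2 : 0 ≤ y * w := mul_nonneg hy0 hw0
    have h3 : (8 * ν - 16) * b * τ * t + 32 * b * τ * s
        = 8 * ((ν - 2) * b * w * t) + 32 * (y * w) - 8 * (ν - 2) * b * κ * t - 32 * κ * y := by
      rw [hτ, ← hw, hy]; ring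
    linarith
  have hτ2 : 32 * (ν - 1) * τ ^ 2
      = 32 * (ν - 1) * w ^ 2 - 64 * (ν - 1) * w * κ + 32 * (ν - 1) * κ ^ 2 := by
    rw [hτ, ← hw]; ring
  have hτt : 8 * τ * t = 8 * w * t - 8 * κ * t := by rw [hτ, ← hw]; ring
  have hst : 4 * b ^ 2 * s * t = 4 * b * y * t := by rw [hy]; ring
  have hεt' : ε * t = 8 * (ν - 2) * b * κ * t + 4 * b * N * t := by rw [hε]; ring
  linarith

end

section

theorem arrayEval_mul (M D : Fin n → Fin n → ℝ) (x y z w : Fin n → ℝ) :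
    arrayEval (fun i j k l => M i k * D j l) x y z w
      = (∑ i, ∑ k, M i k * x i * z k) * ∑ j, ∑ l, D j l * y j * w l := by
  simp only [Finset.sum_mul]
  simp only [arrayEval, Finset.mul_sum]
  refine Finset.sum_congr rfl fun i _ => ?_
  rw [Finset.sum_comm]
  refine Finset.sum_congr rfl fun k _ => Finset.sum_congr rfl fun j _ =>
    Finset.sum_congr rfl fun l _ => ?_
  ring

theorem eval_knId (A : Matrix (Fin n) (Fin n) ℝ) (hA : A.IsSymm) (x y z w : Fin n → ℝ) :
    (knId A hA).eval x y z w
      = (∑ i, ∑ k, A i k * x i * z k) * (y ⬝ᵥ w) - (∑ i, ∑ k, A i k * x i * w k) * (y ⬝ᵥ z)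
        - (∑ i, ∑ k, A i k * y i * z k) * (x ⬝ᵥ w)
        + (∑ i, ∑ k, A i k * y i * w k) * (x ⬝ᵥ z) := by
  have hδ : ∀ u v : Fin n → ℝ, u ⬝ᵥ v
      = ∑ j, ∑ l, (fun j l : Fin n => if j = l then (1 : ℝ) else 0) j l * u j * v l := by
    intro u v
    simp [dotProduct]
  have e1 := arrayEval_mul (fun i k => A i k) (fun j l => if j = l then 1 else 0) x y z w
  have e2 := arrayEval_mul (fun i k => A i k) (fun j l => if j = l then 1 else 0) x y w z
  have e3 := arrayEval_mul (fun i k => A i k) (fun j l => if j = l then 1 else 0) y x z w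
  have e4 := arrayEval_mul (fun i k => A i k) (fun j l => if j = l then 1 else 0) y x w z
  rw [arrayEval_swap_right] at e2
  rw [arrayEval_swap_left] at e3
  rw [arrayEval_swap_right, arrayEval_swap_left] at e4
  rw [hδ y w, hδ y z, hδ x w, hδ x z, ← e1, ← e2, ← e3, ← e4]
  have h : (knId A hA).comp = fun i j k l => (A i k * (if j = l then 1 else 0)
      + (-1) * (A i l * (if j = k then 1 else 0))) + ((-1) * (A j k * (if i = l then 1 else 0))
      + A j l * (if i = k then 1 else 0)) := by
    funext i j k l
    rw [comp_knId]; ring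
  rw [CurvTensor.eval, h, arrayEval_add, arrayEval_add, arrayEval_add, arrayEval_smul,
    arrayEval_smul]
  ring

theorem eval_sub (R S : CurvTensor n) (x y z w : Fin n → ℝ) :
    (R - S).eval x y z w = R.eval x y z w - S.eval x y z w := by
  simp only [CurvTensor.eval, arrayEval, comp_sub, mul_sub, Finset.sum_sub_distrib]

theorem rotate_corrected {A : Matrix (Fin n) (Fin n) ℝ}
    (hA : A ∈ Matrix.orthogonalGroup (Fin n) ℝ) (b τ : ℝ) (R : CurvTensor n) :
    rotate A (corrected b τ R) = corrected b τ (rotate A R) := by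
  have hric : ∀ x z : Fin n → ℝ,
      ∑ i, ∑ k, (b • ricMat R - τ • (1 : Matrix (Fin n) (Fin n) ℝ)) i k * x i * z k
        = b * ricForm R x z - τ * (x ⬝ᵥ z) := by
    intro x z
    have h1 : x ⬝ᵥ z = ∑ i, ∑ k, (if i = k then 1 else 0) * x i * z k := by simp [dotProduct]
    rw [h1, ricForm]
    simp only [Finset.mul_sum, ← Finset.sum_sub_distrib]
    refine Finset.sum_congr rfl fun i _ => Finset.sum_congr rfl fun k _ => ?_
    rw [shift_apply]
    ring
  refine CurvTensor.ext_comp fun i j k l => ?_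
  rw [comp_rotate, corrected, eval_sub, corrected, comp_sub, comp_rotate, eval_knId, comp_knId]
  rw [hric, hric, hric, hric]
  simp only [orthogonal_row hA, shift_apply, ricci_rotate hA]

/-- The pinching conditions with respect to the standard basis; `b` measures the strength of the
isotropic curvature pinching, `κ` and `N` are fixed constants. -/
structure IsPinched (b κ N : ℝ) (R : CurvTensor n) : Prop where
  iso : ∀ i j k l, Function.Injective ![i, j, k, l] →
    8 * κ ≤ isoPinch b ((1 / 2 + 1 / (4 * n)) * b ^ 2) R i j k l
  ric_sec : ∀ i j, i ≠ j → -N ≤ ricPinch (2 * (n - 2) * b) ((2 - 1 / (8 * n)) * b) R i j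
  ric : ∀ i j, i ≠ j → -N ≤ ricPinch 0 ((2 - 1 / (4 * n)) * b) R i j

/-- The set of curvature tensors satisfying the pinching conditions in every orthonormal basis. -/
def pinchedSet (n : ℕ) (b κ N : ℝ) : Set (CurvTensor n) :=
  {R | ∀ A ∈ Matrix.orthogonalGroup (Fin n) ℝ, IsPinched b κ N (rotate A R)}

theorem rotate_one (R : CurvTensor n) : rotate 1 R = R := by
  refine CurvTensor.ext_comp fun i j k l => ?_
  have : ∀ i, (1 : Matrix (Fin n) (Fin n) ℝ) i = stdVec i := by
    intro i; funext j; simp [stdVec, Matrix.one_apply, Pi.single_apply, eq_comm]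
  rw [comp_rotate, this, this, this, this, eval_stdVec]

section Consequences

variable {b κ N : ℝ} {R : CurvTensor n}

theorem rotate_mem_pinchedSet (hR : R ∈ pinchedSet n b κ N) {A : Matrix (Fin n) (Fin n) ℝ}
    (hA : A ∈ Matrix.orthogonalGroup (Fin n) ℝ) : rotate A R ∈ pinchedSet n b κ N := by
  intro B hB
  rw [rotate_rotate]
  exact hR _ (mul_mem hB hA)

theorem isPinched_of_mem (hR : R ∈ pinchedSet n b κ N) : IsPinched b κ N R := by
  have := hR 1 (one_mem _)
  rwa [rotate_one] at this

/-- The isotropic curvature condition says that `R - (b Ric - (g scal - κ) id) ∧ id` lies in `PIC`. -/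
theorem corrected_mem_PIC (hn : 5 ≤ n) (hR : R ∈ pinchedSet n b κ N) :
    corrected b ((1 / 2 + 1 / (4 * n)) * b ^ 2 * scal R - κ) R ∈ PIC n := by
  have hf : Function.Injective (Fin.castLE (show 4 ≤ n by omega)) := Fin.castLE_injective _
  rw [mem_PIC_iff_rotate hf]
  intro A hA
  have hinj : Function.Injective ![Fin.castLE (show 4 ≤ n by omega) 0,
      Fin.castLE (show 4 ≤ n by omega) 1, Fin.castLE (show 4 ≤ n by omega) 2,
      Fin.castLE (show 4 ≤ n by omega) 3] := by
    apply injective_four <;> exact fun h => absurd (hf h) (by decide)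
  have h := (hR A hA).iso _ _ _ _ hinj
  rw [rotate_corrected hA, isoComp_corrected hinj]
  unfold isoPinch at h
  rw [scal_rotate hA] at h
  linarith

/-- The trace of the Ricci tensor over a four-plane is bounded below by its value for the
corrected tensor. -/
theorem traceFour_ge (hn : 5 ≤ n) (hR : R ∈ pinchedSet n b κ N) {i j k l : Fin n}
    (h : Function.Injective ![i, j, k, l]) :
    4 * b * scal R - 8 * (n - 1) * ((1 / 2 + 1 / (4 * n)) * b ^ 2 * scal R - κ)
      ≤ (1 - (n - 2) * b) * traceFour R i j k l := by
  have h1 := ricci_four_nonneg hn (corrected_mem_PIC hn hR) h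
  simp only [ricci_corrected, if_true] at h1
  unfold traceFour
  linarith

/-- Pinched tensors have scalar curvature at least `κ`, because the modified tensor in `PIC` has
nonnegative scalar curvature. -/
theorem scal_ge (hp : SmallParams n b κ N) (hR : R ∈ pinchedSet n b κ N) : κ ≤ scal R := by
  have h := scal_nonneg hp.dim (corrected_mem_PIC hp.dim hR)
  rw [scal_corrected] at h
  have h1 := hp.pow_mul_le (m := 1) (by norm_num)
  have h2 := hp.pow_mul_le (m := 2) (by norm_num)
  have hn := hp.five_le
  have hb := hp.b_pos
  have hκ := hp.κ_pos
  have hb1 := hp.b_le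
  obtain ⟨-, hg⟩ := hp.coef_le
  obtain ⟨g, hgd⟩ : ∃ g, g = (1 / 2 + 1 / (4 * (n : ℝ))) * b ^ 2 := ⟨_, rfl⟩
  rw [← hgd] at h hg
  obtain ⟨c, hc⟩ : ∃ c, c = 1 - (2 * (n : ℝ) - 2) * b + 2 * n * (n - 1) * g := ⟨_, rfl⟩
  have h3 : 2 * n * (n - 1) * κ ≤ c * scal R := by rw [hc]; linarith
  have hg0 : 0 ≤ 2 * (n : ℝ) * (n - 1) * g := by
    rw [hgd]; have : (0 : ℝ) ≤ n - 1 := by linarith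
    positivity
  have hc0 : 0 < c := by rw [hc]; linarith
  have hc2 : c ≤ 2 := by
    have h4 : 2 * (n : ℝ) * (n - 1) * g ≤ 2 * n * n * b ^ 2 :=
      mul_le_mul (mul_le_mul_of_nonneg_left (by linarith) (by linarith)) hg (by rw [hgd]; positivity)
        (by positivity)
    have h5 : 2 * (n : ℝ) * n * b ^ 2 = 2 * (n ^ 2 * b) * b := by ring
    have h6 : 2 * ((n : ℝ) ^ 2 * b) * b ≤ 1 * 1 :=
      mul_le_mul (by linarith) (by linarith) hb.le (by norm_num)
    have h7 : 0 ≤ (2 * (n : ℝ) - 2) * b := mul_nonneg (by linarith) hb.le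
    rw [hc]; linarith
  have h8 : 40 * κ ≤ 2 * n * (n - 1) * κ := by
    have : (20 : ℝ) ≤ n * (n - 1) := by nlinarith
    have := mul_le_mul_of_nonneg_right this hκ.le
    linarith
  have h9 : 0 < scal R := by
    by_contra hle
    have := mul_nonneg hc0.le (show 0 ≤ -scal R by linarith)
    linarith
  have h10 := mul_le_mul_of_nonneg_right hc2 h9.le
  linarith

/-- Pinched tensors have isotropic curvature bounded below by a multiple of the scalar
curvature. -/
theorem isoComp_ge (hp : SmallParams n b κ N) (hR : R ∈ pinchedSet n b κ N) {i j k l : Fin n}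
    (h : Function.Injective ![i, j, k, l]) : 2 * b ^ 2 * scal R ≤ isoComp R i j k l := by
  have h1 := traceFour_ge hp.dim hR h
  have h2 := (isPinched_of_mem hR).iso i j k l h
  unfold isoPinch at h2
  have hs : 0 ≤ scal R := hp.κ_pos.le.trans (scal_ge hp hR)
  have hn := hp.five_le
  have hb := hp.b_pos
  have hκ := hp.κ_pos
  have h3 := hp.pow_mul_le (m := 1) (by norm_num)
  obtain ⟨he, hg⟩ := hp.coef_le
  obtain ⟨g, hgd⟩ : ∃ g, g = (1 / 2 + 1 / (4 * (n : ℝ))) * b ^ 2 := ⟨_, rfl⟩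
  rw [← hgd] at h1 h2 hg
  set s := scal R
  set t := traceFour R i j k l
  have hg' : g * s ≤ 11 / 20 * b ^ 2 * s := by
    apply mul_le_mul_of_nonneg_right _ hs
    rw [hgd]; exact mul_le_mul_of_nonneg_right (by linarith) (sq_nonneg b)
  have hbs : 0 ≤ b ^ 2 * s := by positivity
  have h4 : 8 * ((n : ℝ) - 1) * (g * s) ≤ b * s / 10 := by
    have h5 : 8 * ((n : ℝ) - 1) * (g * s) ≤ 8 * n * (b ^ 2 * s) :=
      mul_le_mul (by linarith) (by linarith) (mul_nonneg (by rw [hgd]; positivity) hs)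
        (by linarith)
    have h6 : 8 * (n : ℝ) * (b ^ 2 * s) = 8 * (n * b) * (b * s) := by ring
    have h7 : 8 * ((n : ℝ) * b) * (b * s) ≤ 1 / 10 * (b * s) :=
      mul_le_mul_of_nonneg_right (by linarith) (by positivity)
    linarith
  have h8 : 39 / 10 * (b * s) ≤ (1 - (n - 2) * b) * t := by
    have : 0 ≤ ((n : ℝ) - 1) * κ := mul_nonneg (by linarith) hκ.le
    linarith
  have h9 : 0 ≤ t := by
    have h10 : 0 < 1 - ((n : ℝ) - 2) * b := by linarith
    have h11 : 0 ≤ (1 - ((n : ℝ) - 2) * b) * t := le_trans (by positivity) h8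
    exact nonneg_of_mul_nonneg_right h11 h10
  have h10 : 39 / 10 * (b * s) ≤ t := by
    have : 0 ≤ ((n : ℝ) - 2) * b * t := mul_nonneg (mul_nonneg (by linarith) hb.le) h9
    linarith
  have h11 := mul_le_mul_of_nonneg_left h10 hb.le
  linarith

theorem mem_PIC_of_mem (hp : SmallParams n b κ N) (hR : R ∈ pinchedSet n b κ N) : R ∈ PIC n := by
  have hf : Function.Injective (Fin.castLE (show 4 ≤ n by linarith [hp.dim])) :=
    Fin.castLE_injective _
  rw [mem_PIC_iff_rotate hf]
  intro A hA
  have hRA := rotate_mem_pinchedSet hR hA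
  refine le_trans ?_ (isoComp_ge hp hRA ?_)
  · have := hp.κ_pos.le.trans (scal_ge hp hRA)
    positivity
  · apply injective_four <;> exact fun h => absurd (hf h) (by decide)

end Consequences

end

section

/-- Nonnegativity of the quadratic form `a p² + c (q² + r²) + 2 α p q + 2 β p r`. -/
theorem sq_add_sq_le_mul_of_quadratic {a c α β : ℝ}
    (h : ∀ p q r : ℝ, 0 ≤ p ^ 2 * a + (q ^ 2 + r ^ 2) * c + 2 * p * q * α + 2 * p * r * β) :
    α ^ 2 + β ^ 2 ≤ a * c := by
  have hc : 0 ≤ c := by simpa using h 0 1 0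
  rcases hc.eq_or_lt with h0 | hpos
  · by_contra hlt
    push Not at hlt
    rw [← h0, mul_zero] at hlt
    have h1 := h 1 (-((|a| + 1) / (α ^ 2 + β ^ 2)) * α) (-((|a| + 1) / (α ^ 2 + β ^ 2)) * β)
    rw [← h0] at h1
    have h2 : (|a| + 1) / (α ^ 2 + β ^ 2) * (α ^ 2 + β ^ 2) = |a| + 1 := by field_simp
    have h3 := le_abs_self a
    have h4 := abs_nonneg a
    linarith
  · have h1 := h c (-α) (-β)
    have h2 : 0 ≤ c * (a * c - (α ^ 2 + β ^ 2)) := by linarith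
    have := nonneg_of_mul_nonneg_right h2 hpos
    linarith

variable {R : CurvTensor n} {i j : Fin n}

/-- The pinching inequality for a pair of orthogonal vectors of arbitrary length. -/
theorem ricPinch_vectors {δ ω N : ℝ} (hij : i ≠ j)
    (hR : ∀ A ∈ Matrix.orthogonalGroup (Fin n) ℝ, -N ≤ ricPinch δ ω (rotate A R) i j)
    {x y : Fin n → ℝ} (hxy : x ⬝ᵥ y = 0) {c d : ℝ} (hx : x ⬝ᵥ x = c) (hy : y ⬝ᵥ y = d)
    (hc : 0 < c) (hd : 0 < d) :
    (ω * scal R - N) * (c * d)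
      ≤ (1 + δ) * (ricForm R x x * d + ricForm R y y * c) - 2 * δ * R.eval x y x y := by
  have hs : ∀ a : ℝ, 0 < a → (√a)⁻¹ * (√a)⁻¹ = a⁻¹ := fun a ha => by
    rw [← mul_inv, Real.mul_self_sqrt ha.le]
  have hv : OrthoTuple ![(√c)⁻¹ • x, (√d)⁻¹ • y] := by
    have hyx : y ⬝ᵥ x = 0 := by rw [dotProduct_comm, hxy]
    have e1 : (√c)⁻¹ * ((√c)⁻¹ * c) = 1 := by rw [← mul_assoc, hs c hc, inv_mul_cancel₀ hc.ne']
    have e2 : (√d)⁻¹ * ((√d)⁻¹ * d) = 1 := by rw [← mul_assoc, hs d hd, inv_mul_cancel₀ hd.ne']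
    intro a b
    fin_cases a <;> fin_cases b <;> simp [hx, hy, hxy, hyx, e1, e2]
  have hf : Function.Injective ![i, j] := by
    intro a b hab
    fin_cases a <;> fin_cases b <;>
      first | rfl | exact absurd hab hij | exact absurd hab.symm hij
  obtain ⟨A, hA, hAv⟩ := hv.exists_orthogonal hf
  have hAi : A i = (√c)⁻¹ • x := hAv 0
  have hAj : A j = (√d)⁻¹ • y := hAv 1
  have h := hR A hA
  unfold ricPinch at h
  rw [ricci_rotate hA, ricci_rotate hA, scal_rotate hA, comp_rotate, hAi, hAj] at h
  simp only [ricForm_smul_left, ricForm_smul_right, R.eval_smul₁, R.eval_smul₂, R.eval_smul₃,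
    R.eval_smul₄] at h
  have hcd : 0 < c * d := mul_pos hc hd
  have h1 : 0 ≤ ((1 + δ) * (c⁻¹ * ricForm R x x + d⁻¹ * ricForm R y y)
      - 2 * δ * (c⁻¹ * d⁻¹ * R.eval x y x y) - ω * scal R + N) * (c * d) := by
    refine mul_nonneg ?_ hcd.le
    rw [← hs c hc, ← hs d hd]
    linarith
  have h2 : ((1 + δ) * (c⁻¹ * ricForm R x x + d⁻¹ * ricForm R y y)
      - 2 * δ * (c⁻¹ * d⁻¹ * R.eval x y x y) - ω * scal R + N) * (c * d)
      = (1 + δ) * (ricForm R x x * d + ricForm R y y * c) - 2 * δ * R.eval x y x y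
        - (ω * scal R - N) * (c * d) := by
    field_simp
    ring
  linarith

variable {b κ N : ℝ} {k l : Fin n}

/-- The condition on Ricci traces of two-planes, applied to all two-planes of a four-dimensional
space which are graphs over a pair of complementary ones. -/
theorem ricci_det_ge (hR : R ∈ pinchedSet n b κ N) (h : Function.Injective ![i, j, k, l]) {μ : ℝ}
    (hμ : μ = (2 - 1 / (4 * n)) * b * scal R - N) :
    μ * traceFour R i j k l - μ ^ 2 ≤ (ricci R i i + ricci R j j) * (ricci R k k + ricci R l l)
          - (ricci R i k + ricci R j l) ^ 2 - (ricci R j k - ricci R i l) ^ 2 := by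
  have hij : i ≠ j := fun e => absurd (@h 0 1 e) (by decide)
  have hik : i ≠ k := fun e => absurd (@h 0 2 e) (by decide)
  have hil : i ≠ l := fun e => absurd (@h 0 3 e) (by decide)
  have hjk : j ≠ k := fun e => absurd (@h 1 2 e) (by decide)
  have hjl : j ≠ l := fun e => absurd (@h 1 3 e) (by decide)
  have hkl : k ≠ l := fun e => absurd (@h 2 3 e) (by decide)
  have key := sq_add_sq_le_mul_of_quadratic (a := ricci R i i + ricci R j j - μ)
    (c := ricci R k k + ricci R l l - μ) (α := ricci R i k + ricci R j l)
    (β := ricci R j k - ricci R i l) (by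
      intro p q r
      by_cases h0 : p ^ 2 + q ^ 2 + r ^ 2 = 0
      · have hp : p = 0 := by nlinarith [sq_nonneg p, sq_nonneg q, sq_nonneg r]
        have hq : q = 0 := by nlinarith [sq_nonneg p, sq_nonneg q, sq_nonneg r]
        have hr : r = 0 := by nlinarith [sq_nonneg p, sq_nonneg q, sq_nonneg r]
        simp [hp, hq, hr]
      have hc : 0 < p ^ 2 + q ^ 2 + r ^ 2 := lt_of_le_of_ne (by positivity) (Ne.symm h0)
      -- these planes join the `ij`-plane (`q = r = 0`) to the `kl`-plane (`p = 0`)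
      have hv := ricPinch_vectors hij (fun A hA => (hR A hA).ric i j hij)
        (x := p • stdVec i + q • stdVec k + (-r) • stdVec l)
        (y := p • stdVec j + r • stdVec k + q • stdVec l)
        (c := p ^ 2 + q ^ 2 + r ^ 2) (d := p ^ 2 + q ^ 2 + r ^ 2)
        (by
          simp only [add_dotProduct, dotProduct_add, smul_dotProduct, dotProduct_smul, dot_stdVec,
            smul_eq_mul, hij, hil, hik, hjk.symm, hkl, hjl.symm, hkl.symm, if_true, if_false]
          ring)
        (by
          simp only [add_dotProduct, dotProduct_add, smul_dotProduct, dotProduct_smul, dot_stdVec,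
            smul_eq_mul, hil, hik, hik.symm, hil.symm, hkl, hkl.symm, if_true, if_false]
          ring)
        (by
          simp only [add_dotProduct, dotProduct_add, smul_dotProduct, dotProduct_smul, dot_stdVec,
            smul_eq_mul, hjl, hjk, hjk.symm, hjl.symm, hkl, hkl.symm, if_true, if_false]
          ring) hc hc
      simp only [ricForm_smul_left, ricForm_smul_right, ricForm_add_left, ricForm_add_right,
        ricForm_stdVec] at hv
      rw [← hμ, ricci_symm R k i, ricci_symm R l i, ricci_symm R k j, ricci_symm R l j,
        ricci_symm R l k] at hv
      have h2 : 0 ≤ (p ^ 2 + q ^ 2 + r ^ 2) * (p ^ 2 * (ricci R i i + ricci R j j - μ)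
          + (q ^ 2 + r ^ 2) * (ricci R k k + ricci R l l - μ)
          + 2 * p * q * (ricci R i k + ricci R j l) + 2 * p * r * (ricci R j k - ricci R i l)) := by
        linarith
      exact nonneg_of_mul_nonneg_right h2 hc)
  unfold traceFour
  linarith

/-- A pinched tensor on the boundary of the isotropic curvature condition moves inward. -/
theorem isoPinch_Q_nonneg (hp : SmallParams n b κ N) (hR : R ∈ pinchedSet n b κ N)
    (h : Function.Injective ![i, j, k, l])
    (h0 : isoPinch b ((1 / 2 + 1 / (4 * n)) * b ^ 2) R i j k l = 8 * κ) :
    0 ≤ isoPinch b ((1 / 2 + 1 / (4 * n)) * b ^ 2) (Q R) i j k l := by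
  have hU := corrected_mem_PIC hp.dim hR
  rw [isoPinch_Q h b _ ((1 / 2 + 1 / (4 * n)) * b ^ 2 * scal R - κ) R]
  refine add_nonneg (isoComp_Q_nonneg hU h ?_) ?_
  · rw [isoComp_corrected h]
    unfold isoPinch at h0
    linarith
  have hPIC := mem_PIC_of_mem hp hR
  have hle := ricci_le_scal hp.dim hPIC
  have hs : 0 ≤ scal R := hp.κ_pos.le.trans (scal_ge hp hR)
  refine isoPinch_boundary_real hp hs (ricci_four_nonneg hp.dim hPIC h) ?_ ?_ ?_ rfl
    (ricci_det_ge hR h rfl) rfl rfl (traceFour_ge hp.dim hR h)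
  · unfold traceFour
    linarith [hle i, hle j, hle k, hle l]
  · have h1 := Finset.sum_mul_sq_le_sq_mul_sq Finset.univ (fun p => ricci R p p) (fun _ => 1)
    simp only [mul_one, one_pow, Finset.sum_const, Finset.card_univ, Fintype.card_fin,
      nsmul_eq_mul] at h1
    have h2 : ∑ p, ricci R p p ^ 2 ≤ ∑ p, ∑ q, ricci R p q ^ 2 :=
      Finset.sum_le_sum fun p _ =>
        Finset.single_le_sum (f := fun q => ricci R p q ^ 2) (fun q _ => sq_nonneg _)
          (Finset.mem_univ p)
    have h3 : (0 : ℝ) ≤ n := by positivity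
    have := mul_le_mul_of_nonneg_left h2 h3
    unfold scal
    linarith
  · have h2 : ∀ p, ricci R p p ^ 2 ≤ ∑ q, ricci R p q ^ 2 := fun p =>
      Finset.single_le_sum (f := fun q => ricci R p q ^ 2) (fun q _ => sq_nonneg _)
        (Finset.mem_univ p)
    have := h2 i
    have := h2 j
    have := h2 k
    have := h2 l
    change (ricci R i i + ricci R j j + ricci R k k + ricci R l l) ^ 2 ≤ _
    nlinarith [sq_nonneg (ricci R i i - ricci R j j), sq_nonneg (ricci R i i - ricci R k k),
      sq_nonneg (ricci R i i - ricci R l l), sq_nonneg (ricci R j j - ricci R k k),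
      sq_nonneg (ricci R j j - ricci R l l), sq_nonneg (ricci R k k - ricci R l l)]

end

section

/-! ### Algebra of the Ricci pinching functional -/

/-- Weighted sums of sectional curvatures: if `K_{pq} ≥ (∑ u - u_p - u_q) / 2 + c` for weights `u`
with nonnegative pairwise sums, then `∑ u_p (x_p + ∑_{q ≠ p} K_{pq})` is bounded below. -/
theorem weighted_sum_ge {ι : Type*} [DecidableEq ι] (I : Finset ι) (hI : 3 ≤ I.card)
    {u x ρ : ι → ℝ} {K : ι → ι → ℝ} {c : ℝ} (hc : 0 ≤ c) (hKs : ∀ p q, K p q = K q p)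
    (hu : ∀ p ∈ I, ∀ q ∈ I, p ≠ q → 0 ≤ u p + u q)
    (hK : ∀ p ∈ I, ∀ q ∈ I, p ≠ q → ((∑ r ∈ I, u r) - u p - u q) / 2 + c ≤ K p q)
    (hρ : ∀ p ∈ I, ρ p = x p + ∑ q ∈ I.erase p, K p q) :
    ∑ p ∈ I, u p * x p + ((∑ p ∈ I, u p) ^ 2 - ∑ p ∈ I, u p ^ 2) / 2 + 2 * c * ∑ p ∈ I, u p
      ≤ ∑ p ∈ I, u p * ρ p := by
  set U := ∑ p ∈ I, u p with hU
  have hU0 : 0 ≤ U := sum_nonneg_of_pairs I (by omega) hu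
  have hoff : ∀ f : ι → ι → ℝ, ∑ p ∈ I, ∑ q ∈ I.erase p, f p q
      = ∑ p ∈ I, ∑ q ∈ I, f p q - ∑ p ∈ I, f p p := by
    intro f
    rw [← Finset.sum_sub_distrib]
    exact Finset.sum_congr rfl fun p hp => Finset.sum_erase_eq_sub hp
  have h1 : ∑ p ∈ I, u p * ρ p
      = ∑ p ∈ I, u p * x p + ∑ p ∈ I, ∑ q ∈ I.erase p, u p * K p q := by
    rw [← Finset.sum_add_distrib]
    refine Finset.sum_congr rfl fun p hp => ?_
    rw [hρ p hp, mul_add, Finset.mul_sum]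
  have h2 : 2 * ∑ p ∈ I, ∑ q ∈ I.erase p, u p * K p q
      = ∑ p ∈ I, ∑ q ∈ I.erase p, (u p + u q) * K p q := by
    have h3 : ∑ p ∈ I, ∑ q ∈ I, u q * K p q = ∑ p ∈ I, ∑ q ∈ I, u p * K p q := by
      rw [Finset.sum_comm]
      exact Finset.sum_congr rfl fun p _ => Finset.sum_congr rfl fun q _ => by rw [hKs]
    rw [hoff fun p q => u p * K p q, hoff fun p q => (u p + u q) * K p q]
    simp only [add_mul, Finset.sum_add_distrib, h3]
    ring
  have hform : ∑ p ∈ I, ∑ q ∈ I.erase p, (u p + u q) * (U - u p - u q)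
      = 2 * ((I.card : ℝ) - 2) * (U ^ 2 - ∑ p ∈ I, u p ^ 2) := by
    have e : ∀ p q, (u p + u q) * (U - u p - u q)
        = U * u p + U * u q - u p ^ 2 - u q ^ 2 - 2 * (u p * u q) := fun p q => by ring
    rw [hoff fun p q => (u p + u q) * (U - u p - u q)]
    simp only [e, Finset.sum_add_distrib, Finset.sum_sub_distrib, ← Finset.mul_sum,
      Finset.sum_const, nsmul_eq_mul, ← Finset.sum_mul, ← hU]
    have e2 : ∑ p ∈ I, u p * u p = ∑ p ∈ I, u p ^ 2 :=
      Finset.sum_congr rfl fun p _ => (sq (u p)).symm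
    rw [e2]
    ring
  have hge : ∑ p ∈ I, ∑ q ∈ I.erase p, (u p + u q) * ((U - u p - u q) / 2 + c)
      ≤ ∑ p ∈ I, ∑ q ∈ I.erase p, (u p + u q) * K p q := by
    refine Finset.sum_le_sum fun p hp => Finset.sum_le_sum fun q hq => ?_
    have hq' := Finset.mem_of_mem_erase hq
    have hne : p ≠ q := (Finset.ne_of_mem_erase hq).symm
    exact mul_le_mul_of_nonneg_left (hK p hp q hq' hne) (hu p hp q hq' hne)
  have hlin : ∑ p ∈ I, ∑ q ∈ I.erase p, (u p + u q) = 2 * ((I.card : ℝ) - 1) * U := by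
    rw [hoff fun p q => u p + u q]
    simp only [Finset.sum_add_distrib, Finset.sum_const, nsmul_eq_mul, ← Finset.mul_sum, ← hU]
    ring
  have hhalf : ∑ p ∈ I, ∑ q ∈ I.erase p, (u p + u q) * ((U - u p - u q) / 2 + c)
      = ((I.card : ℝ) - 2) * (U ^ 2 - ∑ p ∈ I, u p ^ 2) + 2 * c * (((I.card : ℝ) - 1) * U) := by
    have : ∀ p q, (u p + u q) * ((U - u p - u q) / 2 + c)
        = 1 / 2 * ((u p + u q) * (U - u p - u q)) + c * (u p + u q) :=
      fun p q => by ring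
    have hadd : ∀ f g : ι → ι → ℝ, ∑ p ∈ I, ∑ q ∈ I.erase p, (1 / 2 * f p q + c * g p q)
        = 1 / 2 * ∑ p ∈ I, ∑ q ∈ I.erase p, f p q + c * ∑ p ∈ I, ∑ q ∈ I.erase p, g p q := by
      intro f g
      simp only [Finset.sum_add_distrib, Finset.mul_sum]
    simp only [this]
    rw [hadd (fun p q => (u p + u q) * (U - u p - u q)) fun p q => u p + u q, hform, hlin]
    ring
  have hcU : 2 * c * (2 * U) ≤ 2 * c * (((I.card : ℝ) - 1) * U) := by
    have : (3 : ℝ) ≤ I.card := by exact_mod_cast hI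
    exact mul_le_mul_of_nonneg_left (mul_le_mul_of_nonneg_right (by linarith) hU0) (by linarith)
  have hlast : U ^ 2 - ∑ p ∈ I, u p ^ 2 ≤ ((I.card : ℝ) - 2) * (U ^ 2 - ∑ p ∈ I, u p ^ 2) := by
    rcases hI.eq_or_lt with h3 | h4
    · rw [← h3]; norm_num
    · have h5 : 0 ≤ 2 * ((I.card : ℝ) - 2) * (U ^ 2 - ∑ p ∈ I, u p ^ 2) := by
        rw [← hform]
        refine Finset.sum_nonneg fun p hp => Finset.sum_nonneg fun q hq => ?_
        have hq' := Finset.mem_of_mem_erase hq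
        have hne : p ≠ q := (Finset.ne_of_mem_erase hq).symm
        refine mul_nonneg (hu p hp q hq' hne) ?_
        have h6 : U - u p - u q = ∑ r ∈ (I.erase p).erase q, u r := by
          rw [Finset.sum_erase_eq_sub hq, Finset.sum_erase_eq_sub hp]
        rw [h6]
        refine sum_nonneg_of_pairs _ ?_ fun r hr t ht hrt => hu r ?_ t ?_ hrt
        · rw [Finset.card_erase_of_mem hq, Finset.card_erase_of_mem hp]; omega
        · exact Finset.mem_of_mem_erase (Finset.mem_of_mem_erase hr)
        · exact Finset.mem_of_mem_erase (Finset.mem_of_mem_erase ht)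
      have h7 : (4 : ℝ) ≤ I.card := by exact_mod_cast h4
      have h8 : 0 ≤ U ^ 2 - ∑ p ∈ I, u p ^ 2 :=
        nonneg_of_mul_nonneg_right h5 (by linarith)
      exact le_mul_of_one_le_left h8 (by linarith)
  linarith

theorem sum_sum_eq_others {i j : Fin n} (h : i ≠ j) (f : Fin n → Fin n → ℝ) :
    ∑ p, ∑ q, f p q = (f i i + f i j + f j i + f j j)
      + ∑ q ∈ others i j, (f i q + f j q + f q i + f q j)
      + ∑ p ∈ others i j, ∑ q ∈ others i j, f p q := by
  rw [sum_eq_add_sum_others h, sum_eq_add_sum_others h, sum_eq_add_sum_others h (f j)]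
  simp only [sum_eq_add_sum_others h (f _), Finset.sum_add_distrib]
  ring

variable (R : CurvTensor n) {i j : Fin n}

/-- The evolution of a sectional curvature. -/
theorem comp_Q_sectional (h : i ≠ j) : (Q R).comp i j i j = 2 * R.comp i j i j ^ 2
      + 2 * ∑ q ∈ others i j, (R.comp i j i q ^ 2 + R.comp j i j q ^ 2)
      + ∑ p ∈ others i j, ∑ q ∈ others i j, R.comp i j p q ^ 2
      + 2 * ∑ p ∈ others i j, ∑ q ∈ others i j,
        (R.comp i p i q * R.comp j p j q - R.comp i p j q * R.comp j p i q) := by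
  change sqTerm R i j i j + sharpTerm R i j i j = _
  rw [sqTerm, sharpTerm, sum_sum_eq_others h, sum_sum_eq_others h]
  simp only [CurvTensor.comp_self_left, CurvTensor.comp_self_right, mul_zero, zero_mul, sub_zero,
    add_zero, zero_add, Finset.sum_const_zero]
  have e1 : ∑ q ∈ others i j, (R.comp i j i q * R.comp i j i q + R.comp i j j q * R.comp i j j q
      + R.comp i j q i * R.comp i j q i + R.comp i j q j * R.comp i j q j)
      = 2 * ∑ q ∈ others i j, (R.comp i j i q ^ 2 + R.comp j i j q ^ 2) := by
    rw [Finset.mul_sum]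
    refine Finset.sum_congr rfl fun q _ => ?_
    rw [R.antisymm_right i j q i, R.antisymm_right i j q j, R.antisymm_left j i j q]
    ring
  have e2 : ∀ p q, R.comp i j p q * R.comp i j p q = R.comp i j p q ^ 2 := fun p q => (sq _).symm
  rw [e1]
  simp only [e2]
  rw [R.antisymm_right i j j i]
  ring

/-- The evolution of the trace of the Ricci tensor over a two-plane. -/
theorem ricci_Q_pair (h : i ≠ j) : ricci (Q R) i i + ricci (Q R) j j
      = 2 * (R.comp i j i j * (ricci R i i + ricci R j j)
        + ∑ p ∈ others i j, ∑ q ∈ others i j, (R.comp i p i q + R.comp j p j q) * ricci R p q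
        + 2 * ∑ q ∈ others i j, (R.comp i j i q * ricci R j q + R.comp j i j q * ricci R i q)) := by
  rw [ricci_Q, ricci_Q, starForm, starForm, sum_sum_eq_others h, sum_sum_eq_others h]
  simp only [CurvTensor.comp_self_left, CurvTensor.comp_self_right, mul_zero,
    add_zero, zero_add, ricMat, Matrix.of_apply, R.comp_swap_swap j i]
  have e1 : ∀ q, ricci R j q * R.comp i j i q + ricci R q j * R.comp i q i j
      = 2 * (R.comp i j i q * ricci R j q) := fun q => by
    rw [ricci_symm R q j, R.pair_symm i q i j]; ring
  have e2 : ∀ q, ricci R i q * R.comp j i j q + ricci R q i * R.comp j q j i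
      = 2 * (R.comp j i j q * ricci R i q) := fun q => by
    rw [ricci_symm R q i, R.pair_symm j q j i]; ring
  have e3 : ∑ p ∈ others i j, ∑ q ∈ others i j, (R.comp i p i q + R.comp j p j q) * ricci R p q
      = ∑ p ∈ others i j, ∑ q ∈ others i j, ricci R p q * R.comp i p i q
        + ∑ p ∈ others i j, ∑ q ∈ others i j, ricci R p q * R.comp j p j q := by
    simp only [← Finset.sum_add_distrib]
    exact Finset.sum_congr rfl fun p _ => Finset.sum_congr rfl fun q _ => by ring
  rw [e3]
  simp only [e1, e2, Finset.sum_add_distrib, ← Finset.mul_sum]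
  ring

theorem norm_ricci_split (h : i ≠ j) : ∑ p, ∑ q, ricci R p q ^ 2
      = ricci R i i ^ 2 + ricci R j j ^ 2 + 2 * ricci R i j ^ 2
        + 2 * ∑ q ∈ others i j, (ricci R i q ^ 2 + ricci R j q ^ 2)
        + ∑ p ∈ others i j, ∑ q ∈ others i j, ricci R p q ^ 2 := by
  rw [sum_sum_eq_others h, Finset.mul_sum, ricci_symm R j i]
  congr 1
  congr 1
  · ring
  · exact Finset.sum_congr rfl fun q _ => by rw [ricci_symm R q i, ricci_symm R q j]; ring

open Matrix in
/-- A real symmetric matrix can be diagonalized on a subset of the indices by an orthogonal matrix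
fixing the other basis vectors. -/
theorem exists_orthogonal_diagonalizing (M : Matrix (Fin n) (Fin n) ℝ) (hM : M.IsSymm)
    (I : Finset (Fin n)) : ∃ A ∈ Matrix.orthogonalGroup (Fin n) ℝ,
      (∀ p, p ∉ I → A p = stdVec p) ∧
      ∀ p ∈ I, ∀ q ∈ I, p ≠ q → ∑ a, ∑ b, A p a * A q b * M a b = 0 := by
  let ι : {p // p ∈ I} → Fin n := Subtype.val
  have hM' : (M.submatrix ι ι).IsHermitian := by
    ext p q
    simp [Matrix.conjTranspose_apply, hM.apply]
  obtain ⟨V, hV⟩ : ∃ V : Matrix {p // p ∈ I} {p // p ∈ I} ℝ, V = hM'.eigenvectorUnitary := ⟨_, rfl⟩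
  have hVV : Vᵀ * V = 1 := by
    have := Unitary.coe_star_mul_self hM'.eigenvectorUnitary
    rwa [← hV, Matrix.star_eq_conjTranspose, Matrix.conjTranspose_eq_transpose_of_trivial] at this
  have hdiag : Vᵀ * M.submatrix ι ι * V = Matrix.diagonal hM'.eigenvalues := by
    have := hM'.conjStarAlgAut_star_eigenvectorUnitary
    rwa [Unitary.conjStarAlgAut_star_apply, ← hV, Matrix.star_eq_conjTranspose,
      Matrix.conjTranspose_eq_transpose_of_trivial] at this
  let A : Matrix (Fin n) (Fin n) ℝ := Matrix.of fun p a =>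
    if hp : p ∈ I then (if ha : a ∈ I then V ⟨a, ha⟩ ⟨p, hp⟩ else 0) else stdVec p a
  have hsum : ∀ f : Fin n → ℝ, (∀ a, a ∉ I → f a = 0) → ∑ a, f a = ∑ a : {p // p ∈ I}, f a := by
    intro f hf
    rw [Finset.sum_coe_sort I f]
    exact (Finset.sum_subset (Finset.subset_univ I) fun a _ ha => hf a ha).symm
  have hin : ∀ p q : {p // p ∈ I}, A p q = V q p := by
    intro p q; simp [A]
  have hzero : ∀ p ∈ I, ∀ a, a ∉ I → A p a = 0 := by
    intro p hp a ha; simp [A, hp, ha]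
  have hfix : ∀ p, p ∉ I → A p = stdVec p := by
    intro p hp; funext a; simp [A, hp]
  refine ⟨A, ?_, hfix, ?_⟩
  · rw [Matrix.mem_orthogonalGroup_iff]
    ext p q
    rw [Matrix.one_apply]
    change A p ⬝ᵥ A q = _
    by_cases hp : p ∈ I <;> by_cases hq : q ∈ I
    · change ∑ a, A p a * A q a = _
      rw [hsum _ fun a ha => by rw [hzero p hp a ha, zero_mul]]
      have := congrFun (congrFun hVV ⟨p, hp⟩) ⟨q, hq⟩
      rw [Matrix.mul_apply, Matrix.one_apply] at this
      simp only [Subtype.mk.injEq] at this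
      rw [← this]
      exact Finset.sum_congr rfl fun a _ => by
        rw [hin ⟨p, hp⟩ a, hin ⟨q, hq⟩ a, Matrix.transpose_apply]
    · rw [hfix q hq]
      have hpq : p ≠ q := fun h => hq (h ▸ hp)
      simp [stdVec, hpq, hzero p hp q hq]
    · rw [hfix p hp]
      have hpq : p ≠ q := fun h => hp (h ▸ hq)
      simp [stdVec, hpq, hzero q hq p hp]
    · rw [hfix p hp, hfix q hq, dot_stdVec]
  · intro p hp q hq hpq
    have h1 : ∀ a, ∑ b, A p a * A q b * M a b
        = ∑ b : {p // p ∈ I}, A p a * A q b * M a b := fun a =>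
      hsum _ fun b hb => by rw [hzero q hq b hb]; ring
    simp only [h1]
    rw [hsum _ fun a ha => Finset.sum_eq_zero fun b _ => by rw [hzero p hp a ha]; ring]
    have := congrFun (congrFun hdiag ⟨p, hp⟩) ⟨q, hq⟩
    rw [Matrix.diagonal_apply_ne _ (by simpa using hpq), Matrix.mul_apply] at this
    rw [← this, Finset.sum_comm]
    refine Finset.sum_congr rfl fun b _ => ?_
    rw [Matrix.mul_apply, Finset.sum_mul]
    refine Finset.sum_congr rfl fun a _ => ?_
    rw [hin ⟨p, hp⟩ a, hin ⟨q, hq⟩ b, Matrix.transpose_apply, Matrix.submatrix_apply]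
    ring

end

section

/-! ### Curvature estimates for pinched tensors -/

/-- The sum `R_{ipip} + R_{jpjp}` of two sectional curvatures. -/
def secSum (R : CurvTensor n) (i j p : Fin n) : ℝ := R.comp i p i p + R.comp j p j p

/-- The constant `2 b (Ric_{ii} + Ric_{jj}) - 8 g scal + 8 κ`. -/
noncomputable def pinchConst (b κ : ℝ) (R : CurvTensor n) (i j : Fin n) : ℝ :=
  2 * b * (ricci R i i + ricci R j j) - 8 * ((1 / 2 + 1 / (4 * n)) * b ^ 2) * scal R + 8 * κ

/-- The part of `secSum` in excess of what the isotropic curvature condition guarantees: its sums over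
two different indices are nonnegative. -/
noncomputable def excess (b κ : ℝ) (R : CurvTensor n) (i j p : Fin n) : ℝ :=
  secSum R i j p - 2 * b * ricci R p p - pinchConst b κ R i j / 2

variable {b κ N : ℝ} {R : CurvTensor n} {i j p q : Fin n}

theorem IsPinched.neg_le (h : IsPinched b κ N R) (hij : i ≠ j) :
    (2 - 1 / (4 * n)) * b * scal R - N ≤ ricci R i i + ricci R j j := by
  have := h.ric i j hij
  unfold ricPinch at this
  linarith

theorem IsPinched.abs_comp_le (h : IsPinched b κ N R) (hinj : Function.Injective ![i, j, p, q]) :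
    2 * |R.comp i j p q| ≤ excess b κ R i j p + excess b κ R i j q := by
  have hij : i ≠ j := fun e => absurd (@hinj 0 1 e) (by decide)
  have hip : i ≠ p := fun e => absurd (@hinj 0 2 e) (by decide)
  have hiq : i ≠ q := fun e => absurd (@hinj 0 3 e) (by decide)
  have hjp : j ≠ p := fun e => absurd (@hinj 1 2 e) (by decide)
  have hjq : j ≠ q := fun e => absurd (@hinj 1 3 e) (by decide)
  have hpq : p ≠ q := fun e => absurd (@hinj 2 3 e) (by decide)
  have h1 := h.iso i j p q hinj
  have h2 := h.iso i j q p (injective_four hij hiq hip hjq hjp hpq.symm)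
  unfold isoPinch traceFour at h1 h2
  rw [isoComp_swap] at h2
  unfold isoComp at h1
  unfold excess secSum pinchConst
  rcases abs_cases (R.comp i j p q) with ⟨e, -⟩ | ⟨e, -⟩ <;> rw [e] <;> linarith

/-- A lower bound for `R_{pqpq}` from the isotropic curvature of the planes `{i, p}`, `{j, q}` and
`{i, q}`, `{j, p}`. -/
theorem IsPinched.comp_sectional_ge (h : IsPinched b κ N R)
    (hinj : Function.Injective ![i, j, p, q]) :
    -R.comp i j i j - (excess b κ R i j p + excess b κ R i j q) / 2
      + b * (ricci R p p + ricci R q q) + pinchConst b κ R i j / 2 ≤ R.comp p q p q := by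
  have hij : i ≠ j := fun e => absurd (@hinj 0 1 e) (by decide)
  have hip : i ≠ p := fun e => absurd (@hinj 0 2 e) (by decide)
  have hiq : i ≠ q := fun e => absurd (@hinj 0 3 e) (by decide)
  have hjp : j ≠ p := fun e => absurd (@hinj 1 2 e) (by decide)
  have hjq : j ≠ q := fun e => absurd (@hinj 1 3 e) (by decide)
  have hpq : p ≠ q := fun e => absurd (@hinj 2 3 e) (by decide)
  have h1 := h.iso i p j q (injective_four hip hij hiq hjp.symm hpq hjq)
  have h2 := h.iso i p q j (injective_four hip hiq hij hpq hjp.symm hjq.symm)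
  have h3 := h.iso i q j p (injective_four hiq hij hip hjq.symm hpq.symm hjp)
  have h4 := h.iso i q p j (injective_four hiq hip hij hpq.symm hjq.symm hjp.symm)
  unfold isoPinch traceFour at h1 h2 h3 h4
  rw [isoComp_swap] at h2 h4
  unfold isoComp at h1 h3
  unfold excess secSum pinchConst
  have := R.comp_swap_swap p j
  have := R.comp_swap_swap q j
  have := R.comp_swap_swap p q
  linarith

theorem sum_ricci_others (hij : i ≠ j) :
    ∑ p ∈ others i j, ricci R p p = scal R - (ricci R i i + ricci R j j) := by
  rw [scal, sum_eq_add_sum_others hij fun p => ricci R p p]; ring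

theorem ricci_eq_secSum_add (hij : i ≠ j) (hp : p ∈ others i j) :
    ricci R p p = secSum R i j p + ∑ q ∈ (others i j).erase p, R.comp p q p q := by
  rw [Finset.sum_erase_eq_sub hp, R.comp_self_left, ricci,
    sum_eq_add_sum_others hij fun q => R.comp p q p q, secSum, R.comp_swap_swap p i,
    R.comp_swap_swap p j]
  ring

theorem card_others_real (hij : i ≠ j) (hn : 5 ≤ n) : ((others i j).card : ℝ) = n - 2 := by
  rw [card_others hij, Nat.cast_sub (by omega)]; norm_num

theorem sum_secSum (hij : i ≠ j) : ∑ p ∈ others i j, secSum R i j p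
    = ricci R i i + ricci R j j - 2 * R.comp i j i j := sum_others_eq hij R

theorem sum_secSum_eq (hn : 5 ≤ n) (hij : i ≠ j) : ∑ p ∈ others i j, secSum R i j p
    = ∑ p ∈ others i j, excess b κ R i j p
      + 2 * b * (scal R - (ricci R i i + ricci R j j)) + (n - 2) * pinchConst b κ R i j / 2 := by
  simp only [excess, Finset.sum_sub_distrib, ← Finset.mul_sum, sum_ricci_others hij,
    Finset.sum_const, nsmul_eq_mul, card_others_real hij hn]
  ring

theorem pinchConst_ge (hp : SmallParams n b κ N) (hR : R ∈ pinchedSet n b κ N) (hij : i ≠ j) :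
    7 * κ - 8 * b ^ 2 * scal R ≤ pinchConst b κ R i j := by
  have h1 := (isPinched_of_mem hR).neg_le hij
  have hs : 0 ≤ scal R := hp.κ_pos.le.trans (scal_ge hp hR)
  obtain ⟨he, hg⟩ := hp.coef_le
  have h2 := mul_le_mul_of_nonneg_right hg hs
  have hb := hp.b_pos
  have h3 : -N ≤ ricci R i i + ricci R j j := by
    have : 0 ≤ (2 - 1 / (4 * (n : ℝ))) * b * scal R :=
      mul_nonneg (mul_nonneg (by linarith) hb.le) hs
    linarith
  have h4 := mul_le_mul_of_nonneg_left h3 hb.le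
  have h5 : 2 * (b * N) ≤ κ := by
    have h6 := mul_nonneg (show 0 ≤ (n : ℝ) - 1 by linarith [hp.five_le])
      (mul_nonneg hb.le hp.N_nonneg)
    have h7 := mul_nonneg hb.le hp.N_nonneg
    linarith [hp.N_small]
  unfold pinchConst
  linarith

/-- The basic lower bound for the reaction term `∑ (R_{ipip} + R_{jpjp}) Ric_{pp}`. -/
theorem sum_secSum_mul_ricci_ge (hp : SmallParams n b κ N) (hR : R ∈ pinchedSet n b κ N)
    (hij : i ≠ j) (hm : ricci R i i + ricci R j j ≤ (2 - 1 / (8 * n)) * b * scal R) :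
    2 * b * ∑ p ∈ others i j, ricci R p p ^ 2
      + pinchConst b κ R i j / 2 * (scal R - (ricci R i i + ricci R j j))
      + (∑ p ∈ others i j, excess b κ R i j p ^ 2 + (∑ p ∈ others i j, excess b κ R i j p) ^ 2) / 2
      ≤ ∑ p ∈ others i j, secSum R i j p * ricci R p p := by
  have hpin := isPinched_of_mem hR
  have hPIC := mem_PIC_of_mem hp hR
  have hs : 0 ≤ scal R := hp.κ_pos.le.trans (scal_ge hp hR)
  have hn := hp.five_le
  have hb := hp.b_pos
  have hγ := pinchConst_ge hp hR hij
  have hcard := card_others_real hij hp.dim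
  have hXU := sum_secSum_eq (R := R) (b := b) (κ := κ) hp.dim hij
  rw [sum_secSum hij] at hXU
  have hsumρ := sum_ricci_others (R := R) hij
  have hinj : ∀ p ∈ others i j, ∀ q ∈ others i j, p ≠ q → Function.Injective ![i, j, p, q] := by
    intro p hp' q hq' hpq
    rw [mem_others] at hp' hq'
    exact injective_four hij hp'.1.symm hq'.1.symm hp'.2.symm hq'.2.symm hpq
  have hx : ∀ p, secSum R i j p
      = excess b κ R i j p + 2 * b * ricci R p p + pinchConst b κ R i j / 2 := by
    intro p; unfold excess; ring
  set u := excess b κ R i j with hu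
  set γ := pinchConst b κ R i j with hγd
  set U := ∑ p ∈ others i j, u p with hU
  set s := scal R with hsd
  obtain ⟨m, hmd⟩ : ∃ m, m = ricci R i i + ricci R j j := ⟨_, rfl⟩
  rw [← hmd] at hXU hsumρ hm ⊢
  have hm2 : m ≤ 2 * b * s := by
    have : 0 ≤ 1 / (8 * (n : ℝ)) * (b * s) := by positivity
    linarith
  have hbs : 0 ≤ b * s := by positivity
  have hU0 : 0 ≤ U := by
    refine sum_nonneg_of_pairs _ (by rw [card_others hij]; have := hp.dim; omega)
      fun p hp' q hq' hpq => ?_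
    exact le_trans (by positivity) (hpin.abs_comp_le (hinj p hp' q hq' hpq))
  -- smallness of `b` relative to `1 / n`
  have hsmall : (4 + 2 * (n : ℝ)) * b ^ 2 * s ≤ 1 / (32 * n) * b * s := by
    have h1 := hp.pow_mul_le (m := 2) (by norm_num)
    have h2 : (4 + 2 * (n : ℝ)) * b ≤ 1 / (32 * n) := by
      rw [le_div_iff₀ (by positivity)]
      have h3 := mul_nonneg (show (0 : ℝ) ≤ n - 1 by linarith) (show 0 ≤ n * b by positivity)
      linarith
    have h3 := mul_le_mul_of_nonneg_right h2 hbs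
    linarith
  have hmain := weighted_sum_ge (others i j) (by rw [card_others hij]; have := hp.dim; omega)
    (u := u) (x := secSum R i j) (ρ := fun p => ricci R p p) (K := fun p q => R.comp p q p q)
    (c := 1 / (32 * n) * b * s) (by positivity) (fun p q => R.comp_swap_swap p q)
    (fun p hp' q hq' hpq => le_trans (by positivity) (hpin.abs_comp_le (hinj p hp' q hq' hpq)))
    (fun p hp' q hq' hpq => by
      have h1 := hpin.comp_sectional_ge (hinj p hp' q hq' hpq)
      have h2 := ricci_four_nonneg hp.dim hPIC (hinj p hp' q hq' hpq)
      rw [← hu, ← hγd] at h1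
      rw [add_assoc, add_assoc, ← add_assoc, ← hmd] at h2
      have h3 := mul_nonneg hb.le h2
      have h4 := mul_le_mul_of_nonneg_left hm2 hb.le
      have h5 : -(2 * n * b ^ 2 * s) ≤ n * γ / 4 := by
        have h6 : (n : ℝ) * (-(8 * b ^ 2 * s)) ≤ n * γ :=
          mul_le_mul_of_nonneg_left (by linarith [hp.κ_pos]) (by linarith)
        linarith
      have h7 : 1 / (8 * (n : ℝ)) = 4 * (1 / (32 * n)) := by field_simp; norm_num
      rw [h7] at hm
      linarith)
    (fun p hp' => ricci_eq_secSum_add hij hp')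
  set S := ∑ p ∈ others i j, u p ^ 2 with hS
  obtain ⟨Et, hEt⟩ : ∃ E, E = ∑ p ∈ others i j, u p * ricci R p p := ⟨_, rfl⟩
  have hux : ∑ p ∈ others i j, u p * secSum R i j p = S + 2 * b * Et + γ / 2 * U := by
    rw [hS, hEt, hU, Finset.mul_sum, Finset.mul_sum, ← Finset.sum_add_distrib,
      ← Finset.sum_add_distrib]
    refine Finset.sum_congr rfl fun p _ => ?_
    rw [hx p]; ring
  have hE : ∑ p ∈ others i j, secSum R i j p * ricci R p p
      = Et + 2 * b * ∑ p ∈ others i j, ricci R p p ^ 2 + γ / 2 * (s - m) := by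
    rw [← hsumρ, hEt, Finset.mul_sum, Finset.mul_sum, ← Finset.sum_add_distrib,
      ← Finset.sum_add_distrib]
    refine Finset.sum_congr rfl fun p _ => ?_
    rw [hx p]; ring
  rw [hE]
  rw [hux, ← hEt] at hmain
  have hSn : 0 ≤ S := Finset.sum_nonneg fun p _ => sq_nonneg _
  have h1 : 0 ≤ (2 * (1 / (32 * n) * b * s) + γ / 2) * U := by
    refine mul_nonneg ?_ hU0
    have : 0 ≤ (n : ℝ) * b ^ 2 * s := by positivity
    have h2 : 0 ≤ b ^ 2 * s := by positivity
    have h3 := hp.κ_pos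
    linarith
  have h2 : (S + U ^ 2) / 2 ≤ (1 - 2 * b) * Et := by linarith
  have h3 : 0 ≤ Et := by
    have h4 : 0 ≤ (1 - 2 * b) * Et := le_trans (by positivity) h2
    exact nonneg_of_mul_nonneg_right h4 (by linarith [hp.b_le])
  have h4 := mul_nonneg hb.le h3
  linarith

end

section

variable {b κ N δ ω : ℝ} {R : CurvTensor n} {i j p q r : Fin n}

/-! ### Variations of the two-plane and reduction to a diagonal Ricci block -/

theorem ricPinch_comm (δ ω : ℝ) (R : CurvTensor n) (i j : Fin n) :
    ricPinch δ ω R i j = ricPinch δ ω R j i := by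
  unfold ricPinch
  rw [R.comp_swap_swap i j]; ring

/-- The first variation of the Ricci pinching functional, rotating `e_i` towards `e_q`. -/
theorem ricPinch_variation (hij : i ≠ j)
    (hR : ∀ A ∈ Matrix.orthogonalGroup (Fin n) ℝ, -N ≤ ricPinch δ ω (rotate A R) i j)
    (h0 : ricPinch δ ω R i j = -N) (hq : q ∈ others i j) :
    (1 + δ) * ricci R i q = 2 * δ * R.comp j i j q := by
  rw [mem_others] at hq
  have hdot := @dot_stdVec n
  have key : ∀ t : ℝ, 0 ≤ (2 * ((1 + δ) * ricci R i q - 2 * δ * R.comp j i j q)) * t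
      + ((1 + δ) * (ricci R q q + ricci R j j) - 2 * δ * R.comp q j q j - (ω * scal R - N)) * t ^ 2
      + t ^ 3 * (0 : ℝ) := by
    intro t
    have h1 := ricPinch_vectors hij hR (x := stdVec i + t • stdVec q) (y := stdVec j)
      (c := 1 + t ^ 2) (d := 1)
      (by simp [add_dotProduct, hdot, hij, hq.2])
      (by simp [add_dotProduct, dotProduct_add, hdot, hq.1, hq.1.symm]; ring)
      (by simp [hdot]) (by positivity) one_pos
    simp only [ricForm_add_left, ricForm_add_right, ricForm_smul_left, ricForm_smul_right,
      ricForm_stdVec, R.eval_add₁, R.eval_add₃, R.eval_smul₁, R.eval_smul₃, eval_stdVec] at h1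
    have e1 : R.comp q j i j = R.comp j i j q := by
      rw [R.pair_symm, R.antisymm_left, R.antisymm_right]; ring
    have e2 : R.comp i j q j = R.comp j i j q := by
      rw [R.antisymm_left, R.antisymm_right]; ring
    rw [e1, e2, ricci_symm R q i] at h1
    unfold ricPinch at h0
    linarith
  have := (taylor_nonneg (r := fun _ => 0) continuous_const key).1
  linarith

/-- The components `R_{ipiq} + R_{jpjq}` are controlled by the diagonal ones. -/
theorem abs_cross_le (hR : R ∈ PIC n) (hij : i ≠ j) (hp : p ∈ others i j) (hq : q ∈ others i j)
    (hr : r ∈ others i j) (hpq : p ≠ q) (hpr : p ≠ r) (hqr : q ≠ r) :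
    |R.comp i p i q + R.comp j p j q|
      ≤ (secSum R i j p + secSum R i j q) / 2 + secSum R i j r := by
  rw [mem_others] at hp hq hr
  have hs : (√2)⁻¹ * (√2)⁻¹ = (1 / 2 : ℝ) := by
    rw [← mul_inv, Real.mul_self_sqrt (by norm_num)]; norm_num
  have key : ∀ ε : ℝ, ε * ε = 1 → 0 ≤ (secSum R i j p + secSum R i j q) / 2 + secSum R i j r
      + ε * (R.comp i p i q + R.comp j p j q) := by
    intro ε hε
    have hdot := @dot_stdVec n
    have hO : ∀ i' j' : Fin n, i' ≠ j' → i' ≠ p → i' ≠ q → i' ≠ r → j' ≠ p → j' ≠ q → j' ≠ r →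
        OrthoTuple ![stdVec i', stdVec j', (√2)⁻¹ • (stdVec p + ε • stdVec q), stdVec r] := by
      intro i' j' h1 h2 h3 h4 h5 h6 h7
      have e1 : ((√2)⁻¹ • (stdVec p + ε • stdVec q)) ⬝ᵥ ((√2)⁻¹ • (stdVec p + ε • stdVec q)) = 1 := by
        simp only [smul_dotProduct, dotProduct_smul, add_dotProduct, dotProduct_add, hdot, hpq,
          hpq.symm, if_true, if_false, smul_eq_mul]
        linear_combination (1 + ε * ε) * hs + 1 / 2 * hε
      intro a c
      fin_cases a <;> fin_cases c <;>
        simp [hdot, h1, h2, h3, h4, h5, h6, h7, h1.symm, h2.symm, h3.symm, h4.symm, h5.symm,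
          h6.symm, h7.symm, hpr, hqr, hpr.symm, hqr.symm, dotProduct_add, add_dotProduct]
      · simpa [hdot, dotProduct_add, add_dotProduct] using e1
    have h1 := isoEval_nonneg hR (hO i j hij hp.1.symm hq.1.symm hr.1.symm hp.2.symm hq.2.symm
      hr.2.symm)
    have h2 := isoEval_nonneg hR (hO j i hij.symm hp.2.symm hq.2.symm hr.2.symm hp.1.symm hq.1.symm
      hr.1.symm)
    have hR1 : ∀ a : Fin n, R.eval (stdVec a) ((√2)⁻¹ • (stdVec p + ε • stdVec q)) (stdVec a)
        ((√2)⁻¹ • (stdVec p + ε • stdVec q)) = (R.comp a p a p + R.comp a q a q) / 2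
          + ε * R.comp a p a q := by
      intro a
      simp only [R.eval_smul₂, R.eval_smul₄, R.eval_add₂, R.eval_add₄, eval_stdVec]
      rw [R.pair_symm a q a p]
      linear_combination (R.comp a p a p + 2 * ε * R.comp a p a q + ε * ε * R.comp a q a q) * hs
        + 1 / 2 * R.comp a q a q * hε
    unfold isoEval at h1 h2
    rw [R.eval_swap_left (stdVec i) (stdVec j)] at h2
    rw [hR1, hR1, eval_stdVec, eval_stdVec] at h1 h2
    unfold secSum
    linarith
  rw [abs_le]
  constructor <;> linarith [key 1 (by norm_num), key (-1) (by norm_num)]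

/-- It suffices to consider bases in which the Ricci tensor is diagonal on the complement of the
two-plane. -/
theorem ricPinch_Q_nonneg_of_diagonal {G : Set (CurvTensor n)}
    (hG : ∀ A ∈ Matrix.orthogonalGroup (Fin n) ℝ, ∀ R ∈ G, rotate A R ∈ G)
    (h : ∀ R ∈ G, ricPinch δ ω R i j = -N →
      (∀ p ∈ others i j, ∀ q ∈ others i j, p ≠ q → ricci R p q = 0) → 0 ≤ ricPinch δ ω (Q R) i j)
    (hR : R ∈ G) (h0 : ricPinch δ ω R i j = -N) : 0 ≤ ricPinch δ ω (Q R) i j := by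
  obtain ⟨A, hA, hfix, hdiag⟩ :=
    exists_orthogonal_diagonalizing (ricMat R) (ricMat_isSymm R) (others i j)
  have hi : A i = stdVec i := hfix i (by simp [mem_others])
  have hj : A j = stdVec j := hfix j (by simp [mem_others])
  have hinv : ∀ S : CurvTensor n, ricPinch δ ω (rotate A S) i j = ricPinch δ ω S i j := by
    intro S
    unfold ricPinch
    rw [ricci_rotate hA, ricci_rotate hA, scal_rotate hA, comp_rotate, hi, hj, ricForm_stdVec,
      ricForm_stdVec, eval_stdVec]
  have := h (rotate A R) (hG A hA R hR) (by rw [hinv, h0]) fun p hp q hq hpq => by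
    rw [ricci_rotate hA]; exact hdiag p hp q hq hpq
  rwa [Q_rotate hA, hinv] at this

theorem sq_sum_le_card_mul {I : Finset (Fin n)} (Y : Fin n → Fin n → ℝ) :
    (∑ p ∈ I, Y p p) ^ 2 ≤ I.card * ∑ p ∈ I, ∑ q ∈ I, Y p q ^ 2 := by
  refine (sq_sum_le_card_mul_sum_sq (s := I) (f := fun p => Y p p)).trans ?_
  refine mul_le_mul_of_nonneg_left (Finset.sum_le_sum fun p hp => ?_) (Nat.cast_nonneg _)
  exact Finset.single_le_sum (f := fun q => Y p q ^ 2) (fun q _ => sq_nonneg _) hp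

/-- The quadratic terms in the evolution of a sectional curvature. -/
theorem comp_Q_sectional_le (hn : 5 ≤ n) (hij : i ≠ j) : ((n : ℝ) - 2) * (Q R).comp i j i j
      + (ricci R j j - ricci R i i) ^ 2 / 2 + 2 * ricci R i j ^ 2
      ≤ ((n : ℝ) - 2) * (2 * R.comp i j i j ^ 2
        + 2 * ∑ q ∈ others i j, (R.comp i j i q ^ 2 + R.comp j i j q ^ 2)
        + 2 * ∑ p ∈ others i j, ∑ q ∈ others i j, R.comp i j p q ^ 2
        + 1 / 2 * ∑ p ∈ others i j, ∑ q ∈ others i j,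
          (R.comp i p i q + R.comp j p j q) ^ 2) := by
  have hk : ((others i j).card : ℝ) = n - 2 := card_others_real hij hn
  have hY := sq_sum_le_card_mul (I := others i j)
    (fun p q => (R.comp j p j q - R.comp i p i q) / 2)
  have hZ := sq_sum_le_card_mul (I := others i j) (fun p q => R.comp i p j q)
  rw [hk] at hY hZ
  have tY : ∑ p ∈ others i j, (R.comp j p j p - R.comp i p i p) / 2
      = (ricci R j j - ricci R i i) / 2 := by
    rw [ricci, ricci, sum_eq_add_sum_others hij, sum_eq_add_sum_others hij (fun p => R.comp i p i p),
      R.comp_self_left, R.comp_self_left, R.comp_swap_swap i j, ← Finset.sum_div,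
      Finset.sum_sub_distrib]
    ring
  have tZ : ∑ p ∈ others i j, R.comp i p j p = ricci R i j := by
    rw [ricci, sum_eq_add_sum_others hij, R.comp_self_left, R.comp_self_right]; ring
  rw [tY] at hY
  rw [tZ] at hZ
  have hsym : ∑ p ∈ others i j, ∑ q ∈ others i j, R.comp i q j p ^ 2
      = ∑ p ∈ others i j, ∑ q ∈ others i j, R.comp i p j q ^ 2 := Finset.sum_comm
  have hsplit : ∑ p ∈ others i j, ∑ q ∈ others i j,
        (R.comp i p i q * R.comp j p j q - R.comp i p j q * R.comp j p i q)
      = 1 / 4 * ∑ p ∈ others i j, ∑ q ∈ others i j, (R.comp i p i q + R.comp j p j q) ^ 2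
        - ∑ p ∈ others i j, ∑ q ∈ others i j, ((R.comp j p j q - R.comp i p i q) / 2) ^ 2
        + 1 / 2 * ∑ p ∈ others i j, ∑ q ∈ others i j, R.comp i j p q ^ 2
        - 1 / 2 * ∑ p ∈ others i j, ∑ q ∈ others i j, R.comp i p j q ^ 2
        - 1 / 2 * ∑ p ∈ others i j, ∑ q ∈ others i j, R.comp i q j p ^ 2 := by
    simp only [Finset.mul_sum, ← Finset.sum_add_distrib, ← Finset.sum_sub_distrib]
    refine Finset.sum_congr rfl fun p _ => Finset.sum_congr rfl fun q _ => ?_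
    have h1 : R.comp i j p q = R.comp i p j q - R.comp i q j p := by
      linarith [R.bianchi i j p q, R.antisymm_left p i j q, R.pair_symm j p i q,
        R.antisymm_right i q j p]
    rw [h1, R.pair_symm j p i q]
    ring
  rw [comp_Q_sectional R hij, hsplit, hsym]
  linarith

/-- The evolution inequality for the Ricci pinching functional at a boundary point. -/
theorem ricPinch_Q_nonneg_of_reaction (hn : 5 ≤ n) (hij : i ≠ j) (hδ : 0 ≤ δ) (hδω : δ * ω ≤ 1 / 4)
    (hω : 0 ≤ ω) (hω' : (n - 2 : ℝ) * ω ≤ δ)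
    (hR : ∀ A ∈ Matrix.orthogonalGroup (Fin n) ℝ, -N ≤ ricPinch δ ω (rotate A R) i j)
    (h0 : ricPinch δ ω R i j = -N)
    (hd : ∀ p ∈ others i j, ∀ q ∈ others i j, p ≠ q → ricci R p q = 0)
    (hre : 0 ≤ R.comp i j i j * (ω * scal R - N)
      + (1 + δ) * ∑ p ∈ others i j, secSum R i j p * ricci R p p
      - ω * ((ricci R i i + ricci R j j) ^ 2 / 2 + ∑ p ∈ others i j, ricci R p p ^ 2)
      - 2 * δ * ∑ p ∈ others i j, ∑ q ∈ others i j, R.comp i j p q ^ 2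
      - δ / 2 * ∑ p ∈ others i j, ∑ q ∈ others i j, (R.comp i p i q + R.comp j p j q) ^ 2) :
    0 ≤ ricPinch δ ω (Q R) i j := by
  have hk : (0 : ℝ) < n - 2 := by
    have : (5 : ℝ) ≤ n := by exact_mod_cast hn
    linarith
  have hvi : ∀ q ∈ others i j, (1 + δ) * ricci R i q = 2 * δ * R.comp j i j q :=
    fun q hq => ricPinch_variation hij hR h0 hq
  have hvj : ∀ q ∈ others i j, (1 + δ) * ricci R j q = 2 * δ * R.comp i j i q := by
    intro q hq
    refine ricPinch_variation hij.symm (N := N) (ω := ω) (fun A hA => ?_) ?_ ?_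
    · rw [ricPinch_comm]; exact hR A hA
    · rw [ricPinch_comm]; exact h0
    · rw [mem_others] at hq ⊢; exact hq.symm
  obtain ⟨T, hT⟩ : ∃ T, T = ∑ q ∈ others i j, (R.comp i j i q ^ 2 + R.comp j i j q ^ 2) := ⟨_, rfl⟩
  have hT0 : 0 ≤ T := by rw [hT]; exact Finset.sum_nonneg fun q _ => by positivity
  have hmix : (1 + δ) * ∑ q ∈ others i j, (R.comp i j i q * ricci R j q + R.comp j i j q * ricci R i q)
      = 2 * δ * T := by
    rw [hT, Finset.mul_sum, Finset.mul_sum]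
    refine Finset.sum_congr rfl fun q hq => ?_
    linear_combination R.comp i j i q * hvj q hq + R.comp j i j q * hvi q hq
  have hoff : ∑ q ∈ others i j, (ricci R i q ^ 2 + ricci R j q ^ 2) ≤ 4 * δ ^ 2 * T := by
    rw [hT, Finset.mul_sum]
    refine Finset.sum_le_sum fun q hq => ?_
    have key : ∀ x y : ℝ, (1 + δ) * x = 2 * δ * y → x ^ 2 ≤ 4 * δ ^ 2 * y ^ 2 := by
      intro x y hxy
      have h1 : ((1 + δ) * x) ^ 2 = (2 * δ * y) ^ 2 := by rw [hxy]
      have h2 : 0 ≤ (2 * δ + δ ^ 2) * x ^ 2 := by positivity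
      linarith
    linarith [key _ _ (hvi q hq), key _ _ (hvj q hq)]
  have hE : ∑ p ∈ others i j, ∑ q ∈ others i j, (R.comp i p i q + R.comp j p j q) * ricci R p q
      = ∑ p ∈ others i j, secSum R i j p * ricci R p p := by
    refine Finset.sum_congr rfl fun p hp => ?_
    rw [Finset.sum_eq_single_of_mem p hp fun q hq hqp => by rw [hd p hp q hq hqp.symm, mul_zero]]
    rfl
  have hG : ∑ p ∈ others i j, ∑ q ∈ others i j, ricci R p q ^ 2
      = ∑ p ∈ others i j, ricci R p p ^ 2 := by
    refine Finset.sum_congr rfl fun p hp => ?_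
    rw [Finset.sum_eq_single_of_mem p hp fun q hq hqp => by
      rw [hd p hp q hq hqp.symm, zero_pow two_ne_zero]]
  have hsec := comp_Q_sectional_le (R := R) hn hij
  unfold ricPinch at h0 ⊢
  rw [ricci_Q_pair R hij, scal_Q, norm_ricci_split R hij, hE, hG]
  rw [← hT] at hsec
  set SR := ∑ p ∈ others i j, ∑ q ∈ others i j, R.comp i j p q ^ 2
  set SX := ∑ p ∈ others i j, ∑ q ∈ others i j, (R.comp i p i q + R.comp j p j q) ^ 2
  set E := ∑ p ∈ others i j, secSum R i j p * ricci R p p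
  set G2 := ∑ p ∈ others i j, ricci R p p ^ 2
  set P := ∑ q ∈ others i j, (ricci R i q ^ 2 + ricci R j q ^ 2)
  set M := ∑ q ∈ others i j, (R.comp i j i q * ricci R j q + R.comp j i j q * ricci R i q)
  generalize R.comp i j i j = K at *
  generalize (Q R).comp i j i j = K' at *
  generalize ricci R i i = x at *
  generalize ricci R j j = y at *
  generalize ricci R i j = z at *
  -- the trace and off-diagonal terms absorb the part of the Ricci tensor tangent to the plane
  have h1 : δ * K' + ω * ((y - x) ^ 2 / 2 + 2 * z ^ 2)
      ≤ δ * (2 * K ^ 2 + 2 * T + 2 * SR + 1 / 2 * SX) := by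
    have h2 := mul_le_mul_of_nonneg_left hsec hδ
    have h3 := mul_le_mul_of_nonneg_right hω' (show 0 ≤ (y - x) ^ 2 / 2 + 2 * z ^ 2 by positivity)
    refine le_of_mul_le_mul_left ?_ hk
    linarith
  have h2 := mul_le_mul_of_nonneg_left hoff hω
  have h3 : 0 ≤ δ * T * (1 / 4 - δ * ω) := mul_nonneg (by positivity) (by linarith)
  have h4 : K * (ω * scal R - N) = K * ((1 + δ) * (x + y) - 2 * δ * K) := by
    congr 1; linarith
  rw [h4] at hre
  linarith

end

section

variable {b κ N : ℝ} {R : CurvTensor n} {i j : Fin n}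

/-! ### The boundary of the Ricci pinching conditions -/

theorem IsPinched.sum_comp_sq_le (h : IsPinched b κ N R) (hn : 5 ≤ n) (hij : i ≠ j) :
    ∑ p ∈ others i j, ∑ q ∈ others i j, R.comp i j p q ^ 2
      ≤ (n - 2) * ∑ p ∈ others i j, excess b κ R i j p ^ 2 := by
  have h1 : ∀ p ∈ others i j, ∀ q ∈ others i j, R.comp i j p q ^ 2
      ≤ (excess b κ R i j p ^ 2 + excess b κ R i j q ^ 2) / 2 := by
    intro p hp q hq
    rcases eq_or_ne p q with rfl | hpq
    · rw [R.comp_self_right, zero_pow two_ne_zero]; positivity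
    · rw [mem_others] at hp hq
      have h2 := h.abs_comp_le
        (injective_four hij hp.1.symm hq.1.symm hp.2.symm hq.2.symm hpq)
      have h3 := pow_le_pow_left₀ (by positivity) h2 2
      rw [mul_pow, sq_abs] at h3
      linarith [sq_nonneg (excess b κ R i j p - excess b κ R i j q)]
  refine (Finset.sum_le_sum fun p hp => Finset.sum_le_sum fun q hq => h1 p hp q hq).trans
    (le_of_eq ?_)
  rw [← card_others_real hij hn]
  simp only [← Finset.sum_div, Finset.sum_add_distrib, Finset.sum_const, nsmul_eq_mul,
    ← Finset.mul_sum]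
  ring

theorem sum_cross_sq_le (hn : 5 ≤ n) (hR : R ∈ PIC n) (hij : i ≠ j) :
    ∑ p ∈ others i j, ∑ q ∈ others i j, (R.comp i p i q + R.comp j p j q) ^ 2
      ≤ (n - 2) ^ 2 * (3 / 2 * ∑ p ∈ others i j, secSum R i j p ^ 2) := by
  have h1 : ∀ p ∈ others i j, ∀ q ∈ others i j, (R.comp i p i q + R.comp j p j q) ^ 2
      ≤ 3 / 2 * ∑ p ∈ others i j, secSum R i j p ^ 2 := by
    intro p hp q hq
    have hG : ∀ t ⊆ others i j, ∑ p ∈ t, secSum R i j p ^ 2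
        ≤ ∑ p ∈ others i j, secSum R i j p ^ 2 := fun t ht =>
      Finset.sum_le_sum_of_subset_of_nonneg ht fun _ _ _ => sq_nonneg _
    rcases eq_or_ne p q with rfl | hpq
    · have := hG {p} (by simpa using hp)
      rw [Finset.sum_singleton] at this
      have h0 : (R.comp i p i p + R.comp j p j p) ^ 2 = secSum R i j p ^ 2 := rfl
      rw [h0]
      linarith [sq_nonneg (secSum R i j p)]
    · obtain ⟨r, hr, hrn⟩ : ∃ r ∈ others i j, r ∉ ({p, q} : Finset (Fin n)) := by
        refine Finset.exists_mem_notMem_of_card_lt_card ?_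
        rw [card_others hij, Finset.card_pair hpq]; omega
      simp only [Finset.mem_insert, Finset.mem_singleton, not_or] at hrn
      have h2 := abs_cross_le hR hij hp hq hr hpq (Ne.symm hrn.1) (Ne.symm hrn.2)
      have h3 := pow_le_pow_left₀ (abs_nonneg _) h2 2
      rw [sq_abs] at h3
      have h4 := hG {p, q, r} (by
        intro a ha
        simp only [Finset.mem_insert, Finset.mem_singleton] at ha
        rcases ha with rfl | rfl | rfl <;> assumption)
      rw [Finset.sum_insert (by simp [hpq, Ne.symm hrn.1]),
        Finset.sum_insert (by simp [Ne.symm hrn.2]), Finset.sum_singleton] at h4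
      set x := secSum R i j p
      set y := secSum R i j q
      set z := secSum R i j r
      linarith [sq_nonneg (x - y), sq_nonneg (x - z / 2), sq_nonneg (y - z / 2)]
  refine (Finset.sum_le_sum fun p hp => Finset.sum_le_sum fun q hq => h1 p hp q hq).trans
    (le_of_eq ?_)
  rw [← card_others_real hij hn]
  simp only [Finset.sum_const, nsmul_eq_mul]
  ring

theorem sum_secSum_sq_le (hn : 5 ≤ n) (hij : i ≠ j) : ∑ p ∈ others i j, secSum R i j p ^ 2
      ≤ 3 * (∑ p ∈ others i j, excess b κ R i j p ^ 2
        + 4 * b ^ 2 * ∑ p ∈ others i j, ricci R p p ^ 2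
        + (n - 2) * pinchConst b κ R i j ^ 2 / 4) := by
  have h1 : ∀ p ∈ others i j, secSum R i j p ^ 2 ≤ 3 * (excess b κ R i j p ^ 2
      + 4 * b ^ 2 * ricci R p p ^ 2 + pinchConst b κ R i j ^ 2 / 4) := by
    intro p _
    have h2 : secSum R i j p
        = excess b κ R i j p + 2 * b * ricci R p p + pinchConst b κ R i j / 2 := by
      unfold excess; ring
    rw [h2]
    set x := excess b κ R i j p
    set y := 2 * b * ricci R p p with hy
    set z := pinchConst b κ R i j / 2 with hz
    have e1 : 4 * b ^ 2 * ricci R p p ^ 2 = y ^ 2 := by rw [hy]; ring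
    have e2 : pinchConst b κ R i j ^ 2 / 4 = z ^ 2 := by rw [hz]; ring
    rw [e1, e2]
    linarith [sq_nonneg (x - y), sq_nonneg (x - z), sq_nonneg (y - z)]
  refine (Finset.sum_le_sum h1).trans (le_of_eq ?_)
  rw [← card_others_real hij hn]
  simp only [← Finset.mul_sum, Finset.sum_add_distrib, Finset.sum_const, nsmul_eq_mul]
  ring

theorem sq_scal_sub_le (hn : 5 ≤ n) (hij : i ≠ j) :
    (scal R - (ricci R i i + ricci R j j)) ^ 2
      ≤ n * ∑ p ∈ others i j, ricci R p p ^ 2 := by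
  rw [← sum_ricci_others hij]
  refine sq_sum_le_card_mul_sum_sq.trans ?_
  rw [card_others_real hij hn]
  exact mul_le_mul_of_nonneg_right (by linarith)
    (Finset.sum_nonneg fun p _ => sq_nonneg (ricci R p p))

theorem pinchConst_le (hb : 0 < b) (hs : 0 ≤ scal R)
    (hm : ricci R i i + ricci R j j ≤ 2 * b * scal R) :
    pinchConst b κ R i j ≤ 8 * κ + 4 * b ^ 2 * scal R := by
  have h1 := mul_le_mul_of_nonneg_left hm hb.le
  have h2 : 0 ≤ (1 / 2 + 1 / (4 * (n : ℝ))) * b ^ 2 * scal R := by positivity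
  unfold pinchConst
  linarith

/-- The terms of the evolution of a sectional curvature that are not controlled by a sign are small. -/
theorem reaction_error_le {ν b κ s W S G γ SR SX : ℝ} (hν : 5 ≤ ν) (hb : 0 < b)
    (hb1 : 10 ^ 7 * b ≤ 1) (hbν2 : 10 ^ 7 * (ν ^ 2 * b) ≤ 1)
    (hbν3 : 10 ^ 7 * (ν ^ 3 * b) ≤ 1) (hbν4 : 10 ^ 7 * (ν ^ 4 * b) ≤ 1)
    (hκ : 0 ≤ κ) (hκW : κ ≤ 2 * W) (hb2s : 0 ≤ b ^ 2 * s) (hb2W : b ^ 2 * s ≤ 2 * (b ^ 2 * W))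
    (hγ : |γ| ≤ 8 * κ + 8 * (b ^ 2 * s)) (hS : 0 ≤ S) (hG0 : 0 ≤ G) (hSR : SR ≤ (ν - 2) * S)
    (hSX : SX ≤ (ν - 2) ^ 2 * (3 / 2 * (3 * (S + 4 * b ^ 2 * G + (ν - 2) * γ ^ 2 / 4)))) :
    2 * (2 * (ν - 2) * b) * SR + 2 * (ν - 2) * b / 2 * SX
      ≤ S / 2 + b / (16 * ν) * G + κ * W + b ^ 2 * W ^ 2 := by
  have hk : 0 ≤ ν - 2 := by linarith
  have hb2W2 : 0 ≤ b ^ 2 * W ^ 2 := by positivity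
  have hκW' : 0 ≤ κ * W := mul_nonneg hκ (by linarith)
  have hSRb : 2 * (2 * (ν - 2) * b) * SR + (2 * (ν - 2) * b) / 2 * ((ν - 2) ^ 2 * (9 / 2 * S)) ≤ S / 2 := by
    have h1 := mul_le_mul_of_nonneg_left hSR (show 0 ≤ 2 * (2 * (ν - 2) * b) by positivity)
    have h2 : 2 * (2 * (ν - 2) * b) * (ν - 2) + (2 * (ν - 2) * b) / 2 * ((ν - 2) ^ 2 * (9 / 2)) ≤ 1 / 2 := by
      have h3 : 2 * (2 * (ν - 2) * b) * (ν - 2) ≤ 4 * (ν ^ 2 * b) := by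
        have h4 : (ν - 2) ^ 2 ≤ ν ^ 2 := pow_le_pow_left₀ (by linarith) (by linarith) 2
        have := mul_le_mul_of_nonneg_right h4 hb.le
        linarith
      have h5 : (2 * (ν - 2) * b) / 2 * ((ν - 2) ^ 2 * (9 / 2)) ≤ 9 / 2 * (ν ^ 3 * b) := by
        have h4 : (ν - 2) ^ 3 ≤ ν ^ 3 := pow_le_pow_left₀ (by linarith) (by linarith) 3
        have := mul_le_mul_of_nonneg_right h4 hb.le
        linarith
      linarith
    have h3 := mul_le_mul_of_nonneg_right h2 hS
    linarith
  have hν3 : (ν - 2) ^ 3 ≤ ν ^ 3 := pow_le_pow_left₀ (by linarith) (by linarith) 3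
  have hν4 : (ν - 2) ^ 4 ≤ ν ^ 4 := pow_le_pow_left₀ (by linarith) (by linarith) 4
  have hGb : (2 * (ν - 2) * b) / 2 * ((ν - 2) ^ 2 * (9 / 2 * (4 * b ^ 2 * G))) ≤ b / (16 * ν) * G := by
    have h1 : 18 * (ν - 2) ^ 3 * b ^ 3 ≤ b / (16 * ν) := by
      rw [le_div_iff₀ (by positivity)]
      have h2 := mul_le_mul_of_nonneg_right hν3 (show 0 ≤ ν * b ^ 3 by positivity)
      have h3 := mul_le_mul_of_nonneg_right hbν4 (show 0 ≤ b ^ 2 by positivity)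
      have h4 := mul_le_mul_of_nonneg_right hb1 hb.le
      linarith
    have := mul_le_mul_of_nonneg_right h1 hG0
    linarith
  have hγb : (2 * (ν - 2) * b) / 2 * ((ν - 2) ^ 2 * (9 / 2 * ((ν - 2) * γ ^ 2 / 4)))
      ≤ κ * W + b ^ 2 * W ^ 2 := by
    have h1 : γ ^ 2 ≤ 128 * κ ^ 2 + 128 * (b ^ 2 * s) ^ 2 := by
      have h3 := pow_le_pow_left₀ (abs_nonneg _) hγ 2
      rw [sq_abs] at h3
      linarith [sq_nonneg (κ - b ^ 2 * s)]
    have h4 := mul_le_mul_of_nonneg_right hν4 (show 0 ≤ b * γ ^ 2 by positivity)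
    have h5 := mul_le_mul_of_nonneg_left h1 (show 0 ≤ ν ^ 4 * b by positivity)
    have h6 : κ ^ 2 ≤ 2 * (κ * W) := by
      have := mul_le_mul_of_nonneg_left hκW hκ; linarith
    have h7 := mul_le_mul_of_nonneg_right hbν4 (show 0 ≤ κ ^ 2 by positivity)
    have h8 := mul_le_mul_of_nonneg_right hbν4 (show 0 ≤ (b ^ 2 * s) ^ 2 by positivity)
    have h9 := pow_le_pow_left₀ hb2s hb2W 2
    have h10 : 4 * (b ^ 2 * W) ^ 2 ≤ b ^ 2 * W ^ 2 := by
      have h11 : b ^ 2 ≤ 1 / 10 := by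
        have := mul_le_mul_of_nonneg_right hb1 hb.le; linarith
      have := mul_le_mul_of_nonneg_right h11 (show 0 ≤ b ^ 2 * W ^ 2 by positivity)
      linarith
    linarith
  have hSX' := mul_le_mul_of_nonneg_left hSX (show 0 ≤ 2 * (ν - 2) * b / 2 by positivity)
  linarith

set_option maxHeartbeats 1600000 in
/-- The real inequality behind the preservation of the pinching condition that involves sectional
curvatures. Here `K`, `m`, `W`, `s` stand for the sectional curvature and the Ricci trace of the
plane, the Ricci trace of its complement and the scalar curvature, `U`, `S`, `G` for the sum and the
square sums of the excesses and of the complementary Ricci curvatures. -/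
theorem reaction_nonneg {ν b κ N s m K U S G γ E SR SX : ℝ} (hν : 5 ≤ ν) (hb : 0 < b)
    (hb1 : 10 ^ 7 * b ≤ 1) (hbν : 10 ^ 7 * (ν * b) ≤ 1) (hbν2 : 10 ^ 7 * (ν ^ 2 * b) ≤ 1)
    (hbν3 : 10 ^ 7 * (ν ^ 3 * b) ≤ 1) (hbν4 : 10 ^ 7 * (ν ^ 4 * b) ≤ 1)
    (hκ : 0 < κ) (hNκ : 8 * b * N ^ 2 ≤ κ ^ 2)
    (hκs : κ ≤ s) (hmU : m ≤ 2 * b * s)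
    (hmL : -N ≤ m) (hN : 0 ≤ N)
    (hX : m - 2 * K = U + 2 * b * (s - m) + (ν - 2) * γ / 2)
    (h0 : m + 2 * (ν - 2) * b * (m - 2 * K) = (2 - 1 / (8 * ν)) * b * s - N)
    (hγL : 7 * κ - 8 * b ^ 2 * s ≤ γ) (hγU : γ ≤ 8 * κ + 4 * b ^ 2 * s)
    (hS : 0 ≤ S) (hG : (s - m) ^ 2 ≤ ν * G)
    (hE : 2 * b * G + γ / 2 * (s - m) + (S + U ^ 2) / 2 ≤ E)
    (hSR : SR ≤ (ν - 2) * S)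
    (hSX : SX ≤ (ν - 2) ^ 2 * (3 / 2 * (3 * (S + 4 * b ^ 2 * G + (ν - 2) * γ ^ 2 / 4)))) :
    0 ≤ K * ((2 - 1 / (8 * ν)) * b * s - N) + (1 + 2 * (ν - 2) * b) * E
      - (2 - 1 / (8 * ν)) * b * (m ^ 2 / 2 + G) - 2 * (2 * (ν - 2) * b) * SR
      - 2 * (ν - 2) * b / 2 * SX := by
  obtain ⟨δ, hδ⟩ : ∃ δ, δ = 2 * (ν - 2) * b := ⟨_, rfl⟩
  obtain ⟨m0, hm0⟩ : ∃ m0, m0 = (2 - 1 / (8 * ν)) * b * s - N := ⟨_, rfl⟩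
  obtain ⟨W, hW⟩ : ∃ W, W = s - m := ⟨_, rfl⟩
  obtain ⟨D, hD⟩ : ∃ D, D = 2 * b * W + (ν - 2) * γ / 2 := ⟨_, rfl⟩
  rw [← hδ] at h0 ⊢
  rw [← hm0] at h0 ⊢
  rw [← hW] at hX hG hE
  have hs : 0 ≤ s := hκ.le.trans hκs
  have hbs : 0 ≤ b * s := by positivity
  have hδ0 : 0 ≤ δ := by rw [hδ]; exact mul_nonneg (by linarith) hb.le
  have hδ1 : δ ≤ 1 / 10 := by rw [hδ]; linarith
  have hsmall : b * s ≤ s / 100 := by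
    have := mul_le_mul_of_nonneg_right hb1 hs; linarith
  have hsW : s ≤ 2 * W := by linarith
  have hW0 : 0 ≤ W := by linarith
  have hG0 : 0 ≤ G := by
    have : 0 ≤ ν * G := le_trans (sq_nonneg _) hG
    exact nonneg_of_mul_nonneg_right this (by linarith)
  have hm0U : m0 ≤ 2 * b * s := by
    have : 0 ≤ 1 / (8 * ν) * (b * s) := by positivity
    rw [hm0]; linarith
  -- bounds for `D`
  have hb2s : 0 ≤ b ^ 2 * s := by positivity
  have hb2W : b ^ 2 * s ≤ 2 * (b ^ 2 * W) := by
    have := mul_le_mul_of_nonneg_left hsW (sq_nonneg b); linarith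
  have hνb2 : ν * (b ^ 2 * W) ≤ b * W / 1000 := by
    have h1 : 0 ≤ b * W := by positivity
    have h2 := mul_le_mul_of_nonneg_right hbν h1
    linarith
  have hD0 : 0 ≤ D := by
    have h1 := mul_le_mul_of_nonneg_left hγL (show 0 ≤ (ν - 2) / 2 by linarith)
    have h2 := mul_le_mul_of_nonneg_left hb2W (show 0 ≤ 4 * (ν - 2) by linarith)
    have h3 : 0 ≤ (ν - 2) * κ := mul_nonneg (by linarith) hκ.le
    have h4 : 0 ≤ b ^ 2 * W := by positivity
    have h5 : 0 ≤ b * W := by positivity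
    rw [hD]; linarith
  have hDU : D ≤ 3 * (b * W) + 4 * ν * κ := by
    have h1 := mul_le_mul_of_nonneg_left hγU (show 0 ≤ (ν - 2) / 2 by linarith)
    have h2 := mul_le_mul_of_nonneg_left hb2W (show 0 ≤ 2 * (ν - 2) by linarith)
    have h4 : 0 ≤ b ^ 2 * W := by positivity
    have h5 : 0 ≤ b * W := by positivity
    rw [hD]; linarith
  have hbκW : 0 ≤ b * κ * W := by positivity
  have hDm : (1 + δ) / 2 * (D * m0) ≤ 12 * (b ^ 2 * W ^ 2) + 16 * (ν * b * κ * W) := by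
    have h1 : D * m0 ≤ (3 * (b * W) + 4 * ν * κ) * (4 * (b * W)) := by
      rcases le_or_gt m0 0 with h | h
      · have h2 := mul_nonneg hD0 (neg_nonneg.2 h)
        have h3 : 0 ≤ (3 * (b * W) + 4 * ν * κ) * (4 * (b * W)) := by positivity
        linarith
      · have h4 := mul_le_mul_of_nonneg_left hsW (show 0 ≤ 2 * b by linarith)
        exact mul_le_mul hDU (by linarith) h.le (by positivity)
    have h2 : 0 ≤ (3 * (b * W) + 4 * ν * κ) * (4 * (b * W)) := by positivity
    have h3 := mul_le_mul_of_nonneg_left h1 (show 0 ≤ (1 + δ) / 2 by linarith)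
    have h4 := mul_le_mul_of_nonneg_right (show (1 + δ) / 2 ≤ 1 by linarith) h2
    linarith
  -- the sectional curvature term
  have hK : K * m0 = m0 ^ 2 / 2 - (1 + δ) / 2 * (U * m0) - (1 + δ) / 2 * (D * m0) := by
    have h1 : m - 2 * K = U + D := by rw [hX, hD]; ring
    have h2 : 2 * K = m0 - (1 + δ) * (U + D) := by rw [← h1]; linarith
    have h3 : K = (m0 - (1 + δ) * (U + D)) / 2 := by linarith
    rw [h3]; ring
  have hsq : 0 ≤ m0 ^ 2 / 2 - (1 + δ) / 2 * (U * m0) + (1 + δ) / 2 * U ^ 2 := by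
    have h1 := mul_nonneg (show 0 ≤ (1 + δ) / 2 by linarith) (sq_nonneg (U - m0 / 2))
    have h2 := mul_nonneg (show 0 ≤ 1 / 2 - (1 + δ) / 8 by linarith) (sq_nonneg m0)
    linarith
  -- the reaction term
  have hγW : 7 / 2 * (κ * W) - 8 * (b ^ 2 * W ^ 2) ≤ γ / 2 * W := by
    have h1 := mul_le_mul_of_nonneg_right hγL (show 0 ≤ W / 2 by linarith)
    have h2 := mul_le_mul_of_nonneg_right hb2W (show 0 ≤ 4 * W by linarith)
    linarith
  have hκW : 0 ≤ κ * W := by positivity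
  have hWG : 1000 * (b ^ 2 * W ^ 2) ≤ b / (16 * ν) * G := by
    have h1 : b / (16 * ν) * G = b / (16 * ν ^ 2) * (ν * G) := by field_simp
    have h2 : 1000 * b ^ 2 ≤ b / (16 * ν ^ 2) := by
      rw [le_div_iff₀ (by positivity)]
      have := mul_le_mul_of_nonneg_right hbν2 hb.le
      linarith
    have h3 := mul_le_mul_of_nonneg_left hG (show 0 ≤ b / (16 * ν ^ 2) by positivity)
    have h4 := mul_le_mul_of_nonneg_right h2 (sq_nonneg W)
    rw [h1]; linarith
  have hbGν : b / (16 * ν) * G ≤ b * G := by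
    apply mul_le_mul_of_nonneg_right _ hG0
    exact div_le_self hb.le (by linarith)
  have hE' : 2 * (b * G) + γ / 2 * W + S / 2 + (1 + δ) / 2 * U ^ 2 ≤ (1 + δ) * E := by
    have h1 := mul_le_mul_of_nonneg_left hE (show 0 ≤ 1 + δ by linarith)
    have h2 : 0 ≤ 2 * b * G + γ / 2 * W := by
      have : 0 ≤ b ^ 2 * W ^ 2 := by positivity
      linarith
    have h3 := mul_nonneg hδ0 h2
    have h4 := mul_nonneg hδ0 hS
    linarith
  -- the remaining error terms
  have hγ : |γ| ≤ 8 * κ + 8 * (b ^ 2 * s) := by rw [abs_le]; constructor <;> linarith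
  have hm2 : (2 - 1 / (8 * ν)) * b * (m ^ 2 / 2) ≤ κ * W / 4 + 16 * (b ^ 2 * W ^ 2) := by
    have h1 : m ^ 2 ≤ N ^ 2 + (2 * b * s) ^ 2 := by
      rcases le_or_gt m 0 with h | h
      · have := pow_le_pow_left₀ (show 0 ≤ -m by linarith) (show -m ≤ N by linarith) 2
        linarith [sq_nonneg (2 * b * s)]
      · have := pow_le_pow_left₀ h.le hmU 2
        linarith [sq_nonneg N]
    have h2 : (2 - 1 / (8 * ν)) * b ≤ 2 * b := by
      have : 0 ≤ 1 / (8 * ν) * b := by positivity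
      linarith
    have h3 := mul_le_mul_of_nonneg_right h2 (show 0 ≤ m ^ 2 / 2 by positivity)
    have h4 := mul_le_mul_of_nonneg_left h1 hb.le
    have h5 : κ ^ 2 ≤ 2 * (κ * W) := by
      have := mul_le_mul_of_nonneg_left (hκs.trans hsW) hκ.le; linarith
    have h6 : b * s ≤ 2 * (b * W) := by
      have := mul_le_mul_of_nonneg_left hsW hb.le; linarith
    have h7 := pow_le_pow_left₀ hbs h6 2
    have h8 := mul_le_mul_of_nonneg_right (show b ≤ 1 by linarith) (sq_nonneg (b * s))
    linarith
  have herr := reaction_error_le hν hb hb1 hbν2 hbν3 hbν4 hκ.le (hκs.trans hsW) hb2s hb2W hγ hS hG0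
    hSR hSX
  rw [← hδ] at herr
  have hcoef : (2 - 1 / (8 * ν)) * b * G = 2 * (b * G) - 2 * (b / (16 * ν) * G) := by
    field_simp; ring
  have hνκ : 16 * (ν * b * κ * W) ≤ κ * W := by
    have := mul_le_mul_of_nonneg_right hbν hκW; linarith
  have hb2W2 : 0 ≤ b ^ 2 * W ^ 2 := by positivity
  rw [hK]
  linarith

end

section

variable {b κ N : ℝ} {R : CurvTensor n} {i j : Fin n}

/-- A pinched tensor on the boundary of the condition on `Ric_{ii} + Ric_{jj} + δ (Ric_{ii} + Ric_{jj} -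
2 R_{ijij})` moves inward. -/
theorem ricPinch_sec_Q_nonneg (hp : SmallParams n b κ N) (hR : R ∈ pinchedSet n b κ N)
    (hij : i ≠ j) (h0 : ricPinch (2 * (n - 2) * b) ((2 - 1 / (8 * n)) * b) R i j = -N) :
    0 ≤ ricPinch (2 * (n - 2) * b) ((2 - 1 / (8 * n)) * b) (Q R) i j := by
  refine ricPinch_Q_nonneg_of_diagonal (G := pinchedSet n b κ N)
    (fun A hA R hR => rotate_mem_pinchedSet hR hA) (fun R hR h0 hd => ?_) hR h0
  have hn := hp.five_le
  have hb := hp.b_pos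
  have hb1 := hp.pow_mul_le (m := 1) (by norm_num)
  have hb0 := hp.b_le
  have hc : 1 / (8 * (n : ℝ)) ≤ 1 / 20 :=
    one_div_le_one_div_of_le (by norm_num) (by linarith)
  have hc0 : 0 ≤ 1 / (8 * (n : ℝ)) := by positivity
  have hs := scal_ge hp hR
  have hs0 : 0 ≤ scal R := hp.κ_pos.le.trans hs
  have hω0 : 0 ≤ (2 - 1 / (8 * (n : ℝ))) * b := mul_nonneg (by linarith) hb.le
  have hω2 : (2 - 1 / (8 * (n : ℝ))) * b ≤ 2 * b := by
    have := mul_nonneg hc0 hb.le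
    linarith
  have hδ0 : 0 ≤ 2 * ((n : ℝ) - 2) * b := mul_nonneg (by linarith) hb.le
  have hPIC := mem_PIC_of_mem hp hR
  have hpin := isPinched_of_mem hR
  have hX0 := ricci_pair_ge hp.dim hPIC hij
  have hmω : ricci R i i + ricci R j j ≤ (2 - 1 / (8 * n)) * b * scal R := by
    have := mul_nonneg hδ0 hX0
    unfold ricPinch at h0
    linarith [hp.N_nonneg]
  have hm2 := hmω.trans (mul_le_mul_of_nonneg_right hω2 hs0)
  refine ricPinch_Q_nonneg_of_reaction hp.dim hij hδ0 ?_ hω0 ?_ (fun A hA => (hR A hA).ric_sec i j hij)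
    h0 hd ?_
  · have h1 : 2 * ((n : ℝ) - 2) * b ≤ 1 / 10 := by linarith
    have h2 := mul_le_mul h1 (hω2.trans (show 2 * b ≤ 1 by linarith)) hω0 (by norm_num)
    linarith
  · have := mul_le_mul_of_nonneg_left hω2 (show 0 ≤ (n : ℝ) - 2 by linarith)
    linarith
  · refine reaction_nonneg (κ := κ) (S := ∑ p ∈ others i j, excess b κ R i j p ^ 2)
      (U := ∑ p ∈ others i j, excess b κ R i j p) (γ := pinchConst b κ R i j) hn hb hb0
      (by simpa using hb1) (hp.pow_mul_le (by norm_num)) (hp.pow_mul_le (by norm_num))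
      (hp.pow_mul_le (by norm_num)) hp.κ_pos hp.N_sq_small hs hm2 ?_ hp.N_nonneg ?_ ?_
      (pinchConst_ge hp hR hij) (pinchConst_le hb hs0 hm2)
      (Finset.sum_nonneg fun p _ => sq_nonneg _) (sq_scal_sub_le hp.dim hij)
      (sum_secSum_mul_ricci_ge hp hR hij hmω) (hpin.sum_comp_sq_le hp.dim hij) ?_
    · have h1 := hpin.neg_le hij
      have h2 : 0 ≤ (2 - 1 / (4 * (n : ℝ))) * b * scal R :=
        mul_nonneg (mul_nonneg (by linarith [hp.coef_le.1]) hb.le) hs0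
      linarith
    · rw [← sum_secSum hij, sum_secSum_eq hp.dim hij]
    · unfold ricPinch at h0
      linarith
    · refine (sum_cross_sq_le hp.dim hPIC hij).trans ?_
      refine mul_le_mul_of_nonneg_left ?_ (sq_nonneg _)
      exact mul_le_mul_of_nonneg_left (sum_secSum_sq_le hp.dim hij) (by norm_num)

/-- The real inequality behind the preservation of the Ricci pinching condition; the notation is that
of `reaction_nonneg`. -/
theorem reaction_nonneg_of_excess {ν b κ s m K U γ X ω E : ℝ} (hν : 5 ≤ ν)
    (hb : 0 < b) (hbν : 10 ^ 7 * (ν * b) ≤ 1) (hbν5 : 10 ^ 7 * (ν ^ 5 * b) ≤ 1) (hκ : 0 < κ)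
    (hκs : κ ≤ s) (hm : m ≤ 2 * b * s) (hmL : -(6 * s) ≤ m)
    (hXK : m - 2 * K = X) (hX : X = U + 2 * b * (s - m) + (ν - 2) * γ / 2)
    (hXL : s / (16 * ν ^ 2) ≤ X) (hω : ω ≤ 2 * b)
    (hγL : 7 * κ - 8 * b ^ 2 * s ≤ γ) (hγU : γ ≤ 8 * κ + 4 * b ^ 2 * s)
    (hE : γ / 2 * (s - m) + U ^ 2 / 2 ≤ E) :
    0 ≤ K * m + E - ω * (50 * s ^ 2) := by
  have hs : 0 < s := hκ.trans_le hκs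
  have hbs : 0 ≤ b * s := by positivity
  have hbb : b ≤ 1 / 1000 := by
    have := mul_le_mul_of_nonneg_right hν hb.le; linarith
  have hX0 : 0 ≤ X := le_trans (by positivity) hXL
  have hb2s : b ^ 2 * s ≤ b * s / 1000 := by
    have := mul_le_mul_of_nonneg_right hbb hbs; linarith
  have hb2s0 : 0 ≤ b ^ 2 * s := by positivity
  have hνb2s : ν * (b ^ 2 * s) ≤ b * s / 1000 := by
    have := mul_le_mul_of_nonneg_right hbν hbs; linarith
  have hKm : -(X * (b * s)) ≤ K * m := by
    have h1 := mul_le_mul_of_nonneg_left hm hX0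
    have h2 : K = (m - X) / 2 := by linarith
    rw [h2]
    linarith [sq_nonneg m]
  -- the deviation of `X` from `U`
  have hD : X ≤ U + 15 * (b * s) + 4 * (ν * κ) := by
    have h1 := mul_le_mul_of_nonneg_left hγU (show 0 ≤ (ν - 2) / 2 by linarith)
    have h2 := mul_le_mul_of_nonneg_left hmL hb.le
    rw [hX]; linarith
  have hW : s * (99 / 100) ≤ s - m := by
    have := mul_le_mul_of_nonneg_right hbb hs.le; linarith
  have hbs2 : 0 ≤ b * s ^ 2 := by positivity
  have hb2s2 : b ^ 2 * s ^ 2 ≤ b * s ^ 2 / 1000 := by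
    have := mul_le_mul_of_nonneg_right hbb hbs2; linarith
  have hκs' : 0 ≤ κ * s := by positivity
  have hγW : 17 / 5 * (κ * s) - b * s ^ 2 ≤ γ / 2 * (s - m) := by
    have h1 := mul_le_mul_of_nonneg_right hγL (show 0 ≤ (s - m) / 2 by linarith)
    have h2 := mul_le_mul_of_nonneg_left hW (show 0 ≤ 7 / 2 * κ by positivity)
    have h3 := mul_le_mul_of_nonneg_left hmL (show 0 ≤ 4 * (b ^ 2 * s) by positivity)
    linarith
  have hXbs : X * (b * s) ≤ U * (b * s) + b * s ^ 2 + κ * s := by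
    have h1 := mul_le_mul_of_nonneg_right hD hbs
    have h2 := mul_le_mul_of_nonneg_right hbν hκs'
    linarith
  have hUbs : U * (b * s) ≤ U ^ 2 / 4 + b * s ^ 2 := by
    linarith [sq_nonneg (U / 2 - b * s)]
  have hωs := mul_le_mul_of_nonneg_right hω (show 0 ≤ 50 * s ^ 2 by positivity)
  -- either `U` or `κ` is large compared with `s`
  have hmain : 110 * (b * s ^ 2) ≤ U ^ 2 / 4 + 2 * (κ * s) := by
    have hν4 : 1000 * (b * ν ^ 4) ≤ 1 / 2000 := by
      have := mul_le_mul_of_nonneg_right hν (show 0 ≤ ν ^ 4 * b by positivity)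
      linarith
    have hb15 : 15 * (b * s) ≤ s / (80 * ν ^ 2) := by
      rw [le_div_iff₀ (by positivity)]
      have h1 : b * ν ^ 2 ≤ b * ν ^ 4 := by
        apply mul_le_mul_of_nonneg_left _ hb.le
        exact pow_le_pow_right₀ (by linarith) (by norm_num)
      have := mul_le_mul_of_nonneg_right (show 1200 * (b * ν ^ 2) ≤ 1 by linarith) hs.le
      linarith
    have h80 : s / (16 * ν ^ 2) = s / (80 * ν ^ 2) + 2 * (s / (40 * ν ^ 2)) := by
      field_simp; norm_num
    rcases le_or_gt (4 * (ν * κ)) (s / (40 * ν ^ 2)) with h | h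
    · have hU : s / (40 * ν ^ 2) ≤ U := by linarith
      have h1 := pow_le_pow_left₀ (by positivity) hU 2
      have h2 : 440 * (b * s ^ 2) ≤ (s / (40 * ν ^ 2)) ^ 2 := by
        rw [div_pow, le_div_iff₀ (by positivity)]
        have := mul_le_mul_of_nonneg_right (show 440 * 1600 * (b * ν ^ 4) ≤ 1 by linarith)
          (sq_nonneg s)
        linarith
      linarith
    · have h1 : 55 * (b * s) ≤ κ := by
        rw [div_lt_iff₀ (by positivity)] at h
        have h2 : ν ^ 3 ≤ ν ^ 4 := pow_le_pow_right₀ (by linarith) (by norm_num)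
        have h3 := mul_le_mul_of_nonneg_left h2 hb.le
        have h4 := mul_le_mul_of_nonneg_right (show 55 * 160 * (b * ν ^ 3) ≤ 1 by linarith) hs.le
        have h5 : ν ^ 3 * (55 * (b * s)) ≤ ν ^ 3 * κ := by linarith
        exact le_of_mul_le_mul_left h5 (by positivity)
      have := mul_le_mul_of_nonneg_right h1 hs.le
      have := sq_nonneg U
      linarith
  linarith

/-- A pinched tensor on the boundary of the condition on `Ric_{ii} + Ric_{jj}` moves inward: comparison with
the condition `ric_sec`, whose constant is larger, bounds the sum of the sectional curvatures
`R_{ipip} + R_{jpjp}` below by a multiple of the scalar curvature. -/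
theorem ricPinch_Q_nonneg (hp : SmallParams n b κ N) (hR : R ∈ pinchedSet n b κ N)
    (hij : i ≠ j) (h0 : ricPinch 0 ((2 - 1 / (4 * n)) * b) R i j = -N) :
    0 ≤ ricPinch 0 ((2 - 1 / (4 * n)) * b) (Q R) i j := by
  refine ricPinch_Q_nonneg_of_diagonal (G := pinchedSet n b κ N)
    (fun A hA R hR => rotate_mem_pinchedSet hR hA) (fun R hR h0 hd => ?_) hR h0
  have hn := hp.five_le
  have hb := hp.b_pos
  have hb1 := hp.pow_mul_le (m := 1) (by norm_num)
  have hc := hp.coef_le.1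
  have hc0 : 0 ≤ 1 / (4 * (n : ℝ)) := by positivity
  have hs := scal_ge hp hR
  have hs0 : 0 ≤ scal R := hp.κ_pos.le.trans hs
  have hPIC := mem_PIC_of_mem hp hR
  have hpin := isPinched_of_mem hR
  have hrot : ∀ A ∈ Matrix.orthogonalGroup (Fin n) ℝ,
      -N ≤ ricPinch 0 ((2 - 1 / (4 * n)) * b) (rotate A R) i j := fun A hA => (hR A hA).ric i j hij
  have hi : ∀ q ∈ others i j, ricci R i q = 0 := fun q hq => by
    simpa using ricPinch_variation hij hrot h0 hq
  have hj : ∀ q ∈ others i j, ricci R j q = 0 := fun q hq => by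
    have := ricPinch_variation hij.symm (R := R) (q := q) (N := N) (δ := 0)
      (ω := (2 - 1 / (4 * n)) * b) (fun A hA => by rw [ricPinch_comm]; exact hrot A hA)
      (by rw [ricPinch_comm]; exact h0) (by rw [mem_others] at hq ⊢; exact hq.symm)
    simpa using this
  have hE : ∑ p ∈ others i j, ∑ q ∈ others i j, (R.comp i p i q + R.comp j p j q) * ricci R p q
      = ∑ p ∈ others i j, secSum R i j p * ricci R p p := by
    refine Finset.sum_congr rfl fun p hp => ?_
    rw [Finset.sum_eq_single_of_mem p hp fun q hq hqp => by rw [hd p hp q hq hqp.symm, mul_zero]]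
    rfl
  have hG : ∑ p ∈ others i j, ∑ q ∈ others i j, ricci R p q ^ 2
      = ∑ p ∈ others i j, ricci R p p ^ 2 := by
    refine Finset.sum_congr rfl fun p hp => ?_
    rw [Finset.sum_eq_single_of_mem p hp fun q hq hqp => by
      rw [hd p hp q hq hqp.symm, zero_pow two_ne_zero]]
  have hM : ∑ q ∈ others i j, (R.comp i j i q * ricci R j q + R.comp j i j q * ricci R i q) = 0 :=
    Finset.sum_eq_zero fun q hq => by rw [hi q hq, hj q hq]; ring
  have hP : ∑ q ∈ others i j, (ricci R i q ^ 2 + ricci R j q ^ 2) = 0 :=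
    Finset.sum_eq_zero fun q hq => by rw [hi q hq, hj q hq]; ring
  have hω2 : (2 - 1 / (4 * (n : ℝ))) * b ≤ 2 * b := by
    have := mul_nonneg hc0 hb.le
    linarith
  have hω0 : 0 ≤ (2 - 1 / (4 * (n : ℝ))) * b := mul_nonneg (by linarith) hb.le
  have hx1 := ricci_le_scal hp.dim hPIC i
  have hx2 := neg_scal_le_ricci hp.dim hPIC i
  have hy1 := ricci_le_scal hp.dim hPIC j
  have hy2 := neg_scal_le_ricci hp.dim hPIC j
  have hz := abs_ricci_le hp.dim hPIC hij
  have hmeq : ricci R i i + ricci R j j = (2 - 1 / (4 * (n : ℝ))) * b * scal R - N := by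
    unfold ricPinch at h0
    linarith
  have h84 : 1 / (4 * (n : ℝ)) = 2 * (1 / (8 * n)) := by field_simp; norm_num
  have hcb : 0 ≤ 1 / (8 * (n : ℝ)) * (b * scal R) := by positivity
  have hmω : ricci R i i + ricci R j j ≤ (2 - 1 / (8 * n)) * b * scal R := by
    rw [hmeq, h84]; linarith [hp.N_nonneg]
  have hm2 : ricci R i i + ricci R j j ≤ 2 * b * scal R := by linarith
  have hEge := sum_secSum_mul_ricci_ge hp hR hij hmω
  have hS : 0 ≤ ∑ p ∈ others i j, excess b κ R i j p ^ 2 :=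
    Finset.sum_nonneg fun p _ => sq_nonneg _
  have hG0 : 0 ≤ ∑ p ∈ others i j, ricci R p p ^ 2 := Finset.sum_nonneg fun p _ => sq_nonneg _
  have hXL : scal R / (16 * (n : ℝ) ^ 2) ≤ ricci R i i + ricci R j j - 2 * R.comp i j i j := by
    have h1 := hpin.ric_sec i j hij
    have h2 := ricci_pair_ge hp.dim hPIC hij
    unfold ricPinch at h1
    have h3 : 1 / (8 * n) * (b * scal R) ≤ 2 * ((n : ℝ) - 2) * b *
        (ricci R i i + ricci R j j - 2 * R.comp i j i j) := by
      rw [h84] at hmeq; linarith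
    have h4 : 2 * ((n : ℝ) - 2) * b * (ricci R i i + ricci R j j - 2 * R.comp i j i j)
        ≤ 2 * n * b * (ricci R i i + ricci R j j - 2 * R.comp i j i j) := by
      apply mul_le_mul_of_nonneg_right _ h2
      linarith
    have h5 : 1 / (8 * n) * (b * scal R) = 2 * n * b * (scal R / (16 * (n : ℝ) ^ 2)) := by
      field_simp; ring
    rw [h5] at h3
    exact le_of_mul_le_mul_left (h3.trans h4) (by positivity)
  have hmain := reaction_nonneg_of_excess (κ := κ) (ω := (2 - 1 / (4 * (n : ℝ))) * b) hn hb
    (by simpa using hb1) (hp.pow_mul_le le_rfl) hp.κ_pos hs hm2 (by linarith) rfl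
    (by rw [← sum_secSum hij, sum_secSum_eq hp.dim hij]) hXL hω2 (pinchConst_ge hp hR hij)
    (pinchConst_le hb hs0 hm2)
    (E := ∑ p ∈ others i j, secSum R i j p * ricci R p p
      - 2 * b * ∑ p ∈ others i j, ricci R p p ^ 2) (by linarith)
  unfold ricPinch
  rw [ricci_Q_pair R hij, scal_Q, norm_ricci_split R hij, hE, hG, hM, hP]
  have hx : ricci R i i ^ 2 ≤ 9 * scal R ^ 2 := by
    have := abs_le_abs (a := ricci R i i) (b := 3 * scal R) (by linarith) (by linarith)
    have := sq_le_sq.2 this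
    linarith
  have hy : ricci R j j ^ 2 ≤ 9 * scal R ^ 2 := by
    have := abs_le_abs (a := ricci R j j) (b := 3 * scal R) (by linarith) (by linarith)
    have := sq_le_sq.2 this
    linarith
  have hz' : ricci R i j ^ 2 ≤ 16 * scal R ^ 2 := by
    have := pow_le_pow_left₀ (abs_nonneg _) hz 2
    rw [sq_abs] at this
    linarith
  have h1 := mul_le_mul_of_nonneg_left
    (show ricci R i i ^ 2 + ricci R j j ^ 2 + 2 * ricci R i j ^ 2 ≤ 50 * scal R ^ 2 by linarith) hω0
  have h2 := mul_le_mul_of_nonneg_right hω2 hG0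
  linarith

end

section

/-! ### Invariance under an ordinary differential equation -/

open Filter Topology in
/-- A function which is nonnegative on `[a, t]` and vanishes at the right endpoint has nonpositive
derivative there. -/
theorem deriv_nonpos_of_left {φ : ℝ → ℝ} {φ' a t : ℝ} (hat : a < t)
    (h : HasDerivWithinAt φ φ' (Icc a t) t) (hφ : ∀ s ∈ Icc a t, 0 ≤ φ s) (h0 : φ t = 0) :
    φ' ≤ 0 := by
  have h1 : HasDerivWithinAt φ φ' (Ico a t) t := h.mono Ico_subset_Icc_self
  rw [hasDerivWithinAt_iff_tendsto_slope' (by simp)] at h1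
  have : (𝓝[Ico a t] t).NeBot := by
    rw [nhdsWithin_Ico_eq_nhdsLT hat]; infer_instance
  refine le_of_tendsto h1 ?_
  filter_upwards [self_mem_nhdsWithin] with s hs
  rw [slope_def_field, h0, sub_zero]
  exact div_nonpos_of_nonneg_of_nonpos (hφ s (Ico_subset_Icc_self hs)) (by linarith [hs.2])

variable {E P : Type*} [NormedAddCommGroup E] [NormedSpace ℝ E] [TopologicalSpace P]
  [CompactSpace P] {ℓ : P → E →L[ℝ] ℝ} {c : P → ℝ} {F : E → E} {D : E × ℝ → E} {e : E} {η : ℝ}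
  {a b : ℝ} {x : ℝ → E}

/-- If the vector field points inwards, with positive speed, along a curve that starts inside, then
the curve stays inside. -/
theorem forall_lt_of_inward (hℓ : Continuous fun z : P × E => ℓ z.1 z.2) (hc : Continuous c)
    {y y' : ℝ → E} (hy : ∀ t ∈ Icc a b, HasDerivWithinAt y (y' t) (Icc a b) t)
    (ha : ∀ p, c p < ℓ p (y a))
    (hbd : ∀ t ∈ Icc a b, (∀ p, c p ≤ ℓ p (y t)) → ∀ p, ℓ p (y t) = c p → 0 < ℓ p (y' t)) :
    ∀ t ∈ Icc a b, ∀ p, c p < ℓ p (y t) := by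
  by_contra hcon
  push Not at hcon
  obtain ⟨t₁, ht₁, p₁, hp₁⟩ := hcon
  have hyc : ContinuousOn y (Icc a b) := fun t ht => (hy t ht).continuousWithinAt
  have hyr : Continuous fun t : Icc a b => y t := continuousOn_iff_continuous_domRestrict.1 hyc
  let S : Set (Icc a b × P) := {z | ℓ z.2 (y z.1) ≤ c z.2}
  have hS : IsClosed S := by
    refine isClosed_le ?_ (hc.comp continuous_snd)
    exact hℓ.comp (continuous_snd.prodMk (hyr.comp continuous_fst))
  have hB : IsCompact ((fun z : Icc a b × P => (z.1 : ℝ)) '' S) :=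
    hS.isCompact.image (continuous_subtype_val.comp continuous_fst)
  obtain ⟨t, ⟨⟨⟨s, p⟩, hsp, hst⟩, hleast⟩⟩ :=
    hB.exists_isLeast ⟨t₁, ⟨⟨t₁, ht₁⟩, p₁⟩, hp₁, rfl⟩
  have ht : t ∈ Icc a b := hst ▸ s.2
  have hpt : ℓ p (y t) ≤ c p := by rw [← hst]; exact hsp
  have hbefore : ∀ r ∈ Icc a b, r < t → ∀ q, c q < ℓ q (y r) := by
    intro r hr hrt q
    by_contra hle
    exact absurd (hleast ⟨(⟨r, hr⟩, q), not_lt.1 hle, rfl⟩) (not_le.2 hrt)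
  have hat : a < t := by
    rcases ht.1.eq_or_lt with h | h
    · rw [← h] at hpt; exact absurd (ha p) (not_lt.2 hpt)
    · exact h
  have hsub : Icc a t ⊆ Icc a b := Icc_subset_Icc_right ht.2
  have hlim : ∀ q, c q ≤ ℓ q (y t) := by
    intro q
    have h1 : ContinuousOn (fun r => ℓ q (y r)) (Icc a t) :=
      (ℓ q).continuous.comp_continuousOn (hyc.mono hsub)
    have h3 : t ∈ closure (Ico a t) := by
      rw [closure_Ico hat.ne]; exact right_mem_Icc.2 hat.le
    have h4 : Filter.Tendsto (fun r => ℓ q (y r)) (nhdsWithin t (Ico a t))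
        (nhds (ℓ q (y t))) := (h1 t (right_mem_Icc.2 hat.le)).mono Ico_subset_Icc_self
    have := mem_closure_iff_nhdsWithin_neBot.1 h3
    refine ge_of_tendsto h4 ?_
    filter_upwards [self_mem_nhdsWithin] with r hr
    exact (hbefore r (hsub (Ico_subset_Icc_self hr)) hr.2 q).le
  have heq : ℓ p (y t) = c p := le_antisymm hpt (hlim p)
  have hder : HasDerivWithinAt (fun r => ℓ p (y r) - c p) (ℓ p (y' t)) (Icc a t) t :=
    ((ℓ p).hasFDerivAt.comp_hasDerivWithinAt t ((hy t ht).mono hsub)).sub_const _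
  have := deriv_nonpos_of_left hat hder (fun r hr => by
    rcases hr.2.eq_or_lt with h | h
    · rw [h]; exact sub_nonneg.2 (hlim p)
    · exact sub_nonneg.2 (hbefore r (hsub hr) h p).le) (by rw [heq, sub_self])
  exact absurd (hbd t ht hlim p heq) (not_lt.2 this)

/-- A set cut out by a compact family of affine inequalities is invariant under a vector field which,
at every point where one of the inequalities is an equality, points into the corresponding
half-space. The direction `e` points strictly into all the half-spaces, and is used to push the
solution into the interior. -/
theorem forall_le_of_solution (hℓ : Continuous fun z : P × E => ℓ z.1 z.2) (hc : Continuous c)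
    (hD : Continuous D) (hF : ∀ x h, F (x + h • e) = F x + h • D (x, h)) (hη : 0 < η)
    (he : ∀ p, η ≤ ℓ p e)
    (hbd : ∀ x, (∀ p, c p ≤ ℓ p x) → ∀ p, ℓ p x = c p → 0 ≤ ℓ p (F x))
    (hx : ∀ t ∈ Icc a b, HasDerivWithinAt x (F (x t)) (Icc a b) t) (h0 : ∀ p, c p ≤ ℓ p (x a)) :
    ∀ t ∈ Icc a b, ∀ p, c p ≤ ℓ p (x t) := by
  intro t ht p
  have hxc : ContinuousOn x (Icc a b) := fun t ht => (hx t ht).continuousWithinAt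
  have hxr : Continuous fun t : Icc a b => x t := continuousOn_iff_continuous_domRestrict.1 hxc
  obtain ⟨M, hM⟩ : ∃ M, ∀ p, ∀ s ∈ Icc a b, ∀ h ∈ Icc (0 : ℝ) 1, ℓ p (D (x s, h)) ≤ M := by
    have hcont : Continuous fun z : P × Icc a b × Icc (0 : ℝ) 1 => ℓ z.1 (D (x z.2.1, z.2.2)) :=
      hℓ.comp (continuous_fst.prodMk (hD.comp ((hxr.comp (continuous_fst.comp continuous_snd)).prodMk
        (continuous_subtype_val.comp (continuous_snd.comp continuous_snd)))))
    obtain ⟨M, hM⟩ := (isCompact_range hcont).bddAbove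
    exact ⟨M, fun p s hs h hh => hM ⟨(p, ⟨s, hs⟩, ⟨h, hh⟩), rfl⟩⟩
  set L := (|M| + 1) / η with hL
  have hL0 : 0 ≤ L := by positivity
  have hLη : L * η = |M| + 1 := by rw [hL]; field_simp
  have key : ∀ ε : ℝ, 0 < ε → ε * Real.exp (L * (b - a)) ≤ 1 →
      c p ≤ ℓ p (x t) + ε * (Real.exp (L * (t - a)) * ℓ p e) := by
    intro ε hε hε1
    let h : ℝ → ℝ := fun s => ε * Real.exp (L * (s - a))
    have hh : ∀ s ∈ Icc a b, h s ∈ Icc (0 : ℝ) 1 := by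
      intro s hs
      refine ⟨by positivity, le_trans ?_ hε1⟩
      refine mul_le_mul_of_nonneg_left (Real.exp_le_exp.2 ?_) hε.le
      exact mul_le_mul_of_nonneg_left (by linarith [hs.2]) hL0
    have hh0 : ∀ s, 0 < h s := fun s => by positivity
    have hhd : ∀ s, HasDerivAt h (L * h s) s := by
      intro s
      have h1 : HasDerivAt (fun s => L * (s - a)) L s := by
        simpa using ((hasDerivAt_id s).sub_const a).const_mul L
      have h2 := (h1.exp).const_mul ε
      have h3 : ε * (Real.exp (L * (s - a)) * L) = L * h s := by simp only [h]; ring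
      rwa [h3] at h2
    have := forall_lt_of_inward (y := fun s => x s + h s • e) (c := c)
      (y' := fun s => F (x s) + (L * h s) • e) hℓ hc
      (fun s hs => (hx s hs).add ((hhd s).hasDerivWithinAt.smul_const e)) (fun q => by
        have h1 := mul_pos (hh0 a) (hη.trans_le (he q))
        simp only [map_add, map_smul, smul_eq_mul]
        linarith [h0 q]) (fun s hs hge q hq => by
        have h1 := hbd _ hge q hq
        rw [hF] at h1
        simp only [map_add, map_smul, smul_eq_mul] at h1 ⊢
        have h2 := mul_le_mul_of_nonneg_left (hM q s hs (h s) (hh s hs)) (hh0 s).le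
        have h3 := mul_le_mul_of_nonneg_left (he q) (mul_nonneg hL0 (hh0 s).le)
        have h4 : L * h s * η = h s * |M| + h s := by
          calc L * h s * η = h s * (L * η) := by ring
            _ = _ := by rw [hLη]; ring
        have h5 := mul_le_mul_of_nonneg_left (le_abs_self M) (hh0 s).le
        linarith [hh0 s]) t ht p
    simp only [map_add, map_smul, smul_eq_mul, h] at this
    linarith
  -- let `ε` tend to zero
  have hlim : Filter.Tendsto (fun ε : ℝ => ℓ p (x t) + ε * (Real.exp (L * (t - a)) * ℓ p e))
      (nhdsWithin 0 (Ioi 0)) (nhds (ℓ p (x t))) := by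
    have h1 : Continuous fun ε : ℝ => ℓ p (x t) + ε * (Real.exp (L * (t - a)) * ℓ p e) := by
      fun_prop
    have h2 := h1.tendsto 0
    rw [zero_mul, add_zero] at h2
    exact h2.mono_left nhdsWithin_le_nhds
  refine ge_of_tendsto hlim ?_
  have hpos : 0 < Real.exp (-(L * (b - a))) := Real.exp_pos _
  filter_upwards [Ioo_mem_nhdsGT hpos] with ε hε
  refine key ε hε.1 ?_
  have h1 := mul_le_mul_of_nonneg_right hε.2.le (Real.exp_pos (L * (b - a))).le
  rwa [← Real.exp_add, neg_add_cancel, Real.exp_zero] at h1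

end

section

/-! ### The pinched sets as intersections of half-spaces -/

theorem rotate_add (A : Matrix (Fin n) (Fin n) ℝ) (R S : CurvTensor n) :
    rotate A (R + S) = rotate A R + rotate A S :=
  CurvTensor.ext_comp fun i j k l => by
    rw [comp_add, comp_rotate, comp_rotate, comp_rotate]
    simp only [CurvTensor.eval, ← arrayEval_add]
    rfl

theorem rotate_smul (A : Matrix (Fin n) (Fin n) ℝ) (r : ℝ) (R : CurvTensor n) :
    rotate A (r • R) = r • rotate A R :=
  CurvTensor.ext_comp fun i j k l => by
    rw [comp_smul, comp_rotate, comp_rotate]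
    simp only [CurvTensor.eval, ← arrayEval_smul]
    rfl

theorem idKNid_eq_knId : idKNid n = knId 1 Matrix.isSymm_one :=
  CurvTensor.ext_comp fun i j k l => by
    rw [comp_knId]
    simp only [idKNid, CurvTensor.comp, kulkarniNomizu, Matrix.one_apply]

theorem rotate_idKNid {A : Matrix (Fin n) (Fin n) ℝ} (hA : A ∈ Matrix.orthogonalGroup (Fin n) ℝ) :
    rotate A (idKNid n) = idKNid n := by
  have h1 : ∀ x z : Fin n → ℝ, ∑ i, ∑ k, (1 : Matrix (Fin n) (Fin n) ℝ) i k * x i * z k = x ⬝ᵥ z := by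
    intro x z; simp [Matrix.one_apply, dotProduct]
  refine CurvTensor.ext_comp fun i j k l => ?_
  rw [comp_rotate, idKNid_eq_knId, eval_knId, comp_knId]
  simp only [h1, orthogonal_row hA]
  simp only [Matrix.one_apply]

theorem ricci_idKNid (i : Fin n) : ricci (idKNid n) i i = 2 * (n - 1) := by
  rw [idKNid_eq_knId, ricci_knId, Matrix.one_apply_eq, if_pos rfl, Matrix.trace_one,
    Fintype.card_fin]
  ring

theorem scal_idKNid : scal (idKNid n) = 2 * (n * (n - 1)) := by
  simp only [scal, ricci_idKNid, Finset.sum_const, Finset.card_univ, Fintype.card_fin, nsmul_eq_mul]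
  ring

theorem comp_idKNid_sectional {i j : Fin n} (h : i ≠ j) : (idKNid n).comp i j i j = 2 := by
  rw [idKNid_eq_knId, comp_knId]
  simp [h, h.symm]
  norm_num

theorem isoComp_idKNid {i j k l : Fin n} (h : Function.Injective ![i, j, k, l]) :
    isoComp (idKNid n) i j k l = 8 := by
  have hij : i ≠ j := fun e => absurd (@h 0 1 e) (by decide)
  have hik : i ≠ k := fun e => absurd (@h 0 2 e) (by decide)
  have hil : i ≠ l := fun e => absurd (@h 0 3 e) (by decide)
  have hjk : j ≠ k := fun e => absurd (@h 1 2 e) (by decide)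
  have hjl : j ≠ l := fun e => absurd (@h 1 3 e) (by decide)
  have h0 : (idKNid n).comp i j k l = 0 := by
    rw [idKNid_eq_knId, comp_knId]; simp [hik, hil, hjk, hjl]
  rw [isoComp, comp_idKNid_sectional hik, comp_idKNid_sectional hil, comp_idKNid_sectional hjk,
    comp_idKNid_sectional hjl, h0]
  norm_num

theorem continuous_comp (i j k l : Fin n) : Continuous fun R : CurvTensor n => R.comp i j k l :=
  (continuous_apply l).comp <| (continuous_apply k).comp <| (continuous_apply j).comp <|
    (continuous_apply i).comp continuous_subtype_val

theorem continuous_iff_comp {X : Type*} [TopologicalSpace X] {f : X → CurvTensor n} :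
    Continuous f ↔ ∀ i j k l, Continuous fun x => (f x).comp i j k l := by
  refine ⟨fun h i j k l => (continuous_comp i j k l).comp h, fun h => ?_⟩
  refine continuous_induced_rng.2 ?_
  exact continuous_pi fun i => continuous_pi fun j => continuous_pi fun k => continuous_pi fun l =>
    h i j k l

theorem continuous_Q : Continuous (Q : CurvTensor n → CurvTensor n) := by
  rw [continuous_iff_comp]
  intro i j k l
  have := @continuous_comp n
  simp only [comp_Q, auxB]
  fun_prop

theorem continuous_rotate :
    Continuous fun z : Matrix (Fin n) (Fin n) ℝ × CurvTensor n => rotate z.1 z.2 := by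
  rw [continuous_iff_comp]
  intro i j k l
  have h1 : ∀ p q r s, Continuous fun z : Matrix (Fin n) (Fin n) ℝ × CurvTensor n =>
      z.2.comp p q r s := fun p q r s => (continuous_comp p q r s).comp continuous_snd
  have h2 : ∀ p q, Continuous fun z : Matrix (Fin n) (Fin n) ℝ × CurvTensor n => z.1 p q :=
    fun p q => (continuous_apply_apply p q).comp continuous_fst
  change Continuous fun z : Matrix (Fin n) (Fin n) ℝ × CurvTensor n =>
    ∑ p, ∑ q, ∑ r, ∑ s, z.1 i p * z.1 j q * z.1 k r * z.1 l s * z.2.comp p q r s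
  fun_prop

/-- `Q` along a line; since `Q` is quadratic, the difference quotient is a polynomial in the base point and
the step. -/
theorem Q_add_smul (R S : CurvTensor n) (h : ℝ) :
    Q (R + h • S) = Q R + h • ((Q (R + S) - Q R - Q S) + h • Q S) := by
  have key : ∀ i j k l, auxB (R + h • S) i j k l = auxB R i j k l
      + h * (auxB (R + S) i j k l - auxB R i j k l - auxB S i j k l + h * auxB S i j k l) := by
    intro i j k l
    simp only [auxB, comp_add, comp_smul, Finset.mul_sum, ← Finset.sum_add_distrib,
      ← Finset.sum_sub_distrib]
    refine Finset.sum_congr rfl fun p _ => Finset.sum_congr rfl fun q _ => ?_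
    ring
  refine CurvTensor.ext_comp fun i j k l => ?_
  simp only [comp_Q, comp_add, comp_sub, comp_smul, key]
  ring

theorem isCompact_orthogonalGroup :
    IsCompact (Matrix.orthogonalGroup (Fin n) ℝ : Set (Matrix (Fin n) (Fin n) ℝ)) := by
  have hK : IsCompact (Set.pi univ fun _ : Fin n => Set.pi univ fun _ : Fin n => Icc (-1 : ℝ) 1) :=
    isCompact_univ_pi fun _ => isCompact_univ_pi fun _ => isCompact_Icc
  refine hK.of_isClosed_subset ?_ ?_
  · have : (Matrix.orthogonalGroup (Fin n) ℝ : Set (Matrix (Fin n) (Fin n) ℝ))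
        = {A | A * star A = 1} := by
      ext A; exact Matrix.mem_orthogonalGroup_iff (Fin n) ℝ
    rw [this]
    exact isClosed_eq (continuous_id.matrix_mul continuous_star) continuous_const
  · intro A hA i _ j _
    have h1 := orthogonal_row hA i i
    rw [if_pos rfl, dotProduct] at h1
    have h2 : A i j * A i j ≤ 1 := by
      rw [← h1]
      exact Finset.single_le_sum (f := fun j => A i j * A i j) (fun j _ => mul_self_nonneg _)
        (Finset.mem_univ j)
    exact abs_le.1 (abs_le_one_iff_mul_self_le_one.2 h2)

/-- The index set of the pinching conditions: quadruples of distinct indices for the isotropic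
curvature condition and, for each of the two Ricci conditions, pairs of distinct indices. -/
abbrev PinchIndex (n : ℕ) : Type :=
  {v : Fin n × Fin n × Fin n × Fin n // Function.Injective ![v.1, v.2.1, v.2.2.1, v.2.2.2]} ⊕
    ({v : Fin n × Fin n // v.1 ≠ v.2} × Bool)

/-- The functionals defining the pinching conditions. -/
noncomputable def pinchFun (b : ℝ) : PinchIndex n → CurvTensor n → ℝ
  | .inl v, R => isoPinch b ((1 / 2 + 1 / (4 * n)) * b ^ 2) R v.1.1 v.1.2.1 v.1.2.2.1 v.1.2.2.2
  | .inr (v, true), R => ricPinch (2 * (n - 2) * b) ((2 - 1 / (8 * n)) * b) R v.1.1 v.1.2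
  | .inr (v, false), R => ricPinch 0 ((2 - 1 / (4 * n)) * b) R v.1.1 v.1.2

/-- The lower bounds in the pinching conditions. -/
def pinchBound (κ N : ℝ) : PinchIndex n → ℝ
  | .inl _ => 8 * κ
  | .inr _ => -N

variable {b κ N : ℝ}

theorem isPinched_iff {R : CurvTensor n} :
    IsPinched b κ N R ↔ ∀ a, pinchBound κ N a ≤ pinchFun b a R := by
  constructor
  · rintro h (v | ⟨v, _ | _⟩)
    · exact h.iso _ _ _ _ v.2
    · exact h.ric _ _ v.2
    · exact h.ric_sec _ _ v.2
  · intro h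
    exact ⟨fun i j k l hv => h (.inl ⟨(i, j, k, l), hv⟩), fun i j hv => h (.inr (⟨(i, j), hv⟩, true)),
      fun i j hv => h (.inr (⟨(i, j), hv⟩, false))⟩

theorem pinchFun_add (a : PinchIndex n) (R S : CurvTensor n) :
    pinchFun b a (R + S) = pinchFun b a R + pinchFun b a S := by
  rcases a with v | ⟨v, _ | _⟩ <;>
  · simp only [pinchFun, isoPinch, ricPinch, isoComp, traceFour, comp_add, ricci_add, scal_add]
    ring

theorem pinchFun_smul (a : PinchIndex n) (r : ℝ) (R : CurvTensor n) :
    pinchFun b a (r • R) = r * pinchFun b a R := by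
  rcases a with v | ⟨v, _ | _⟩ <;>
  · simp only [pinchFun, isoPinch, ricPinch, isoComp, traceFour, comp_smul, ricci_smul, scal_smul]
    ring

theorem one_le_pinchFun_idKNid (hp : SmallParams n b κ N) (a : PinchIndex n) :
    1 ≤ pinchFun b a (idKNid n) := by
  have hn := hp.five_le
  have hb := hp.b_pos
  have hb1 := hp.pow_mul_le (m := 1) (by norm_num)
  have hn1 : (0 : ℝ) ≤ n * (n - 1) := mul_nonneg (by linarith) (by linarith)
  have hric : ∀ ω : ℝ, ω ≤ 2 * b → 1 ≤ 2 * (2 * ((n : ℝ) - 1)) - ω * (2 * (n * (n - 1))) := by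
    intro ω hω
    have h1 := mul_le_mul_of_nonneg_right hω (show 0 ≤ 2 * ((n : ℝ) * (n - 1)) by linarith)
    have h2 := mul_le_mul_of_nonneg_right hb1 (show 0 ≤ (n : ℝ) - 1 by linarith)
    linarith
  rcases a with v | ⟨v, _ | _⟩
  · simp only [pinchFun, isoPinch, traceFour, isoComp_idKNid v.2, ricci_idKNid, scal_idKNid]
    have : 0 ≤ 8 * ((1 / 2 + 1 / (4 * (n : ℝ))) * b ^ 2) * (2 * (n * (n - 1))) := by positivity
    linarith
  · simp only [pinchFun, ricPinch, ricci_idKNid, scal_idKNid, comp_idKNid_sectional v.2]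
    have : 0 ≤ 1 / (4 * (n : ℝ)) * b := by positivity
    linarith [hric ((2 - 1 / (4 * n)) * b) (by linarith)]
  · simp only [pinchFun, ricPinch, ricci_idKNid, scal_idKNid, comp_idKNid_sectional v.2]
    have h1 : 0 ≤ 1 / (8 * (n : ℝ)) * b := by positivity
    have h2 : 0 ≤ ((n : ℝ) - 2) * b * (n - 2) :=
      mul_nonneg (mul_nonneg (by linarith) hb.le) (by linarith)
    linarith [hric ((2 - 1 / (8 * n)) * b) (by linarith)]

theorem pinchFun_Q_nonneg (hp : SmallParams n b κ N) {R : CurvTensor n}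
    (hR : R ∈ pinchedSet n b κ N) (a : PinchIndex n) (h : pinchFun b a R = pinchBound κ N a) :
    0 ≤ pinchFun b a (Q R) := by
  rcases a with v | ⟨v, _ | _⟩
  · exact isoPinch_Q_nonneg hp hR v.2 h
  · exact ricPinch_Q_nonneg hp hR v.2 h
  · exact ricPinch_sec_Q_nonneg hp hR v.2 h

theorem continuous_pinchFun (a : PinchIndex n) :
    Continuous fun R : CurvTensor n => pinchFun b a R := by
  have := @continuous_comp n
  rcases a with v | ⟨v, _ | _⟩ <;>
  · simp only [pinchFun, isoPinch, ricPinch, isoComp, traceFour, scal, ricci]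
    fun_prop

/-- The functional `R ↦ pinchFun b a (rotate A R)`. -/
noncomputable def pinchCLM (b : ℝ) (z : Matrix.orthogonalGroup (Fin n) ℝ × PinchIndex n) :
    CurvTensor n →L[ℝ] ℝ :=
  LinearMap.toContinuousLinearMap
    { toFun := fun R => pinchFun b z.2 (rotate z.1 R)
      map_add' := fun R S => by rw [rotate_add, pinchFun_add]
      map_smul' := fun r R => by rw [rotate_smul, pinchFun_smul]; rfl }

theorem mem_pinchedSet_iff {R : CurvTensor n} : R ∈ pinchedSet n b κ N ↔
    ∀ z : Matrix.orthogonalGroup (Fin n) ℝ × PinchIndex n, pinchBound κ N z.2 ≤ pinchCLM b z R := by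
  constructor
  · intro h z
    exact isPinched_iff.1 (h z.1 z.1.2) z.2
  · intro h A hA
    exact isPinched_iff.2 fun a => h (⟨A, hA⟩, a)

theorem continuous_pinchCLM : Continuous fun z : (Matrix.orthogonalGroup (Fin n) ℝ × PinchIndex n) ×
    CurvTensor n => pinchCLM b z.1 z.2 := by
  have h1 : Continuous fun z : PinchIndex n × CurvTensor n => pinchFun b z.1 z.2 := by
    rw [continuous_prod_of_discrete_left]
    intro a
    exact continuous_pinchFun a
  have h2 : Continuous fun z : (Matrix.orthogonalGroup (Fin n) ℝ × PinchIndex n) × CurvTensor n =>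
      ((z.1.1 : Matrix (Fin n) (Fin n) ℝ), z.2) :=
    (continuous_subtype_val.comp (continuous_fst.comp continuous_fst)).prodMk continuous_snd
  have h3 := (continuous_rotate (n := n)).comp h2
  have h4 : Continuous fun z : (Matrix.orthogonalGroup (Fin n) ℝ × PinchIndex n) × CurvTensor n =>
      (z.1.2, rotate z.1.1 z.2) := (continuous_snd.comp continuous_fst).prodMk h3
  exact h1.comp h4

theorem isClosed_pinchedSet : IsClosed (pinchedSet n b κ N) := by
  have : pinchedSet n b κ N = ⋂ z, {R | pinchBound κ N z.2 ≤ pinchCLM b z R} := by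
    ext R; simp only [mem_iInter]; exact mem_pinchedSet_iff
  rw [this]
  exact isClosed_iInter fun z => isClosed_le continuous_const (pinchCLM b z).continuous

theorem convex_pinchedSet : Convex ℝ (pinchedSet n b κ N) := by
  have : pinchedSet n b κ N = ⋂ z, {R | pinchBound κ N z.2 ≤ pinchCLM b z R} := by
    ext R; simp only [mem_iInter]; exact mem_pinchedSet_iff
  rw [this]
  exact convex_iInter fun z => convex_halfSpace_ge (pinchCLM b z).toLinearMap.isLinear _

theorem nonempty_pinchedSet (hp : SmallParams n b κ N) : (pinchedSet n b κ N).Nonempty := by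
  refine ⟨(8 * κ) • idKNid n, fun A hA => isPinched_iff.2 fun a => ?_⟩
  rw [rotate_smul, rotate_idKNid hA, pinchFun_smul]
  have h1 := mul_le_mul_of_nonneg_left (one_le_pinchFun_idKNid hp a)
    (show 0 ≤ 8 * κ by linarith [hp.κ_pos])
  refine le_trans ?_ h1
  rcases a with v | v
  · exact (mul_one _).ge
  · change -N ≤ _
    linarith [hp.N_nonneg, hp.κ_pos]

/-- The pinched sets are invariant under the Hamilton ODE. -/
theorem mem_pinchedSet_of_solution (hp : SmallParams n b κ N) {t₀ t₁ : ℝ} {R : ℝ → CurvTensor n}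
    (hR : SolvesHamiltonODE t₀ t₁ R) (h0 : R t₀ ∈ pinchedSet n b κ N) :
    ∀ t ∈ Icc t₀ t₁, R t ∈ pinchedSet n b κ N := by
  have : CompactSpace (Matrix.orthogonalGroup (Fin n) ℝ) :=
    isCompact_iff_compactSpace.1 isCompact_orthogonalGroup
  have hc : Continuous fun z : Matrix.orthogonalGroup (Fin n) ℝ × PinchIndex n =>
      pinchBound κ N z.2 := (continuous_of_discreteTopology (f := pinchBound κ N)).comp continuous_snd
  intro t ht
  rw [mem_pinchedSet_iff] at h0 ⊢
  refine forall_le_of_solution (F := Q) (e := idKNid n) (η := 1)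
    (D := fun z => (Q (z.1 + idKNid n) - Q z.1 - Q (idKNid n)) + z.2 • Q (idKNid n))
    continuous_pinchCLM hc ?_ (fun R h => Q_add_smul R (idKNid n) h) one_pos ?_ ?_ hR h0 t ht
  · have := @continuous_Q n
    fun_prop
  · intro z
    change 1 ≤ pinchFun b z.2 (rotate z.1 (idKNid n))
    rw [rotate_idKNid z.1.2]
    exact one_le_pinchFun_idKNid hp z.2
  · intro S hS z hz
    have hS' := rotate_mem_pinchedSet (mem_pinchedSet_iff.2 hS) z.1.2
    change 0 ≤ pinchFun b z.2 (rotate z.1 (Q S))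
    rw [← Q_rotate z.1.2]
    exact pinchFun_Q_nonneg hp hS' z.2 hz

end

/-! ### Compact subsets of the interior of PIC -/

theorem rotate_sub (A : Matrix (Fin n) (Fin n) ℝ) (R S : CurvTensor n) :
    rotate A (R - S) = rotate A R - rotate A S := by
  rw [sub_eq_add_neg, ← neg_one_smul ℝ S, rotate_add, rotate_smul,
    neg_one_smul ℝ (rotate A S), ← sub_eq_add_neg]

theorem isoComp_smul (r : ℝ) (R : CurvTensor n) (i j k l : Fin n) :
    isoComp (r • R) i j k l = r * isoComp R i j k l := by
  simp only [isoComp, comp_smul]; ring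

/-- A compact subset of the interior of `PIC` stays in `PIC` after subtracting a small multiple of
`id ∧ id`. -/
theorem exists_sub_smul_mem_PIC {K : Set (CurvTensor n)} (hK : IsCompact K)
    (hKPIC : K ⊆ interior (PIC n)) : ∃ μ : ℝ, 0 < μ ∧ ∀ R ∈ K, R - μ • idKNid n ∈ PIC n := by
  obtain ⟨r, hr, hsub⟩ := hK.exists_thickening_subset_open isOpen_interior hKPIC
  have h1 : 0 < ‖idKNid n‖ + 1 := by positivity
  refine ⟨r / (‖idKNid n‖ + 1), by positivity, fun R hR => interior_subset (hsub ?_)⟩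
  rw [Metric.mem_thickening_iff]
  refine ⟨R, hR, ?_⟩
  rw [dist_eq_norm, sub_sub_cancel_left, norm_neg, norm_smul, Real.norm_of_nonneg (by positivity),
    div_mul_eq_mul_div, div_lt_iff₀ h1]
  linarith

theorem continuous_scal : Continuous fun R : CurvTensor n => scal R := by
  have := @continuous_comp n
  simp only [scal, ricci]
  fun_prop

/-- A compact set in the interior of PIC lies in a pinched set with small parameters. -/
theorem exists_subset_pinchedSet (hn : 5 ≤ n) {K : Set (CurvTensor n)} (hK : IsCompact K)
    (hKPIC : K ⊆ interior (PIC n)) :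
    ∃ b κ N : ℝ, 0 < N ∧ SmallParams n b κ N ∧ K ⊆ pinchedSet n b κ N := by
  obtain ⟨μ, hμ, hKμ⟩ := exists_sub_smul_mem_PIC hK hKPIC
  obtain ⟨s₀, hs₀⟩ := (hK.image continuous_scal).bddAbove
  set s := max s₀ 1 with hs
  have hs1 : 1 ≤ s := le_max_right _ _
  have hKs : ∀ R ∈ K, scal R ≤ s := fun R hR => (hs₀ ⟨R, hR, rfl⟩).trans (le_max_left _ _)
  have hn5 : (5 : ℝ) ≤ n := by exact_mod_cast hn
  set κ := μ / 2 with hκ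
  set N := 8 * s with hN
  have hN0 : 0 < N := by linarith
  have hκ0 : 0 < κ := by positivity
  set b := min (min (κ / s) (1 / (10 ^ 7 * (n : ℝ) ^ 5)))
    (min (κ / (1000 * n * N)) (κ ^ 2 / (8 * N ^ 2))) with hb
  have hb0 : 0 < b := by rw [hb]; simp only [lt_min_iff]; refine ⟨⟨?_, ?_⟩, ?_, ?_⟩ <;> positivity
  have hb1 : b * s ≤ κ := by
    rw [← le_div_iff₀ (by positivity)]; exact (min_le_left _ _).trans (min_le_left _ _)
  have hb2 : b * (10 ^ 7 * (n : ℝ) ^ 5) ≤ 1 := by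
    rw [← le_div_iff₀ (by positivity)]; exact (min_le_left _ _).trans (min_le_right _ _)
  have hb3 : b * (1000 * n * N) ≤ κ := by
    rw [← le_div_iff₀ (by positivity)]; exact (min_le_right _ _).trans (min_le_left _ _)
  have hb4 : b * (8 * N ^ 2) ≤ κ ^ 2 := by
    rw [← le_div_iff₀ (by positivity)]; exact (min_le_right _ _).trans (min_le_right _ _)
  have hp : SmallParams n b κ N :=
    ⟨hn, hb0, hκ0, hN0.le, by linarith, by linarith, by linarith⟩
  refine ⟨b, κ, N, hN0, hp, fun R hRK A hA => ?_⟩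
  have hR : rotate A R ∈ PIC n := rotate_mem_PIC (interior_subset (hKPIC hRK)) hA
  have hRμ : rotate A R - μ • idKNid n ∈ PIC n := by
    have := rotate_mem_PIC (hKμ R hRK) hA
    rwa [rotate_sub, rotate_smul, rotate_idKNid hA] at this
  have hscal : scal (rotate A R) ≤ s := by rw [scal_rotate hA]; exact hKs R hRK
  have hscal0 := scal_nonneg hn hR
  have hle := fun i => ricci_le_scal hn hR i
  have hge := fun i => neg_scal_le_ricci hn hR i
  generalize rotate A R = S at *
  have hbs : b * scal S ≤ κ := (mul_le_mul_of_nonneg_left hscal hb0.le).trans hb1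
  have hbs0 : 0 ≤ b * scal S := mul_nonneg hb0.le hscal0
  have hric : ∀ i j δ ω, i ≠ j → 0 ≤ δ → ω ≤ 2 * b → -N ≤ ricPinch δ ω S i j := by
    intro i j δ ω hij hδ hω
    have h1 := mul_nonneg hδ (ricci_pair_ge hn hR hij)
    have h2 := mul_le_mul_of_nonneg_right hω hscal0
    have h3 := mul_le_mul_of_nonneg_right (show 2 * b ≤ 2 by linarith [hp.b_le]) hscal0
    unfold ricPinch
    linarith [hge i, hge j]
  refine ⟨fun i j k l h => ?_, fun i j hij => hric i j _ _ hij ?_ ?_,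
    fun i j hij => hric i j _ _ hij le_rfl ?_⟩
  · have h1 := isoComp_nonneg hRμ h
    rw [isoComp_sub, isoComp_smul, isoComp_idKNid h] at h1
    have h2 : 0 ≤ 8 * ((1 / 2 + 1 / (4 * (n : ℝ))) * b ^ 2) * scal S := by positivity
    have h3 := mul_le_mul_of_nonneg_left
      (show traceFour S i j k l ≤ 4 * scal S by
        unfold traceFour; linarith [hle i, hle j, hle k, hle l]) hb0.le
    unfold isoPinch
    linarith
  · exact mul_nonneg (by linarith) hb0.le
  · have : 0 ≤ 1 / (8 * (n : ℝ)) * b := by positivity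
    linarith
  · have : 0 ≤ 1 / (4 * (n : ℝ)) * b := by positivity
    linarith

theorem sub_smul_mem_PIC_of_mem_pinchedSet {b κ N : ℝ} (hp : SmallParams n b κ N) {R : CurvTensor n}
    (hR : R ∈ pinchedSet n b κ N) : R - (b ^ 2 / 4 * scal R) • idKNid n ∈ PIC n := by
  have hf : Function.Injective (Fin.castLE (show 4 ≤ n by linarith [hp.dim])) :=
    Fin.castLE_injective _
  rw [mem_PIC_iff_rotate hf]
  intro A hA
  have hinj : Function.Injective ![Fin.castLE (show 4 ≤ n by linarith [hp.dim]) 0,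
      Fin.castLE (show 4 ≤ n by linarith [hp.dim]) 1, Fin.castLE (show 4 ≤ n by linarith [hp.dim]) 2,
      Fin.castLE (show 4 ≤ n by linarith [hp.dim]) 3] := by
    apply injective_four <;> exact fun h => absurd (hf h) (by decide)
  have h1 := isoComp_ge hp (rotate_mem_pinchedSet hR hA) hinj
  rw [scal_rotate hA] at h1
  rw [rotate_sub, rotate_smul, rotate_idKNid hA, isoComp_sub, isoComp_smul, isoComp_idKNid hinj]
  linarith

theorem ricciQuad_add_ge_of_mem_pinchedSet {b κ N : ℝ} (hp : SmallParams n b κ N) {R : CurvTensor n}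
    (hR : R ∈ pinchedSet n b κ N) {e : Fin 2 → EuclideanSpace ℝ (Fin n)} (he : Orthonormal ℝ e) :
    0 ≤ ricciQuad R (e 0) + ricciQuad R (e 1) - b ^ 2 / 4 * scal R + N := by
  have hf : Function.Injective (Fin.castLE (show 2 ≤ n by linarith [hp.dim])) :=
    Fin.castLE_injective _
  have hv : OrthoTuple fun a => (e a).ofLp := (orthonormal_toLp_iff _).1 he
  obtain ⟨A, hA, hAe⟩ := hv.exists_orthogonal hf
  have h1 := (hR A hA).ric _ _ (hf.ne (show (0 : Fin 2) ≠ 1 by decide))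
  unfold ricPinch at h1
  rw [ricci_rotate hA, ricci_rotate hA, scal_rotate hA, hAe, hAe] at h1
  rw [ricciQuad_eq, ricciQuad_eq]
  have hs : 0 ≤ scal R := hp.κ_pos.le.trans (scal_ge hp hR)
  have hb := hp.b_pos
  have h2 : b ^ 2 / 4 * scal R ≤ (2 - 1 / (4 * (n : ℝ))) * b * scal R := by
    refine mul_le_mul_of_nonneg_right ?_ hs
    have h3 := mul_le_mul_of_nonneg_right (show b ≤ 1 by linarith [hp.b_le]) hb.le
    have h4 := mul_le_mul_of_nonneg_right hp.coef_le.1 hb.le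
    linarith
  linarith

end AlgCurv

theorem theorem2p1 (n : ℕ) (hn : 5 ≤ n) (K : Set (AlgCurv.CurvTensor n)) (hK : IsCompact K)
    (hKPIC : K ⊆ interior (AlgCurv.PIC n)) (T : ℝ) (hT : 0 < T) :
    ∃ θ : ℝ, 0 < θ ∧ ∃ N : ℝ, 0 < N ∧ ∃ G : ℝ → Set (AlgCurv.CurvTensor n),
      (∀ t ∈ Set.Icc 0 T, (G t).Nonempty ∧ IsClosed (G t) ∧ Convex ℝ (G t) ∧
        AlgCurv.IsOrthogonallyInvariant (G t)) ∧
      AlgCurv.IsContinuousFamily T G ∧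
      AlgCurv.IsHamiltonInvariant T G ∧
      K ⊆ G 0 ∧
      ∀ t ∈ Set.Icc 0 T,
        G t ⊆ {R | R - (θ * AlgCurv.scal R) • AlgCurv.idKNid n ∈ AlgCurv.PIC n} ∩
          {R | ∀ e : Fin 2 → EuclideanSpace ℝ (Fin n), Orthonormal ℝ e →
            0 ≤ AlgCurv.ricciQuad R (e 0) + AlgCurv.ricciQuad R (e 1)
              - θ * AlgCurv.scal R + N} := by
  obtain ⟨b, κ, N, hN, hp, hsub⟩ := AlgCurv.exists_subset_pinchedSet hn hK hKPIC
  refine ⟨b ^ 2 / 4, div_pos (pow_pos hp.b_pos 2) four_pos, N, hN,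
    fun _ => AlgCurv.pinchedSet n b κ N, fun _ _ => ⟨AlgCurv.nonempty_pinchedSet hp,
      AlgCurv.isClosed_pinchedSet, AlgCurv.convex_pinchedSet,
      fun A hA R hR => AlgCurv.rotate_mem_pinchedSet hR hA⟩, ⟨?_, LowerHemicontinuousOn.const⟩,
    fun t₀ t₁ _ _ _ R hR h0 => AlgCurv.mem_pinchedSet_of_solution hp hR h0, hsub,
    fun _ _ R hR => ⟨AlgCurv.sub_smul_mem_PIC_of_mem_pinchedSet hp hR,
      fun e he => AlgCurv.ricciQuad_add_ge_of_mem_pinchedSet hp hR he⟩⟩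
  exact (isClosed_Icc.preimage continuous_fst).inter
    (AlgCurv.isClosed_pinchedSet.preimage continuous_snd)
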